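/- **Setting.** Let $D\ge 1$, let $(X_t,Y_t)_{t\ge 0}$ be i.i.d. with values in $\mathbb{R}^D\times\{1,\dots,c\}$ and law $\rho$, and assume that $X_t$ has a density with respect to Lebesgue measure; write $\mu$ for the law of $X_t$. Each time $t$ carries a type $I_t\in\{s,e\}$ (structure or estimation point). For an interval of time, $N^k(A)$ denotes the number of points of type $k$ which fall in $A\subseteq\mathbb{R}^D$ during it. Fix $m\ge 1$, a fringe size $F\ge 1$, $\lambda\ge 0$, $\tau\in\mathbb{R}$, a real function $G$ of two class histograms (for example the information gain), a nondecreasing $\alpha:\mathbb{N}\to(0,\infty)$ with $\alpha(d)\to\infty$ and $d/\alpha(d)\to 0$, and $\beta\ge\alpha$. **Online tree with a fringe of bounded size.** The tree starts as a single active leaf (of depth $0$) whose cell is $\mathbb{R}^D$. Every node has a random set of candidate dimensions: $\min(1+\mathrm{Poisson}(\lambda),D)$ distinct dimensions selected uniformly at random, independently over nodes and independently of the data and the types. When a structure point $X_t$ arrives in an active leaf $A$: 1. if $A$ has fewer than $m$ candidate split points, then for each candidate dimension $j$ a candidate split $x_j\le X_{t,j}$ / $x_j>X_{t,j}$ of $A$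 is created; the lifetime of its two candidate children begins at that time; 2. a candidate split is eligible if each of its two children has received at least $\alpha(d)$ estimation points since its creation, $d$ being the depth of $A$. If there are eligible candidates, let $S$ be one for which $G$ of the class histograms of the structure points in its two children (since its creation) is maximal. If this value is at least $\tau$, or if $A$ has received at least $\beta(d)$ estimation points in its lifetime, then $A$ is split at $S$: it is replaced by the two children, which are inactive leafs, and it leaves the fringe (the set of active leafs); 3. after a split, inactive leafs are activated, one with the largest $\hat s$ first, until the fringe contains $F$ leafs or no inactive leaf is left. Ties are broken by fixed rules. Nothing else changes the tree or the fringe. Here, for a leaf $A$ at a given time, $\hat s(A)=\hat p(A)\,\hat e(A)$, where, counting over the lifetime of $A$ up to that time, $\hat p(A)=N^e(A)/N^e(\mathbb{R}^D)$ and $\hat e(A)$ is the fraction of the $N^e(A)$ estimation points in $A$ whose class differs from the predicted class $g_t(A)$, the most frequent class among these points (the smallest such class in case of ties); $0/0=0$. The true score of $A$ at time $t$ is $$s(A)=p(A)\,e(A),\qquad p(A)=\mu(A),\qquad e(A)=\mathbb{P}\big(g_t(A)\ne Y\mid X\in A\big),$$ for a fresh pair $(X,Y)\sim\rho$. **Proposition.**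 Suppose either that $(I_t)$ is a fixed partitioning sequence, i.e. a deterministic sequence in which both types occur infinitely often, or that the $I_t$ are i.i.d., independent of everything else, with $\mathbb{P}(I_t=e)=p\in(0,1)$. Then every leaf with $s(A)>0$ is added to the fringe in finite time with arbitrarily high probability. That is, for every $t_0$, let $E_{t_0,T}$ be the event that every leaf $A$ of the tree at time $t_0$ with $s(A)>0$ (at time $t_0$) has been in the fringe at some time $t\le T$. Then * for every $\delta>0$ there is $T<\infty$ with $\mathbb{P}(E_{t_0,T})\ge 1-\delta$; * almost surely, for every $\delta>0$ there is $T<\infty$ (depending on the past) with $\mathbb{P}(E_{t_0,T}\mid\mathcal{H}_{t_0})\ge 1-\delta$, where $\mathcal{H}_{t_0}$ is generated by $(X_t,Y_t,I_t)_{t<t_0}$ and by the candidate dimensions of all nodes of depth at most $t_0$. -/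

import Mathlib

open MeasureTheory ProbabilityTheory Filter Topology
open scoped NNReal ENNReal

namespace OnlineForest

/-- The two streams into which the data points are split. -/
inductive PointType where
  | structural
  | estimation
  deriving DecidableEq

instance : MeasurableSpace PointType := ⊤

/-- A node of the (binary) tree is named by the list of turns leading to it from the root, the
last turn being the head of the list. The root is `[]`, the two children of `v` are `false :: v`
and `true :: v`, and the depth of `v` is `v.length`. -/
abbrev Node := List Bool

/-- A candidate split of a leaf: the coordinate `q.1` is cut at the projection of the data point
which arrived at time `q.2`; `q.2` is also the time at which the candidate is created. -/
abbrev Candidate (D : ℕ) := Fin D × ℕ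

/-- The parameters of the algorithm. -/
structure Params (c : ℕ) where
  /-- number of candidate split points per candidate dimension -/
  m : ℕ
  /-- maximal size of the fringe -/
  F : ℕ
  /-- number of estimation points needed in both candidate children to allow a split at depth `d` -/
  α : ℕ → ℝ
  /-- number of estimation points in a leaf at depth `d` which makes a split compulsory -/
  β : ℕ → ℝ
  /-- the structural statistic (e.g. the information gain) by which candidate splits are compared:
  a function of the class histograms of structure points in the two candidate children -/
  gain : (Fin c → ℕ) → (Fin c → ℕ) → ℝ
  /-- least value of the structural statistic for an optional split -/
  τ : ℝ

/-- Everything the construction of one tree uses: the points `X t`, their labels `Y t`, the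
stream `I t` they are assigned to, and the candidate dimensions drawn for each node. -/
structure Input (D c : ℕ) where
  X : ℕ → Fin D → ℝ
  Y : ℕ → Fin c
  I : ℕ → PointType
  dims : Node → Finset (Fin D)

/-- The state of the tree. -/
structure TreeState (D : ℕ) where
  /-- current leafs -/
  leaves : Finset Node
  /-- the active leafs -/
  fringe : Finset Node
  /-- the split which was made at a node, if it has been split -/
  split : Node → Option (Candidate D)
  /-- arrival times of the structure points which generate the candidate splits of a node -/
  points : Node → Finset ℕ

section Algorithm

variable {D c : ℕ}

/-- The part of the cell `A` on one side (`false`: left, `true`: right) of a candidate split. -/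
def side (inp : Input D c) (A : Set (Fin D → ℝ)) (q : Candidate D) : Bool → Set (Fin D → ℝ)
  | false => {x | x ∈ A ∧ x q.1 ≤ inp.X q.2 q.1}
  | true => {x | x ∈ A ∧ inp.X q.2 q.1 < x q.1}

/-- The rectangular cell of a node; the cell of the root is the whole space. -/
def cell (inp : Input D c) (s : TreeState D) : Node → Set (Fin D → ℝ)
  | [] => Set.univ
  | b :: v =>
    match s.split v with
    | some q => side inp (cell inp s v) q b
    | none => ∅

/-- The time at which the lifetime of a node begins, i.e. at which it was created as a candidate
child of its parent (`0` for the root). -/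
def birth (s : TreeState D) : Node → ℕ
  | [] => 0
  | _ :: v =>
    match s.split v with
    | some q => q.2
    | none => 0

open Classical in
/-- `N^k(A)` over the time interval `[a, b)`: the number of points of type `k` falling in `A`. -/
noncomputable def count (inp : Input D c) (k : PointType) (a b : ℕ) (A : Set (Fin D → ℝ)) : ℕ :=
  ((Finset.Ico a b).filter fun i => inp.I i = k ∧ inp.X i ∈ A).card

open Classical in
/-- The class histogram of the points of type `k` falling in `A` in the interval `[a, b)`. -/
noncomputable def hist (inp : Input D c) (k : PointType) (a b : ℕ) (A : Set (Fin D → ℝ)) :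
    Fin c → ℕ :=
  fun y => ((Finset.Ico a b).filter fun i => inp.I i = k ∧ inp.X i ∈ A ∧ inp.Y i = y).card

open Classical in
/-- The elements of `s` at which `f` is maximal over `s`. -/
noncomputable def argmaxSet {ι : Type*} (s : Finset ι) (f : ι → ℝ) : Finset ι :=
  s.filter fun x => ∀ y ∈ s, f y ≤ f x

open Classical in
/-- An element of `s` at which `f` is maximal over `s` (ties are broken by a fixed rule);
`none` if `s` is empty. -/
noncomputable def pickMax {ι : Type*} (s : Finset ι) (f : ι → ℝ) : Option ι :=
  if h : (argmaxSet s f).Nonempty then some h.choose else none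

/-- The majority class of a histogram, ties being broken in favour of smaller classes. -/
def majority [NeZero c] (h : Fin c → ℕ) : Fin c :=
  (Finset.univ.filter fun k => ∀ j, h j ≤ h k).min' (by
    obtain ⟨k, -, hk⟩ :=
      Finset.exists_max_image (Finset.univ : Finset (Fin c)) h ⟨0, Finset.mem_univ 0⟩
    exact ⟨k, by simpa using fun j => hk j (Finset.mem_univ j)⟩)

variable [NeZero c]

/-- The class which the tree predicts in the leaf `v` when the points before time `t` have been
processed: the majority class of the estimation points which arrived in `v` in its lifetime. -/
noncomputable def prediction (inp : Input D c) (s : TreeState D) (v : Node) (t : ℕ) : Fin c :=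
  majority (hist inp .estimation (birth s v) t (cell inp s v))

/-- `p̂(A)`: fraction of the estimation points arriving in the lifetime of the leaf that fall
in it. -/
noncomputable def pHat (inp : Input D c) (s : TreeState D) (v : Node) (t : ℕ) : ℝ :=
  (count inp .estimation (birth s v) t (cell inp s v) : ℝ) /
    (count inp .estimation (birth s v) t Set.univ : ℝ)

open Classical in
/-- `ê(A)`: fraction of the estimation points which fell in the leaf in its lifetime that the
current prediction in the leaf misclassifies. -/
noncomputable def eHat (inp : Input D c) (s : TreeState D) (v : Node) (t : ℕ) : ℝ :=
  (((Finset.Ico (birth s v) t).filter fun i => inp.I i = .estimation ∧ inp.X i ∈ cell inp s v ∧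
      inp.Y i ≠ prediction inp s v t).card : ℝ) /
    (count inp .estimation (birth s v) t (cell inp s v) : ℝ)

/-- `ŝ(A) = p̂(A) ê(A)`. -/
noncomputable def sHat (inp : Input D c) (s : TreeState D) (v : Node) (t : ℕ) : ℝ :=
  pHat inp s v t * eHat inp s v t

/-- The true score `s(A) = p(A) e(A)` of the leaf `v` at time `t`, where `p(A) = P(X ∈ A)` and
`e(A) = P(g_t(X) ≠ Y | X ∈ A)`, for a fresh pair `(X, Y)` with law `ρ`. -/
noncomputable def trueScore (ρ : Measure ((Fin D → ℝ) × Fin c)) (inp : Input D c)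
    (s : TreeState D) (v : Node) (t : ℕ) : ℝ :=
  ρ.real {z | z.1 ∈ cell inp s v} *
    (ProbabilityTheory.cond ρ {z | z.1 ∈ cell inp s v}).real {z | z.2 ≠ prediction inp s v t}

variable (prm : Params c)

open Classical in
/-- If the fringe is not full, activate the inactive leaf with the largest `ŝ`. -/
noncomputable def activateOne (inp : Input D c) (t : ℕ) (s : TreeState D) : TreeState D :=
  if s.fringe.card < prm.F then
    match pickMax (s.leaves \ s.fringe) (fun v => sHat inp s v t) with
    | some v => { s with fringe := insert v s.fringe }
    | none => s
  else s

/-- Activate inactive leafs, the one with the largest `ŝ` first, until the fringe is full or no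
inactive leaf is left. -/
noncomputable def refill (inp : Input D c) (t : ℕ) (s : TreeState D) : TreeState D :=
  (activateOne prm inp t)^[prm.F] s

/-- Split the leaf `v` at `q`: it leaves the fringe, its children are inactive leafs. -/
def splitLeaf (s : TreeState D) (v : Node) (q : Candidate D) : TreeState D where
  leaves := s.leaves.erase v ∪ {false :: v, true :: v}
  fringe := s.fringe.erase v
  split := Function.update s.split v (some q)
  points := s.points

open Classical in
/-- The candidate splits of `v` both children of which have received at least `α(depth)`
estimation points before time `t`. -/
noncomputable def eligible (inp : Input D c) (s : TreeState D) (v : Node) (t : ℕ) :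
    Finset (Candidate D) :=
  (inp.dims v ×ˢ s.points v).filter fun q =>
    ∀ b, prm.α v.length ≤ (count inp .estimation q.2 t (side inp (cell inp s v) q b) : ℝ)

/-- The structural statistic of a candidate split of `v`, after the points before time `t`. -/
noncomputable def candidateGain (inp : Input D c) (s : TreeState D) (v : Node) (t : ℕ)
    (q : Candidate D) : ℝ :=
  prm.gain (hist inp .structural q.2 t (side inp (cell inp s v) q false))
    (hist inp .structural q.2 t (side inp (cell inp s v) q true))

/-- The structure point arriving at time `t` in the active leaf `v` generates candidate splits,
unless `v` already has `m` candidate split points. -/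
def addPoint (s : TreeState D) (v : Node) (t : ℕ) : TreeState D where
  leaves := s.leaves
  fringe := s.fringe
  split := s.split
  points := Function.update s.points v
    (if (s.points v).card < prm.m then insert t (s.points v) else s.points v)

open Classical in
/-- Split the active leaf `v`, in which a structure point arrives at time `t`, at the eligible
candidate with the largest structural statistic, if that statistic is at least `τ` or the leaf
has received at least `β(depth)` estimation points; refill the fringe after a split. -/
noncomputable def trySplit (inp : Input D c) (s : TreeState D) (v : Node) (t : ℕ) :
    TreeState D :=
  match pickMax (eligible prm inp s v (t + 1)) (candidateGain prm inp s v (t + 1)) with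
  | some q =>
    if prm.τ ≤ candidateGain prm inp s v (t + 1) q ∨
        prm.β v.length ≤ (count inp .estimation (birth s v) (t + 1) (cell inp s v) : ℝ) then
      refill prm inp (t + 1) (splitLeaf s v q)
    else s
  | none => s

open Classical in
/-- Processing of the point which arrives at time `t`. Estimation points, and structure points
in inactive leafs, change nothing but the counts. -/
noncomputable def step (inp : Input D c) (t : ℕ) (s : TreeState D) : TreeState D :=
  if h : inp.I t = .structural ∧ ∃ v ∈ s.fringe, inp.X t ∈ cell inp s v then
    trySplit prm inp (addPoint prm s h.2.choose t) h.2.choose t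
  else s

/-- Initially the root is the only leaf, and it is active. -/
def initial (D : ℕ) : TreeState D where
  leaves := {[]}
  fringe := {[]}
  split := fun _ => none
  points := fun _ => ∅

/-- The tree after the points arriving at the times `0, …, t - 1` have been processed. -/
noncomputable def tree (inp : Input D c) : ℕ → TreeState D
  | 0 => initial D
  | t + 1 => step prm inp t (tree inp t)

end Algorithm

/-- The law of the random set of candidate dimensions of a leaf: `min (1 + Poisson(lam)) D`
distinct dimensions, selected uniformly at random. -/
noncomputable def dimsProb (lam : ℝ≥0) (D : ℕ) (S : Finset (Fin D)) : ℝ≥0∞ :=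
  poissonMeasure lam {n | min (1 + n) D = S.card} / (D.choose S.card : ℝ≥0∞)

section Random

variable {D c : ℕ} {Ω : Type*}

/-- The input of the algorithm for the outcome `ω`. -/
def input (X : ℕ → Ω → Fin D → ℝ) (Y : ℕ → Ω → Fin c) (I : ℕ → Ω → PointType)
    (Z : Node → Ω → Finset (Fin D)) (ω : Ω) : Input D c where
  X := fun t => X t ω
  Y := fun t => Y t ω
  I := fun t => I t ω
  dims := fun v => Z v ω

/-- The past of time `t₀`: the points arriving before `t₀`, with their labels and stream
assignments, and the candidate dimensions of the nodes which can exist at that time (those of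
depth at most `t₀`). -/
abbrev history (X : ℕ → Ω → Fin D → ℝ) (Y : ℕ → Ω → Fin c) (I : ℕ → Ω → PointType)
    (Z : Node → Ω → Finset (Fin D)) (t₀ : ℕ) : MeasurableSpace Ω :=
  (⨆ i, ⨆ (_ : i < t₀), (MeasurableSpace.comap (X i) inferInstance ⊔
    MeasurableSpace.comap (Y i) inferInstance ⊔ MeasurableSpace.comap (I i) inferInstance)) ⊔
  ⨆ v : Node, ⨆ (_ : v.length ≤ t₀), MeasurableSpace.comap (Z v) inferInstance

variable [NeZero c]

/-- The event that every leaf `A` of the tree at time `t₀` with `s(A) > 0` has entered the fringe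
by time `T`. -/
def entersFringe (prm : Params c) (ρ : Measure ((Fin D → ℝ) × Fin c))
    (X : ℕ → Ω → Fin D → ℝ) (Y : ℕ → Ω → Fin c) (I : ℕ → Ω → PointType)
    (Z : Node → Ω → Finset (Fin D)) (t₀ T : ℕ) : Set Ω :=
  {ω | ∀ v ∈ (tree prm (input X Y I Z ω) t₀).leaves,
    0 < trueScore ρ (input X Y I Z ω) (tree prm (input X Y I Z ω) t₀) v t₀ →
      ∃ t ≤ T, v ∈ (tree prm (input X Y I Z ω) t).fringe}

/-- Every leaf with `s(A) > 0` enters the fringe in finite time with arbitrarily high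
probability: for the leafs of the tree at any time `t₀`, both unconditionally and conditionally
on the past of `t₀` (the time then depending on that past). -/
def LeavesEnterFringe [MeasurableSpace Ω] (P : Measure Ω) (prm : Params c)
    (ρ : Measure ((Fin D → ℝ) × Fin c))
    (X : ℕ → Ω → Fin D → ℝ) (Y : ℕ → Ω → Fin c) (I : ℕ → Ω → PointType)
    (Z : Node → Ω → Finset (Fin D)) : Prop :=
  ∀ t₀ : ℕ,
    (∀ δ : ℝ, 0 < δ → ∃ T : ℕ, 1 - δ ≤ P.real (entersFringe prm ρ X Y I Z t₀ T)) ∧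
    ∀ᵐ ω ∂P, ∀ δ : ℝ, 0 < δ → ∃ T : ℕ,
      1 - δ ≤ (P⟦entersFringe prm ρ X Y I Z t₀ T | history X Y I Z t₀⟧) ω

end Random

end OnlineForest

/-!
Almost surely, every leaf with positive score becomes active; both assertions follow, as the events
that this happens before time `T` increase with `T`.

**Reduction to one source of randomness.** The types and the candidate dimensions are independent
of the data points, so they may be fixed; only the i.i.d. data points `x` remain random. A cell is a
`box` described by the list of the splits on the way to it, of which there are countably many.
Hence almost surely, simultaneously for all boxes, a data point falling in a box splits it into two
parts of positive measure (`ae_measure_box_cons_ne_zero`), and every class which is not negligible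
in a box is visited with positive frequency by the estimation points (`ae_typical`). In
particular every active leaf is eventually split (`GoodSequence.exists_split`).

**Why a leaf cannot wait forever.** Suppose that the leaf `v` with positive score is never
activated. The class predicted in `v` has been observed there and some other class is not negligible
there, so that `ŝ(v) ≥ 1 / L` from some time on (`GoodSequence.one_le_mul_sHat`). Every leaf `w`
activated afterwards has `ŝ(w) ≥ ŝ(v)`, hence contains at least a fraction `1 / L` of the estimation
points of its lifetime, besides at least `α` of the depth of its parent. Below some depth no such
leaf exists (next paragraph), so only finitely many leafs are ever activated and only finitely many
splits are made, although the fringe is never empty and its leafs are split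
(`GoodSequence.exists_mem_fringe`).

**No deep candidate child is frequent.** Choose `r` so large that cutting any set at one of its own
random points leaves, on either side, a mass whose `r`-th power has a small mean relative to the
`r`-th power of the mass of the set (`exists_pow_halfSpace_le`). A node has at most `m D`
candidate splits, so the expected sum of the `r`-th powers of the masses of all nodes of depth `d`
decays geometrically in `d` (`sum_level_leafMass_le`). Given the past of its creation, a candidate
child of mass `q` receives `r` or more later points with frequency at least `1 / L` with probability
at most a constant times `q ^ r` (`measure_frequent_le`). By the Borel–Cantelli lemma, this happens
only up to a finite depth (`ae_exists_depth_not_frequentChild`); since `α` tends to infinity, a deep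
child which contains a fraction `1 / L` of the estimation points is frequent in this sense.
-/

namespace OnlineForest

/-! ### Cells as boxes -/

section Boxes

variable {D c : ℕ}

/-- The box cut out by a list of constraints. The constraint `(q, b)` restricts to the side `b` of
the hyperplane through the data point `x q.2` orthogonal to the coordinate `q.1`. -/
def box (x : ℕ → Fin D → ℝ) (l : List (Candidate D × Bool)) : Set (Fin D → ℝ) :=
  {y | ∀ p ∈ l, if p.2 then x p.1.2 p.1.1 < y p.1.1 else y p.1.1 ≤ x p.1.2 p.1.1}

/-- The arrival times of the data points which a list of constraints refers to. -/
def times (l : List (Candidate D × Bool)) : Finset ℕ := (l.map fun p => p.1.2).toFinset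

@[simp] lemma box_nil (x : ℕ → Fin D → ℝ) : box x [] = Set.univ := by
  ext y; simp [box]

@[simp] lemma times_nil : times ([] : List (Candidate D × Bool)) = ∅ := rfl

@[simp] lemma times_cons (p : Candidate D × Bool) (l : List (Candidate D × Bool)) :
    times (p :: l) = insert p.1.2 (times l) := by
  simp [times]

lemma box_congr {x x' : ℕ → Fin D → ℝ} {l : List (Candidate D × Bool)}
    (h : ∀ s ∈ times l, x s = x' s) : box x l = box x' l := by
  ext y
  refine forall₂_congr fun p hp => ?_
  rw [h p.1.2 (List.mem_toFinset.2 (List.mem_map.2 ⟨p, hp, rfl⟩))]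

lemma side_box (inp : Input D c) (l : List (Candidate D × Bool)) (q : Candidate D) (b : Bool) :
    side inp (box inp.X l) q b = box inp.X ((q, b) :: l) := by
  cases b <;> ext y <;> simp [side, box, and_comm]

/-- The constraints which cut out the cell of a node. -/
def path (s : TreeState D) : Node → List (Candidate D × Bool)
  | [] => []
  | b :: v =>
    match s.split v with
    | some q => (q, b) :: path s v
    | none => []

/-- All proper ancestors of the node have been split. -/
def Reached (s : TreeState D) : Node → Prop
  | [] => True
  | _ :: v => (s.split v).isSome ∧ Reached s v

lemma cell_cons (inp : Input D c) {s : TreeState D} {v : Node} {q : Candidate D} (b : Bool)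
    (h : s.split v = some q) : cell inp s (b :: v) = side inp (cell inp s v) q b := by
  simp [cell, h]

lemma path_cons {s : TreeState D} {v : Node} {q : Candidate D} (b : Bool)
    (h : s.split v = some q) : path s (b :: v) = (q, b) :: path s v := by
  simp [path, h]

lemma cell_eq_box (inp : Input D c) {s : TreeState D} {v : Node} (h : Reached s v) :
    cell inp s v = box inp.X (path s v) := by
  induction v with
  | nil => simp [cell, path]
  | cons b v ih =>
    obtain ⟨q, hq⟩ := Option.isSome_iff_exists.1 h.1
    rw [cell_cons inp b hq, path_cons b hq, ih h.2, side_box]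

lemma side_subset (inp : Input D c) (A : Set (Fin D → ℝ)) (q : Candidate D) (b : Bool) :
    side inp A q b ⊆ A := by
  cases b <;> exact fun x hx => hx.1

lemma side_disjoint (inp : Input D c) (A : Set (Fin D → ℝ)) (q : Candidate D) {b b' : Bool}
    {y : Fin D → ℝ} (h : y ∈ side inp A q b) (h' : y ∈ side inp A q b') : b = b' := by
  cases b <;> cases b' <;> simp only [side, Set.mem_ofPred_eq] at h h' ⊢ <;>
    linarith [h.2, h'.2]

lemma mem_cell_of_cons {inp : Input D c} {s : TreeState D} {v : Node} {b : Bool}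
    {y : Fin D → ℝ} (h : y ∈ cell inp s (b :: v)) : y ∈ cell inp s v := by
  cases hq : s.split v with
  | none => simp [cell, hq] at h
  | some q => rw [cell_cons inp b hq] at h; exact side_subset _ _ _ _ h

lemma mem_cell_of_suffix {inp : Input D c} {s : TreeState D} {v w : Node} {y : Fin D → ℝ}
    (hvw : v <:+ w) (h : y ∈ cell inp s w) : y ∈ cell inp s v := by
  induction w with
  | nil => rwa [List.suffix_nil.1 hvw]
  | cons b w ih =>
    rcases List.suffix_cons_iff.1 hvw with rfl | h'
    · exact h
    · exact ih h' (mem_cell_of_cons h)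

/-- Two cells which meet belong to nodes one of which is an ancestor of the other. -/
lemma suffix_or_suffix_of_mem_cell {inp : Input D c} {s : TreeState D} {v w : Node}
    {y : Fin D → ℝ} (hv : y ∈ cell inp s v) (hw : y ∈ cell inp s w) : v <:+ w ∨ w <:+ v := by
  induction v with
  | nil => exact .inl (List.nil_suffix)
  | cons b v ih =>
    rcases ih (mem_cell_of_cons hv) with h | h
    · obtain ⟨u, rfl⟩ := h
      rcases List.eq_nil_or_concat u with rfl | ⟨u, b', rfl⟩
      · exact .inr (List.suffix_cons b v)
      · have h1 : y ∈ cell inp s (b' :: v) :=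
          mem_cell_of_suffix ⟨u, by simp⟩ hw
        cases hq : s.split v with
        | none => simp [cell, hq] at h1
        | some q =>
          rw [cell_cons inp _ hq] at h1 hv
          obtain rfl := side_disjoint _ _ _ hv h1
          exact .inl ⟨u, by simp⟩
    · exact .inr (h.trans (List.suffix_cons b v))

lemma Reached.isSome_of_suffix {s : TreeState D} {v w : Node} (h : Reached s w) (hvw : v <:+ w)
    (hne : v ≠ w) : (s.split v).isSome := by
  induction w with
  | nil => exact absurd (List.suffix_nil.1 hvw) hne
  | cons b w ih =>
    rcases List.suffix_cons_iff.1 hvw with rfl | h'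
    · exact absurd rfl hne
    · by_cases hw : v = w
      · exact hw ▸ h.1
      · exact ih h.2 h' hw

/-- `s'` extends `s`: the splits made in `s` have been made in `s'`. -/
def Extends (s s' : TreeState D) : Prop := ∀ v q, s.split v = some q → s'.split v = some q

lemma Extends.refl (s : TreeState D) : Extends s s := fun _ _ h => h

lemma Extends.trans {s s' s'' : TreeState D} (h : Extends s s') (h' : Extends s' s'') :
    Extends s s'' := fun v q hq => h' v q (h v q hq)

lemma Extends.reached {s s' : TreeState D} (h : Extends s s') {v : Node} (hv : Reached s v) :
    Reached s' v := by
  induction v with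
  | nil => trivial
  | cons b v ih =>
    obtain ⟨q, hq⟩ := Option.isSome_iff_exists.1 hv.1
    exact ⟨by rw [h v q hq]; rfl, ih hv.2⟩

lemma Extends.path_eq {s s' : TreeState D} (h : Extends s s') {v : Node} (hv : Reached s v) :
    path s' v = path s v := by
  induction v with
  | nil => rfl
  | cons b v ih =>
    obtain ⟨q, hq⟩ := Option.isSome_iff_exists.1 hv.1
    rw [path_cons b hq, path_cons b (h v q hq), ih hv.2]

lemma Extends.cell_eq {s s' : TreeState D} (h : Extends s s') (inp : Input D c) {v : Node}
    (hv : Reached s v) : cell inp s' v = cell inp s v := by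
  rw [cell_eq_box inp hv, cell_eq_box inp (h.reached hv), h.path_eq hv]

lemma Extends.birth_eq {s s' : TreeState D} (h : Extends s s') {v : Node}
    (hv : Reached s v) : birth s' v = birth s v := by
  cases v with
  | nil => rfl
  | cons b v =>
    obtain ⟨q, hq⟩ := Option.isSome_iff_exists.1 hv.1
    simp [birth, hq, h v q hq]

lemma cell_congr_split (inp : Input D c) {s s' : TreeState D} (h : s.split = s'.split) :
    cell inp s = cell inp s' := by
  funext v
  induction v with
  | nil => rfl
  | cons b v ih => simp [cell, h, ih]

lemma birth_congr_split {s s' : TreeState D} (h : s.split = s'.split) : birth s = birth s' := by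
  funext v
  cases v with
  | nil => rfl
  | cons b v => simp [birth, h]

lemma reached_congr_split {s s' : TreeState D} (h : s.split = s'.split) {v : Node}
    (hv : Reached s v) : Reached s' v :=
  Extends.reached (fun v q hq => by rw [← h, hq]) hv

lemma sHat_congr_split [NeZero c] (inp : Input D c) {s s' : TreeState D}
    (h : s.split = s'.split) : sHat inp s = sHat inp s' := by
  funext v t
  have hp : prediction inp s v t = prediction inp s' v t := by
    simp only [prediction, cell_congr_split inp h, birth_congr_split h]
  have he : eHat inp s v t = eHat inp s' v t := by
    unfold eHat
    rw [hp, cell_congr_split inp h, birth_congr_split h]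
  simp only [sHat, pHat, he, cell_congr_split inp h, birth_congr_split h]

lemma count_mono_right (inp : Input D c) (k : PointType) (a : ℕ) {b b' : ℕ} (h : b ≤ b')
    (A : Set (Fin D → ℝ)) : count inp k a b A ≤ count inp k a b' A := by
  classical
  unfold count
  exact Finset.card_le_card fun i hi => by
    simp only [Finset.mem_filter, Finset.mem_Ico] at hi ⊢
    exact ⟨⟨hi.1.1, hi.1.2.trans_le h⟩, hi.2⟩

lemma sum_hist (inp : Input D c) (k : PointType) (a b : ℕ) (A : Set (Fin D → ℝ)) :
    ∑ y, hist inp k a b A y = count inp k a b A := by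
  refine ((Finset.card_eq_sum_card_fiberwise (f := inp.Y) (t := Finset.univ) (by simp)).trans
    (Finset.sum_congr rfl fun y _ => ?_)).symm
  rw [hist, Finset.filter_filter]
  congr 1
  ext i
  simp [and_assoc]

lemma hist_le_hist_majority [NeZero c] (h : Fin c → ℕ) (k : Fin c) : h k ≤ h (majority h) := by
  have := Finset.min'_mem (Finset.univ.filter fun k => ∀ j, h j ≤ h k) (by
    obtain ⟨k, -, hk⟩ :=
      Finset.exists_max_image (Finset.univ : Finset (Fin c)) h ⟨0, Finset.mem_univ 0⟩
    exact ⟨k, by simpa using fun j => hk j (Finset.mem_univ j)⟩)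
  exact (Finset.mem_filter.1 this).2 k

end Boxes

section Refill

variable {D c : ℕ} [NeZero c] {prm : Params c} {inp : Input D c} {t : ℕ}

lemma pickMax_eq_some {ι : Type*} {s : Finset ι} {f : ι → ℝ} {x : ι} (h : pickMax s f = some x) :
    x ∈ s ∧ ∀ y ∈ s, f y ≤ f x := by
  unfold pickMax at h
  split_ifs at h with hne
  have := hne.choose_spec
  rw [Option.some_inj.1 h] at this
  simpa [argmaxSet] using this

lemma pickMax_isSome {ι : Type*} {s : Finset ι} {f : ι → ℝ} (h : s.Nonempty) :
    ∃ x, pickMax s f = some x := by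
  obtain ⟨x, hx, hm⟩ := s.exists_max_image f h
  have : (argmaxSet s f).Nonempty := ⟨x, by simpa [argmaxSet] using ⟨hx, hm⟩⟩
  exact ⟨_, dif_pos this⟩

lemma activateOne_cases (prm : Params c) (inp : Input D c) (t : ℕ) (s : TreeState D) :
    (activateOne prm inp t s = s ∧ (s.fringe.card < prm.F → s.leaves ⊆ s.fringe)) ∨
      ∃ v ∈ s.leaves \ s.fringe, (∀ w ∈ s.leaves \ s.fringe, sHat inp s w t ≤ sHat inp s v t) ∧
        activateOne prm inp t s = { s with fringe := insert v s.fringe } := by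
  unfold activateOne
  split_ifs with hF
  · by_cases hne : (s.leaves \ s.fringe).Nonempty
    · obtain ⟨v, hv⟩ := pickMax_isSome (f := fun v => sHat inp s v t) hne
      obtain ⟨h1, h2⟩ := pickMax_eq_some hv
      right
      refine ⟨v, h1, h2, ?_⟩
      rw [hv]
    · left
      rw [Finset.not_nonempty_iff_eq_empty] at hne
      constructor
      · cases hp : pickMax (s.leaves \ s.fringe) (fun v => sHat inp s v t) with
        | none => rfl
        | some v => have := (pickMax_eq_some hp).1; simp [hne] at this
      · intro _
        exact Finset.sdiff_eq_empty_iff_subset.1 hne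
  · exact .inl ⟨rfl, fun h => absurd h hF⟩

lemma iterate_activateOne (s : TreeState D) (n : ℕ) (hs : s.fringe ⊆ s.leaves) :
    ((activateOne prm inp t)^[n] s).leaves = s.leaves ∧
    ((activateOne prm inp t)^[n] s).split = s.split ∧
    ((activateOne prm inp t)^[n] s).points = s.points ∧
    s.fringe ⊆ ((activateOne prm inp t)^[n] s).fringe ∧
    ((activateOne prm inp t)^[n] s).fringe ⊆ s.leaves ∧
    ∀ v w, v ∈ s.leaves → v ∉ ((activateOne prm inp t)^[n] s).fringe → w ∉ s.fringe →
      w ∈ ((activateOne prm inp t)^[n] s).fringe → sHat inp s v t ≤ sHat inp s w t := by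
  induction n with
  | zero => exact ⟨rfl, rfl, rfl, subset_rfl, hs, fun v w _ _ h h' => absurd h' h⟩
  | succ n ih =>
    rw [Function.iterate_succ_apply']
    set s' := (activateOne prm inp t)^[n] s
    obtain ⟨h1, h2, h3, h4, h5, h6⟩ := ih
    rcases activateOne_cases prm inp t s' with ⟨h, -⟩ | ⟨u, hu, hmax, h⟩
    · rw [h]; exact ⟨h1, h2, h3, h4, h5, h6⟩
    · rw [h]
      refine ⟨h1, h2, h3, h4.trans (Finset.subset_insert _ _), ?_, ?_⟩
      · refine Finset.insert_subset ?_ h5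
        rw [← h1]; exact (Finset.mem_sdiff.1 hu).1
      · intro v w hv hv' hw hw'
        simp only [Finset.mem_insert, not_or] at hv' hw'
        rcases hw' with rfl | hw'
        · rw [← sHat_congr_split inp h2]
          exact hmax v (by rw [Finset.mem_sdiff, h1]; exact ⟨hv, hv'.2⟩)
        · exact h6 v w hv hv'.2 hw hw'

lemma refill_spec (s : TreeState D) (hs : s.fringe ⊆ s.leaves) :
    (refill prm inp t s).leaves = s.leaves ∧
    (refill prm inp t s).split = s.split ∧
    (refill prm inp t s).points = s.points ∧
    s.fringe ⊆ (refill prm inp t s).fringe ∧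
    (refill prm inp t s).fringe ⊆ s.leaves ∧
    ∀ v w, v ∈ s.leaves → v ∉ (refill prm inp t s).fringe → w ∉ s.fringe →
      w ∈ (refill prm inp t s).fringe → sHat inp s v t ≤ sHat inp s w t :=
  iterate_activateOne s prm.F hs

lemma refill_fringe_nonempty (hF : 1 ≤ prm.F) (s : TreeState D) (hs : s.fringe ⊆ s.leaves)
    (hne : s.leaves.Nonempty) : (refill prm inp t s).fringe.Nonempty := by
  obtain ⟨n, hn⟩ := Nat.exists_eq_add_of_le' hF
  have h1 : (activateOne prm inp t s).fringe.Nonempty ∧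
      (activateOne prm inp t s).fringe ⊆ (activateOne prm inp t s).leaves := by
    rcases activateOne_cases prm inp t s with ⟨h, h'⟩ | ⟨u, hu, -, h⟩
    · rw [h]
      refine ⟨?_, hs⟩
      by_contra hcon
      rw [Finset.not_nonempty_iff_eq_empty] at hcon
      have := h' (by rw [hcon]; exact hF)
      rw [hcon] at this
      exact hne.ne_empty (Finset.subset_empty.1 this)
    · rw [h]
      exact ⟨⟨u, by simp⟩, Finset.insert_subset (Finset.mem_sdiff.1 hu).1 hs⟩
  unfold refill
  rw [hn, Function.iterate_succ_apply]
  exact h1.1.mono (iterate_activateOne _ n h1.2).2.2.2.1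

end Refill

/-! ### Invariants of the tree -/

section Tree

variable {D c : ℕ} {prm : Params c} {inp : Input D c}

/-- The properties of the state of the tree at time `t` which the algorithm preserves. -/
structure Invariant (prm : Params c) (inp : Input D c) (s : TreeState D) (t : ℕ) : Prop where
  leaf_unsplit : ∀ v ∈ s.leaves, s.split v = none
  leaf_reached : ∀ v ∈ s.leaves, Reached s v
  split_reached : ∀ v, (s.split v).isSome → Reached s v
  fringe_subset : s.fringe ⊆ s.leaves
  fringe_nonempty : s.fringe.Nonempty
  split_mem : ∀ v q, s.split v = some q → q.2 ∈ s.points v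
  point_lt : ∀ v, ∀ τ ∈ s.points v, τ < t
  card_points : ∀ v, (s.points v).card ≤ prm.m
  finite_split : {v | (s.split v).isSome}.Finite
  /-- a leaf received as a candidate child the number of estimation points required for the split
  of its parent -/
  leaf_count : ∀ b u q, b :: u ∈ s.leaves → s.split u = some q →
    prm.α u.length ≤ (count inp .estimation q.2 t (cell inp s (b :: u)) : ℝ)

lemma invariant_initial : Invariant prm inp (initial D) 0 where
  leaf_unsplit := by simp [initial]
  leaf_reached := by simp [initial, Reached]
  split_reached := by simp [initial]
  fringe_subset := by simp [initial]
  fringe_nonempty := by simp [initial]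
  split_mem := by simp [initial]
  point_lt := by simp [initial]
  card_points := by simp [initial]
  finite_split := by simp [initial]
  leaf_count := by simp [initial]

lemma points_subset_addPoint (s : TreeState D) (v w : Node) (t : ℕ) :
    s.points w ⊆ (addPoint prm s v t).points w := by
  rcases eq_or_ne w v with rfl | h
  · simp only [addPoint, Function.update_self]
    split_ifs <;> simp
  · simp [addPoint, h]

lemma mem_points_addPoint {s : TreeState D} {v w : Node} {t τ : ℕ}
    (h : τ ∈ (addPoint prm s v t).points w) :
    τ ∈ s.points w ∨ (τ = t ∧ w = v ∧ (s.points v).card < prm.m) := by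
  rcases eq_or_ne w v with rfl | hw
  · simp only [addPoint, Function.update_self] at h
    split_ifs at h with hc
    · rcases Finset.mem_insert.1 h with rfl | h
      · exact .inr ⟨rfl, rfl, hc⟩
      · exact .inl h
    · exact .inl h
  · simp only [addPoint, Function.update_of_ne hw] at h
    exact .inl h

lemma card_points_addPoint {s : TreeState D} {v w : Node} {t : ℕ}
    (h : (s.points w).card ≤ prm.m) : ((addPoint prm s v t).points w).card ≤ prm.m := by
  rcases eq_or_ne w v with rfl | hw
  · simp only [addPoint, Function.update_self]
    split_ifs with hc
    · exact (Finset.card_insert_le _ _).trans hc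
    · exact h
  · simpa [addPoint, hw] using h

lemma Invariant.mono {s : TreeState D} {t t' : ℕ} (h : Invariant prm inp s t) (ht : t ≤ t') :
    Invariant prm inp s t' where
  __ := h
  point_lt := fun v τ hτ => (h.point_lt v τ hτ).trans_le ht
  leaf_count := fun b u q hu hq => (h.leaf_count b u q hu hq).trans
    (by exact_mod_cast count_mono_right _ _ _ ht _)

lemma Invariant.addPoint {s : TreeState D} {t : ℕ} {v : Node} (h : Invariant prm inp s t) :
    Invariant prm inp (addPoint prm s v t) (t + 1) where
  leaf_unsplit := h.leaf_unsplit
  leaf_reached := fun w hw => reached_congr_split (s := s)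
    (s' := OnlineForest.addPoint prm s v t) rfl (h.leaf_reached w hw)
  split_reached := fun w hw => reached_congr_split (s := s)
    (s' := OnlineForest.addPoint prm s v t) rfl (h.split_reached w hw)
  fringe_subset := h.fringe_subset
  fringe_nonempty := h.fringe_nonempty
  split_mem := fun w q hq => points_subset_addPoint s v w t (h.split_mem w q hq)
  point_lt := fun w τ hτ => by
    rcases mem_points_addPoint hτ with hτ | ⟨rfl, -, -⟩
    · exact (h.point_lt w τ hτ).trans (Nat.lt_succ_self t)
    · exact Nat.lt_succ_self _
  card_points := fun w => card_points_addPoint (h.card_points w)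
  finite_split := h.finite_split
  leaf_count := fun b u q hu hq => by
    have := (h.mono (Nat.le_succ t)).leaf_count b u q hu hq
    rwa [cell_congr_split inp (s := s) (s' := OnlineForest.addPoint prm s v t) rfl] at this

lemma splitLeaf_extends {s : TreeState D} {v : Node} (q : Candidate D) (h : s.split v = none) :
    Extends s (splitLeaf s v q) := by
  intro w q' hw
  have : w ≠ v := by rintro rfl; simp [h] at hw
  simp [splitLeaf, this, hw]

lemma mem_splitLeaf_leaves {s : TreeState D} {v w : Node} {q : Candidate D} :
    w ∈ (splitLeaf s v q).leaves ↔ (w ≠ v ∧ w ∈ s.leaves) ∨ ∃ b, w = b :: v := by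
  simp only [splitLeaf, Finset.mem_union, Finset.mem_erase, Finset.mem_insert,
    Finset.mem_singleton, Bool.exists_bool]

lemma splitLeaf_split_self (s : TreeState D) (v : Node) (q : Candidate D) :
    (splitLeaf s v q).split v = some q := by
  simp [splitLeaf]

lemma splitLeaf_split_of_ne (s : TreeState D) {v w : Node} (q : Candidate D) (h : w ≠ v) :
    (splitLeaf s v q).split w = s.split w := by
  simp [splitLeaf, h]

lemma splitLeaf_fringe_subset {s : TreeState D} {v : Node} {q : Candidate D}
    (h : s.fringe ⊆ s.leaves) : (splitLeaf s v q).fringe ⊆ (splitLeaf s v q).leaves := by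
  intro w hw
  simp only [splitLeaf, Finset.mem_erase] at hw
  exact mem_splitLeaf_leaves.2 (.inl ⟨hw.1, h hw.2⟩)

lemma cell_addPoint (s : TreeState D) (v : Node) (t : ℕ) :
    cell inp (addPoint prm s v t) = cell inp s :=
  cell_congr_split inp rfl

lemma mem_eligible {s : TreeState D} {v : Node} {t : ℕ} {q : Candidate D} :
    q ∈ eligible prm inp s v t ↔ q.1 ∈ inp.dims v ∧ q.2 ∈ s.points v ∧
      ∀ b, prm.α v.length ≤ (count inp .estimation q.2 t (side inp (cell inp s v) q b) : ℝ) := by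
  simp [eligible, and_assoc]

/-- After the split of an active leaf the invariant holds again, whatever the new fringe is. -/
lemma Invariant.split {s s' : TreeState D} {t : ℕ} {v : Node} {q : Candidate D}
    (h : Invariant prm inp s t) (hv : v ∈ s.leaves) (hq : q ∈ eligible prm inp s v t)
    (hleaves : s'.leaves = (splitLeaf s v q).leaves) (hsplit : s'.split = (splitLeaf s v q).split)
    (hpoints : s'.points = s.points) (hsub : s'.fringe ⊆ s'.leaves) (hne : s'.fringe.Nonempty) :
    Invariant prm inp s' t := by
  have hext : Extends s s' := fun w q' hw => by
    rw [hsplit]; exact splitLeaf_extends q (h.leaf_unsplit v hv) w q' hw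
  have hself : s'.split v = some q := by rw [hsplit, splitLeaf_split_self]
  have hother : ∀ w, w ≠ v → s'.split w = s.split w := fun w hw => by
    rw [hsplit, splitLeaf_split_of_ne _ _ hw]
  have hmem : ∀ w, w ∈ s'.leaves ↔ (w ≠ v ∧ w ∈ s.leaves) ∨ ∃ b, w = b :: v := fun w => by
    rw [hleaves, mem_splitLeaf_leaves]
  have hv' := h.leaf_reached v hv
  obtain ⟨-, hq2, hqα⟩ := mem_eligible.1 hq
  constructor
  · intro w hw
    rcases (hmem w).1 hw with ⟨hne, hw⟩ | ⟨b, rfl⟩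
    · rw [hother w hne, h.leaf_unsplit w hw]
    · rw [hother _ (by simp)]
      by_contra hcon
      have := (h.split_reached (b :: v) (Option.isSome_iff_ne_none.2 hcon)).1
      simp [h.leaf_unsplit v hv] at this
  · intro w hw
    rcases (hmem w).1 hw with ⟨-, hw⟩ | ⟨b, rfl⟩
    · exact hext.reached (h.leaf_reached w hw)
    · exact ⟨by simp [hself], hext.reached hv'⟩
  · intro w hw
    by_cases hwv : w = v
    · exact hwv ▸ hext.reached hv'
    · exact hext.reached (h.split_reached w (by rwa [hother w hwv] at hw))
  · exact hsub
  · exact hne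
  · intro w q' hw
    rw [hpoints]
    by_cases hwv : w = v
    · subst hwv
      rw [hself, Option.some_inj] at hw
      exact hw ▸ hq2
    · exact h.split_mem w q' (by rwa [hother w hwv] at hw)
  · rw [hpoints]; exact h.point_lt
  · rw [hpoints]; exact h.card_points
  · refine (h.finite_split.insert v).subset fun w hw => ?_
    by_cases hwv : w = v
    · exact .inl hwv
    · exact .inr (by simpa [hother w hwv] using hw)
  · intro b u q' hu hq'
    rcases (hmem _).1 hu with ⟨-, hw⟩ | ⟨b', hb'⟩
    · have hr := h.leaf_reached _ hw
      obtain ⟨q'', hq''⟩ := Option.isSome_iff_exists.1 hr.1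
      have : q'' = q' := by
        have := hext u q'' hq''
        rw [hq'] at this
        exact (Option.some_inj.1 this).symm
      subst this
      rw [hext.cell_eq inp hr]
      exact h.leaf_count b u q'' hw hq''
    · obtain ⟨rfl, rfl⟩ := List.cons_eq_cons.1 hb'
      rw [hself, Option.some_inj] at hq'
      subst hq'
      rw [cell_cons inp b hself, hext.cell_eq inp hv']
      exact hqα b

variable [NeZero c]

lemma step_cases (prm : Params c) (inp : Input D c) (t : ℕ) (s : TreeState D) :
    step prm inp t s = s ∨ ∃ v ∈ s.fringe, inp.I t = .structural ∧ inp.X t ∈ cell inp s v ∧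
      (step prm inp t s = addPoint prm s v t ∨
        ∃ q ∈ eligible prm inp (addPoint prm s v t) v (t + 1),
          step prm inp t s = refill prm inp (t + 1) (splitLeaf (addPoint prm s v t) v q)) := by
  unfold step
  split_ifs with h
  · right
    refine ⟨h.2.choose, h.2.choose_spec.1, h.1, h.2.choose_spec.2, ?_⟩
    unfold trySplit
    cases hp : pickMax (eligible prm inp (addPoint prm s h.2.choose t) h.2.choose (t + 1))
        (candidateGain prm inp (addPoint prm s h.2.choose t) h.2.choose (t + 1)) with
    | none => exact .inl rfl
    | some q =>
      dsimp only
      split_ifs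
      · exact .inr ⟨q, (pickMax_eq_some hp).1, rfl⟩
      · exact .inl rfl
  · exact .inl rfl

lemma step_invariant (hF : 1 ≤ prm.F) {s : TreeState D} {t : ℕ} (h : Invariant prm inp s t) :
    Invariant prm inp (step prm inp t s) (t + 1) := by
  rcases step_cases prm inp t s with h' | ⟨v, hv, -, -, h' | ⟨q, hq, h'⟩⟩
  · rw [h']; exact h.mono (Nat.le_succ t)
  · rw [h']; exact h.addPoint
  · rw [h']
    have h1 : Invariant prm inp (addPoint prm s v t) (t + 1) := h.addPoint
    have hsub : (splitLeaf (addPoint prm s v t) v q).fringe ⊆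
      (splitLeaf (addPoint prm s v t) v q).leaves := splitLeaf_fringe_subset h1.fringe_subset
    obtain ⟨r1, r2, r3, r4, r5, -⟩ := refill_spec (prm := prm) (inp := inp) (t := t + 1) _ hsub
    exact h1.split (h.fringe_subset hv) hq r1 r2 r3 (by rw [r1]; exact r5)
      (refill_fringe_nonempty hF _ hsub ⟨false :: v, mem_splitLeaf_leaves.2 (.inr ⟨_, rfl⟩)⟩)

lemma tree_invariant (hF : 1 ≤ prm.F) (t : ℕ) : Invariant prm inp (tree prm inp t) t := by
  induction t with
  | zero => exact invariant_initial
  | succ t ih => exact step_invariant hF ih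

/-- The effect of one step of the algorithm: nothing happens; or the structure point only generates
candidate splits; or the active leaf in which it arrives is split, and then the newly activated
leafs `w` have at least the estimated score of every leaf `u` which stays inactive. -/
lemma tree_succ_cases (hF : 1 ≤ prm.F) (t : ℕ) :
    tree prm inp (t + 1) = tree prm inp t ∨
    ∃ v ∈ (tree prm inp t).fringe, inp.I t = .structural ∧ inp.X t ∈ cell inp (tree prm inp t) v ∧
      (tree prm inp (t + 1)).points = (addPoint prm (tree prm inp t) v t).points ∧
      ((tree prm inp (t + 1)).leaves = (tree prm inp t).leaves ∧
        (tree prm inp (t + 1)).fringe = (tree prm inp t).fringe ∧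
        (tree prm inp (t + 1)).split = (tree prm inp t).split ∨
      ∃ q, (tree prm inp (t + 1)).leaves = (splitLeaf (tree prm inp t) v q).leaves ∧
        (tree prm inp (t + 1)).split = (splitLeaf (tree prm inp t) v q).split ∧
        (∀ w ∈ (tree prm inp t).fringe, w ≠ v → w ∈ (tree prm inp (t + 1)).fringe) ∧
        ∀ u w, u ∈ (tree prm inp (t + 1)).leaves → u ∉ (tree prm inp (t + 1)).fringe →
          w ∉ (tree prm inp t).fringe → w ∈ (tree prm inp (t + 1)).fringe →
          sHat inp (tree prm inp (t + 1)) u (t + 1) ≤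
            sHat inp (tree prm inp (t + 1)) w (t + 1)) := by
  have h := tree_invariant (prm := prm) (inp := inp) hF t
  set s := tree prm inp t with hs
  have htree : tree prm inp (t + 1) = step prm inp t s := rfl
  rcases step_cases prm inp t s with h' | ⟨v, hv, hI, hX, h' | ⟨q, hq, h'⟩⟩
  · left; rw [htree, h']
  · right
    rw [htree, h']
    exact ⟨v, hv, hI, hX, rfl, .inl ⟨rfl, rfl, rfl⟩⟩
  · right
    rw [htree, h']
    have hsub : (splitLeaf (addPoint prm s v t) v q).fringe ⊆
      (splitLeaf (addPoint prm s v t) v q).leaves :=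
      splitLeaf_fringe_subset (s := addPoint prm s v t) h.fringe_subset
    obtain ⟨r1, r2, r3, r4, -, r6⟩ := refill_spec (prm := prm) (inp := inp) (t := t + 1) _ hsub
    refine ⟨v, hv, hI, hX, r3, .inr ⟨q, r1, r2, ?_, ?_⟩⟩
    · intro w hw hne
      exact r4 (by simpa [splitLeaf, addPoint, hne] using hw)
    · intro u w hu hu' hw hw'
      rw [sHat_congr_split inp r2]
      exact r6 u w (r1 ▸ hu) hu' (fun hcon => hw (by
        simp only [splitLeaf, addPoint, Finset.mem_erase] at hcon
        exact hcon.2)) hw'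

lemma tree_extends_succ (hF : 1 ≤ prm.F) (t : ℕ) :
    Extends (tree prm inp t) (tree prm inp (t + 1)) := by
  rcases tree_succ_cases (prm := prm) (inp := inp) hF t with
    h | ⟨v, hv, -, -, -, ⟨-, -, h⟩ | ⟨q, -, h, -⟩⟩
  · rw [h]; exact Extends.refl _
  · intro w q hw; rw [h, hw]
  · have hinv := tree_invariant (prm := prm) (inp := inp) hF t
    intro w q' hw
    rw [h]
    exact splitLeaf_extends q (hinv.leaf_unsplit v (hinv.fringe_subset hv)) w q' hw

lemma tree_extends (hF : 1 ≤ prm.F) {t t' : ℕ} (h : t ≤ t') :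
    Extends (tree prm inp t) (tree prm inp t') := by
  induction t', h using Nat.le_induction with
  | base => exact Extends.refl _
  | succ n _ ih => exact ih.trans (tree_extends_succ hF n)

lemma points_subset (hF : 1 ≤ prm.F) {t t' : ℕ} (h : t ≤ t') (v : Node) :
    (tree prm inp t).points v ⊆ (tree prm inp t').points v := by
  induction t', h using Nat.le_induction with
  | base => exact subset_rfl
  | succ n _ ih =>
    refine ih.trans ?_
    rcases tree_succ_cases (prm := prm) (inp := inp) hF n with h | ⟨w, -, -, -, h, -⟩
    · rw [h]
    · rw [h]; exact points_subset_addPoint _ _ _ _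

/-- At time `τ` a structure point arrives in the active leaf `v` and generates candidate splits
of `v`. -/
def Created (prm : Params c) (inp : Input D c) (v : Node) (τ : ℕ) : Prop :=
  inp.I τ = .structural ∧ v ∈ (tree prm inp τ).fringe ∧
    ((tree prm inp τ).points v).card < prm.m ∧ inp.X τ ∈ cell inp (tree prm inp τ) v

lemma created_of_mem_points (hF : 1 ≤ prm.F) {v : Node} {τ t : ℕ}
    (h : τ ∈ (tree prm inp t).points v) : Created prm inp v τ := by
  induction t with
  | zero => simp [tree, initial] at h
  | succ t ih =>
    rcases tree_succ_cases (prm := prm) (inp := inp) hF t with h' | ⟨w, hw, hI, hX, h', -⟩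
    · exact ih (h' ▸ h)
    · rw [h'] at h
      rcases mem_points_addPoint h with h | ⟨rfl, rfl, hc⟩
      · exact ih h
      · exact ⟨hI, hw, hc, hX⟩

lemma eq_of_mem_cell_of_leaves (hF : 1 ≤ prm.F) {t : ℕ} {v w : Node} {y : Fin D → ℝ}
    (hv : v ∈ (tree prm inp t).leaves) (hw : w ∈ (tree prm inp t).leaves)
    (hyv : y ∈ cell inp (tree prm inp t) v) (hyw : y ∈ cell inp (tree prm inp t) w) : v = w := by
  have hinv := tree_invariant (prm := prm) (inp := inp) hF t
  by_contra hne
  rcases suffix_or_suffix_of_mem_cell hyv hyw with h | h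
  · have := (hinv.leaf_reached w hw).isSome_of_suffix h hne
    simp [hinv.leaf_unsplit v hv] at this
  · have := (hinv.leaf_reached v hv).isSome_of_suffix h (Ne.symm hne)
    simp [hinv.leaf_unsplit w hw] at this

lemma tree_succ_eq_trySplit (hF : 1 ≤ prm.F) {t : ℕ} {v : Node} (hI : inp.I t = .structural)
    (hv : v ∈ (tree prm inp t).fringe) (hX : inp.X t ∈ cell inp (tree prm inp t) v) :
    tree prm inp (t + 1) = trySplit prm inp (addPoint prm (tree prm inp t) v t) v t := by
  have hinv := tree_invariant (prm := prm) (inp := inp) hF t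
  have h : inp.I t = .structural ∧
      ∃ v ∈ (tree prm inp t).fringe, inp.X t ∈ cell inp (tree prm inp t) v := ⟨hI, v, hv, hX⟩
  have hc : h.2.choose = v :=
    eq_of_mem_cell_of_leaves hF (hinv.fringe_subset h.2.choose_spec.1) (hinv.fringe_subset hv)
      h.2.choose_spec.2 hX
  change step prm inp t (tree prm inp t) = _
  rw [step, dif_pos h, hc]

lemma trySplit_points {s : TreeState D} (hs : s.fringe ⊆ s.leaves) (v : Node)
    (t : ℕ) : (trySplit prm inp s v t).points = s.points := by
  unfold trySplit
  cases pickMax (eligible prm inp s v (t + 1)) (candidateGain prm inp s v (t + 1)) with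
  | none => rfl
  | some q =>
    dsimp only
    split_ifs
    · exact (refill_spec _ (splitLeaf_fringe_subset hs)).2.2.1
    · rfl

lemma points_succ (hF : 1 ≤ prm.F) {t : ℕ} {v : Node} (hI : inp.I t = .structural)
    (hv : v ∈ (tree prm inp t).fringe) (hX : inp.X t ∈ cell inp (tree prm inp t) v) :
    (tree prm inp (t + 1)).points v = if ((tree prm inp t).points v).card < prm.m then
      insert t ((tree prm inp t).points v) else (tree prm inp t).points v := by
  rw [tree_succ_eq_trySplit hF hI hv hX, trySplit_points]
  · simp [addPoint]
  · exact (tree_invariant (prm := prm) (inp := inp) hF t).fringe_subset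

lemma Created.mem_points (hF : 1 ≤ prm.F) {v : Node} {τ t : ℕ} (h : Created prm inp v τ)
    (ht : τ < t) : τ ∈ (tree prm inp t).points v := by
  refine points_subset hF ht v ?_
  rw [points_succ hF h.1 h.2.1 h.2.2.2, if_pos h.2.2.1]
  exact Finset.mem_insert_self _ _

/-- At most `m` data points generate candidate splits of a node. -/
lemma card_le_of_created (hF : 1 ≤ prm.F) {v : Node} {S : Finset ℕ}
    (hS : ∀ τ ∈ S, Created prm inp v τ) : S.card ≤ prm.m := by
  refine (Finset.card_le_card fun τ hτ => ?_).trans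
    ((tree_invariant (prm := prm) (inp := inp) hF (S.sup id + 1)).card_points v)
  exact (hS τ hτ).mem_points hF (Nat.lt_succ_of_le (Finset.le_sup (f := id) hτ))

/-- A split was made at a candidate created at some time when the node was active. -/
lemma created_of_split (hF : 1 ≤ prm.F) {v : Node} {t : ℕ} {q : Candidate D}
    (h : (tree prm inp t).split v = some q) : Created prm inp v q.2 ∧ q.2 < t :=
  have hinv := tree_invariant (prm := prm) (inp := inp) hF t
  ⟨created_of_mem_points hF (hinv.split_mem v q h), hinv.point_lt v q.2 (hinv.split_mem v q h)⟩

lemma Created.reached (hF : 1 ≤ prm.F) {v : Node} {τ : ℕ} (h : Created prm inp v τ) :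
    Reached (tree prm inp τ) v :=
  have hinv := tree_invariant (prm := prm) (inp := inp) hF τ
  hinv.leaf_reached v (hinv.fringe_subset h.2.1)

lemma times_path_lt (hF : 1 ≤ prm.F) {v : Node} {t : ℕ} (hv : Reached (tree prm inp t) v) :
    ∀ τ ∈ times (path (tree prm inp t) v), τ < t ∧ inp.I τ = .structural := by
  induction v with
  | nil => simp [path]
  | cons b v ih =>
    obtain ⟨q, hq⟩ := Option.isSome_iff_exists.1 hv.1
    rw [path_cons b hq, times_cons]
    intro τ hτ
    rcases Finset.mem_insert.1 hτ with rfl | hτ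
    · exact ⟨(created_of_split hF hq).2, (created_of_split hF hq).1.1⟩
    · exact ih hv.2 τ hτ

/-- The cell of the child of a split node, computed at the time when the split was created as a
candidate. -/
lemma cell_child (hF : 1 ≤ prm.F) {v : Node} {t : ℕ} {q : Candidate D} (b : Bool)
    (h : (tree prm inp t).split v = some q) :
    cell inp (tree prm inp t) (b :: v) = side inp (cell inp (tree prm inp q.2) v) q b := by
  obtain ⟨hc, hlt⟩ := created_of_split hF h
  rw [cell_cons inp b h, (tree_extends hF hlt.le).cell_eq inp (hc.reached hF)]

/-- A leaf outside the fringe at all times stays a leaf. -/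
lemma leaf_of_never_active (hF : 1 ≤ prm.F) {v : Node} {t t' : ℕ} (htt : t ≤ t')
    (hv : v ∈ (tree prm inp t).leaves) (hnever : ∀ τ, v ∉ (tree prm inp τ).fringe) :
    v ∈ (tree prm inp t').leaves := by
  induction t', htt using Nat.le_induction with
  | base => exact hv
  | succ n _ ih =>
    rcases tree_succ_cases (prm := prm) (inp := inp) hF n with
      h | ⟨w, hw, -, -, -, ⟨h, -, -⟩ | ⟨q, h, -⟩⟩
    · rwa [h]
    · rwa [h]
    · rw [h]
      refine mem_splitLeaf_leaves.2 (.inl ⟨?_, ih⟩)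
      rintro rfl
      exact hnever n hw

end Tree

/-! ### The tree depends on the past only -/

section Past

variable {D c : ℕ} {prm : Params c} {inp inp' : Input D c} {n : ℕ} {s : TreeState D}

/-- The two inputs have the same points before time `n` and the same candidate dimensions. -/
structure Agree (n : ℕ) (inp inp' : Input D c) : Prop where
  X_eq : ∀ i < n, inp.X i = inp'.X i
  Y_eq : ∀ i < n, inp.Y i = inp'.Y i
  I_eq : ∀ i < n, inp.I i = inp'.I i
  dims_eq : inp.dims = inp'.dims

lemma Agree.mono {n' : ℕ} (h : Agree n inp inp') (hn : n' ≤ n) : Agree n' inp inp' where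
  X_eq := fun i hi => h.X_eq i (hi.trans_le hn)
  Y_eq := fun i hi => h.Y_eq i (hi.trans_le hn)
  I_eq := fun i hi => h.I_eq i (hi.trans_le hn)
  dims_eq := h.dims_eq

lemma Agree.side_eq (h : Agree n inp inp') {q : Candidate D} (hq : q.2 < n)
    (A : Set (Fin D → ℝ)) : side inp A q = side inp' A q := by
  funext b
  cases b <;> simp [side, h.X_eq q.2 hq]

lemma Agree.cell_eq (h : Agree n inp inp') (hs : ∀ v q, s.split v = some q → q.2 < n) :
    cell inp s = cell inp' s := by
  funext v
  induction v with
  | nil => rfl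
  | cons b v ih =>
    cases hq : s.split v with
    | none => simp [cell, hq]
    | some q => rw [cell_cons _ b hq, cell_cons _ b hq, ih, h.side_eq (hs v q hq)]

lemma Agree.count_eq (h : Agree n inp inp') (k : PointType) (a : ℕ) {b : ℕ} (hb : b ≤ n) :
    count inp k a b = count inp' k a b := by
  funext A
  unfold count
  congr 1
  ext i
  simp only [Finset.mem_filter, Finset.mem_Ico]
  refine and_congr_right fun hi => ?_
  rw [h.X_eq i (hi.2.trans_le hb), h.I_eq i (hi.2.trans_le hb)]

lemma Agree.hist_eq (h : Agree n inp inp') (k : PointType) (a : ℕ) {b : ℕ} (hb : b ≤ n) :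
    hist inp k a b = hist inp' k a b := by
  funext A y
  unfold hist
  congr 1
  ext i
  simp only [Finset.mem_filter, Finset.mem_Ico]
  refine and_congr_right fun hi => ?_
  have hi := hi.2.trans_le hb
  rw [h.X_eq i hi, h.I_eq i hi, h.Y_eq i hi]

lemma Agree.eligible_eq (h : Agree n inp inp') (hs : ∀ v q, s.split v = some q → q.2 < n)
    (hp : ∀ v, ∀ τ ∈ s.points v, τ < n) (v : Node) {t : ℕ} (ht : t ≤ n) :
    eligible prm inp s v t = eligible prm inp' s v t := by
  unfold eligible
  rw [h.dims_eq]
  refine Finset.filter_congr fun q hq => forall_congr' fun b => ?_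
  rw [h.count_eq _ _ ht, h.cell_eq hs, h.side_eq (hp v _ (Finset.mem_product.1 hq).2)]

lemma pickMax_congr {ι : Type*} {s : Finset ι} {f g : ι → ℝ} (h : ∀ x ∈ s, f x = g x) :
    pickMax s f = pickMax s g := by
  have : argmaxSet s f = argmaxSet s g := by
    unfold argmaxSet
    refine Finset.filter_congr fun x hx => forall₂_congr fun y hy => ?_
    rw [h x hx, h y hy]
  unfold pickMax
  rw [this]

variable [NeZero c]

lemma Agree.sHat_eq (h : Agree n inp inp') (hs : ∀ v q, s.split v = some q → q.2 < n) (v : Node)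
    {t : ℕ} (ht : t ≤ n) : sHat inp s v t = sHat inp' s v t := by
  have hp : prediction inp s v t = prediction inp' s v t := by
    simp only [prediction, h.cell_eq hs, h.hist_eq _ _ ht]
  have he : eHat inp s v t = eHat inp' s v t := by
    unfold eHat
    rw [hp, h.cell_eq hs, h.count_eq _ _ ht]
    congr 3
    ext i
    simp only [Finset.mem_filter, Finset.mem_Ico]
    refine and_congr_right fun hi => ?_
    have hi := hi.2.trans_le ht
    rw [h.X_eq i hi, h.I_eq i hi, h.Y_eq i hi]
  simp only [sHat, pHat, he, h.cell_eq hs, h.count_eq _ _ ht]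

lemma Agree.activateOne_eq (h : Agree n inp inp') (hs : ∀ v q, s.split v = some q → q.2 < n)
    {t : ℕ} (ht : t ≤ n) : activateOne prm inp t s = activateOne prm inp' t s := by
  unfold activateOne
  simp only [h.sHat_eq hs _ ht]

lemma activateOne_split (inp : Input D c) (t : ℕ) (s : TreeState D) :
    (activateOne prm inp t s).split = s.split := by
  rcases activateOne_cases prm inp t s with ⟨h, -⟩ | ⟨v, -, -, h⟩ <;> rw [h]

lemma Agree.iterate_activateOne_eq (h : Agree n inp inp') {t : ℕ} (ht : t ≤ n) (k : ℕ) :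
    ∀ s : TreeState D, (∀ v q, s.split v = some q → q.2 < n) →
      (activateOne prm inp t)^[k] s = (activateOne prm inp' t)^[k] s := by
  induction k with
  | zero => intro s _; rw [Function.iterate_zero_apply, Function.iterate_zero_apply]
  | succ k ih =>
    intro s hs
    have h1 : ∀ v q, (activateOne prm inp t s).split v = some q → q.2 < n := by
      rw [activateOne_split]; exact hs
    rw [Function.iterate_succ_apply, Function.iterate_succ_apply, ih _ h1,
      h.activateOne_eq hs ht]

lemma Agree.refill_eq (h : Agree n inp inp') (hs : ∀ v q, s.split v = some q → q.2 < n)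
    {t : ℕ} (ht : t ≤ n) : refill prm inp t s = refill prm inp' t s :=
  h.iterate_activateOne_eq ht prm.F s hs

lemma Agree.trySplit_eq {t : ℕ} (h : Agree (t + 1) inp inp')
    (hs : ∀ v q, s.split v = some q → q.2 < t + 1) (hp : ∀ v, ∀ τ ∈ s.points v, τ < t + 1)
    (v : Node) : trySplit prm inp s v t = trySplit prm inp' s v t := by
  have he := h.eligible_eq (prm := prm) hs hp v le_rfl
  have hg : ∀ q ∈ eligible prm inp' s v (t + 1),
      candidateGain prm inp s v (t + 1) q = candidateGain prm inp' s v (t + 1) q := by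
    intro q hq
    unfold candidateGain
    rw [h.hist_eq _ _ le_rfl, h.cell_eq hs, h.side_eq (hp v _ (mem_eligible.1 hq).2.1)]
  unfold trySplit
  rw [he, pickMax_congr hg]
  cases hpick : pickMax (eligible prm inp' s v (t + 1)) (candidateGain prm inp' s v (t + 1)) with
  | none => rfl
  | some q =>
    have hq := (pickMax_eq_some hpick).1
    dsimp only
    rw [hg q hq, h.count_eq _ _ le_rfl, h.cell_eq hs, h.refill_eq (n := t + 1) _ le_rfl]
    intro w q' hw
    by_cases hwv : w = v
    · subst hwv
      rw [splitLeaf_split_self, Option.some_inj] at hw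
      exact hw ▸ hp w _ (mem_eligible.1 hq).2.1
    · exact hs w q' (by rwa [splitLeaf_split_of_ne _ _ hwv] at hw)

open Classical in
/-- The body of `step`, with the event that a structure point arrives, the property of being the
active leaf in which it arrives and the resulting state as separate arguments. As `step` makes a
choice from a proof about the input, it is only in this form that equal arguments can be
substituted. -/
noncomputable def stepWith (k : PointType) (p : Node → Prop) (f : Node → TreeState D)
    (s : TreeState D) : TreeState D :=
  if h : k = .structural ∧ ∃ v, p v then f h.2.choose else s

lemma step_eq_stepWith (inp : Input D c) (t : ℕ) (s : TreeState D) :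
    step prm inp t s = stepWith (inp.I t) (fun v => v ∈ s.fringe ∧ inp.X t ∈ cell inp s v)
      (fun v => trySplit prm inp (addPoint prm s v t) v t) s := by
  unfold step stepWith
  congr

lemma Agree.step_eq {t : ℕ} (h : Agree (t + 1) inp inp')
    (hs : ∀ v q, s.split v = some q → q.2 < t) (hp : ∀ v, ∀ τ ∈ s.points v, τ < t) :
    step prm inp t s = step prm inp' t s := by
  have key : ∀ v, trySplit prm inp (addPoint prm s v t) v t =
      trySplit prm inp' (addPoint prm s v t) v t := fun v => by
    have h1 : ∀ w q, (addPoint prm s v t).split w = some q → q.2 < t + 1 :=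
      fun w q hw => (hs w q hw).trans (Nat.lt_succ_self t)
    refine h.trySplit_eq (s := addPoint prm s v t) h1 (fun w τ hτ => ?_) v
    rcases mem_points_addPoint hτ with hτ | ⟨rfl, -, -⟩
    · exact (hp w τ hτ).trans (Nat.lt_succ_self t)
    · exact Nat.lt_succ_self _
  rw [step_eq_stepWith, step_eq_stepWith, funext key, h.X_eq t (Nat.lt_succ_self t),
    h.I_eq t (Nat.lt_succ_self t), (h.mono (Nat.le_succ t)).cell_eq hs]

/-- The tree at time `t` is a function of the points before time `t` and of the candidate
dimensions. -/
lemma Agree.tree_eq (hF : 1 ≤ prm.F) {t : ℕ} (h : Agree t inp inp') :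
    tree prm inp t = tree prm inp' t := by
  induction t with
  | zero => rfl
  | succ t ih =>
    have hinv := tree_invariant (prm := prm) (inp := inp) hF t
    change step prm inp t (tree prm inp t) = step prm inp' t (tree prm inp' t)
    rw [← ih (h.mono (Nat.le_succ t))]
    exact h.step_eq (fun v q hq => hinv.point_lt v _ (hinv.split_mem v q hq)) hinv.point_lt

end Past

instance : Finite PointType :=
  Finite.of_injective (fun k => decide (k = .structural)) fun a b h => by
    cases a <;> cases b <;> simp_all

/-! ### Measurability of the tree -/

lemma measurableSet_imp {Ω : Type*} [MeasurableSpace Ω] {p q : Ω → Prop}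
    (hp : MeasurableSet {ω | p ω}) (hq : MeasurableSet {ω | q ω}) :
    MeasurableSet {ω | p ω → q ω} := by
  simp only [imp_iff_not_or]
  exact hp.compl.union hq

section CountablyValued

variable {Ω : Type*} [MeasurableSpace Ω] {β γ : Type*}

/-- The map takes countably many values, each of them on a measurable set. This is measurability
with respect to the discrete σ-algebra, in a form stable under `CountablyValued.bind`. -/
def CountablyValued (f : Ω → β) : Prop :=
  (Set.range f).Countable ∧ ∀ b, MeasurableSet {ω | f ω = b}

lemma CountablyValued.const (b : β) : CountablyValued fun _ : Ω => b :=
  ⟨(Set.countable_singleton b).mono (by rintro _ ⟨_, rfl⟩; rfl), fun _ => .const _⟩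

/-- A choice between countably many countably valued maps, made by a countably valued map, is
countably valued. -/
lemma CountablyValued.bind {f : Ω → β} {g : β → Ω → γ} {h : Ω → γ} (hf : CountablyValued f)
    (hg : ∀ b, CountablyValued (g b)) (hh : ∀ ω, h ω = g (f ω) ω) : CountablyValued h := by
  constructor
  · refine (hf.1.biUnion fun b _ => (hg b).1).mono ?_
    rintro _ ⟨ω, rfl⟩
    exact Set.mem_biUnion (Set.mem_range_self ω) ⟨ω, (hh ω).symm⟩
  · intro y
    have : {ω | h ω = y} = ⋃ b ∈ Set.range f, ({ω | f ω = b} ∩ {ω | g b ω = y}) := by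
      ext ω
      simp only [Set.mem_ofPred_eq, hh, Set.mem_iUnion, Set.mem_inter_iff, exists_prop]
      exact ⟨fun h => ⟨_, ⟨ω, rfl⟩, rfl, h⟩, fun ⟨b, _, hb, h⟩ => by rwa [hb]⟩
    rw [this]
    exact MeasurableSet.biUnion hf.1 fun b _ => (hf.2 b).inter ((hg b).2 y)

lemma CountablyValued.comp {f : Ω → β} (hf : CountablyValued f) (g : β → γ) :
    CountablyValued fun ω => g (f ω) :=
  hf.bind (g := fun b _ => g b) (fun b => .const (g b)) fun _ => rfl

lemma CountablyValued.prodMk {f : Ω → β} {g : Ω → γ} (hf : CountablyValued f)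
    (hg : CountablyValued g) : CountablyValued fun ω => (f ω, g ω) :=
  hf.bind (g := fun b ω => (b, g ω)) (fun b => hg.comp fun y => (b, y)) fun _ => rfl

lemma CountablyValued.measurableSet {f : Ω → β} (hf : CountablyValued f) (p : β → Prop) :
    MeasurableSet {ω | p (f ω)} := by
  have : {ω | p (f ω)} = ⋃ b ∈ Set.range f ∩ {b | p b}, {ω | f ω = b} := by
    ext ω
    simp
  rw [this]
  exact MeasurableSet.biUnion (hf.1.mono Set.inter_subset_left) fun b _ => hf.2 b

lemma CountablyValued.of_measurableSet {p : Ω → Prop} (hp : MeasurableSet {ω | p ω}) :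
    CountablyValued p := by
  refine ⟨Set.to_countable _, fun q => ?_⟩
  by_cases hq : q
  · simpa [hq] using hp
  · have : {ω | p ω = q} = {ω | p ω}ᶜ := by
      ext ω
      simp [hq]
    rw [this]
    exact hp.compl

lemma CountablyValued.of_countable [Countable β] [MeasurableSpace β] [MeasurableSingletonClass β]
    {f : Ω → β} (hf : Measurable f) : CountablyValued f :=
  ⟨Set.to_countable _, fun b => hf (measurableSet_singleton b)⟩

lemma CountablyValued.pi {ι : Type*} [Finite ι] {f : ι → Ω → β} (hf : ∀ i, CountablyValued (f i)) :
    CountablyValued fun ω i => f i ω := by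
  constructor
  · refine (Set.countable_univ_pi fun i => (hf i).1).mono ?_
    rintro _ ⟨ω, rfl⟩ i _
    exact ⟨ω, rfl⟩
  · intro b
    simp only [funext_iff, Set.ofPred_forall]
    exact MeasurableSet.iInter fun i => (hf i).2 (b i)

lemma CountablyValued.finset {ι : Type*} {G : Ω → Finset ι} (S : Finset ι)
    (hS : ∀ ω, ∀ i ∈ G ω, i ∈ S) (hG : ∀ i ∈ S, MeasurableSet {ω | i ∈ G ω}) :
    CountablyValued G := by
  constructor
  · refine (S.powerset.finite_toSet.subset ?_).countable
    rintro _ ⟨ω, rfl⟩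
    exact Finset.mem_powerset.2 fun i hi => hS ω i hi
  · intro T
    by_cases hT : T ⊆ S
    · have : {ω | G ω = T} = ⋂ i ∈ S, {ω | i ∈ G ω ↔ i ∈ T} := by
        ext ω
        simp only [Set.mem_iInter]
        exact ⟨fun (h : G ω = T) i _ => by simp [h], fun h => Finset.ext fun i =>
          ⟨fun hi => (h i (hS ω i hi)).1 hi, fun hi => (h i (hT hi)).2 hi⟩⟩
      rw [this]
      refine S.measurableSet_biInter fun i hi => ?_
      by_cases hiT : i ∈ T
      · simpa only [hiT, iff_true] using hG i hi
      · simp only [hiT, iff_false]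
        exact (hG i hi).compl
    · convert MeasurableSet.empty
      exact Set.eq_empty_iff_forall_notMem.2 fun ω hω =>
        hT fun i hi => hS ω i (by rwa [show G ω = T from hω])

lemma CountablyValued.iterate {f : Ω → β → β} (hf : ∀ b, CountablyValued fun ω => f ω b) (n : ℕ)
    (b : β) : CountablyValued fun ω => (f ω)^[n] b := by
  induction n with
  | zero => exact .const b
  | succ n ih =>
    exact ih.bind hf fun ω => Function.iterate_succ_apply' _ _ _

lemma CountablyValued.pickMax {ι : Type*} (S : Finset ι) {f : Ω → ι → ℝ}
    (hf : ∀ i ∈ S, CountablyValued fun ω => f ω i) :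
    CountablyValued fun ω => pickMax S (f ω) := by
  have h : CountablyValued fun ω => argmaxSet S (f ω) := by
    refine .finset S (fun _ _ hj => Finset.mem_of_mem_filter _ hj) fun x hx => ?_
    have : {ω | x ∈ argmaxSet S (f ω)} = ⋂ y ∈ S, {ω | f ω y ≤ f ω x} := by
      ext ω
      simp [argmaxSet, hx]
    rw [this]
    refine S.measurableSet_biInter fun y hy => ?_
    exact ((hf y hy).prodMk (hf x hx)).measurableSet fun p => p.1 ≤ p.2
  exact h.comp fun A => open Classical in if h : A.Nonempty then some h.choose else none

end CountablyValued

section TreeMeasurable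

variable {Ω : Type*} [MeasurableSpace Ω] {D c : ℕ} {prm : Params c}
  {X : ℕ → Ω → Fin D → ℝ} {Y : ℕ → Ω → Fin c} {I : ℕ → Ω → PointType}
  {Z : Node → Ω → Finset (Fin D)}

lemma measurableSet_box (hX : ∀ t, Measurable (X t)) (l : List (Candidate D × Bool)) :
    MeasurableSet {p : Ω × (Fin D → ℝ) | p.2 ∈ box (fun t => X t p.1) l} := by
  have : {p : Ω × (Fin D → ℝ) | p.2 ∈ box (fun t => X t p.1) l} =
      ⋂ q ∈ {q | q ∈ l}, {p : Ω × (Fin D → ℝ) |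
        if q.2 then X q.1.2 p.1 q.1.1 < p.2 q.1.1 else p.2 q.1.1 ≤ X q.1.2 p.1 q.1.1} := by
    ext p
    simp [box]
  rw [this]
  refine MeasurableSet.biInter (List.finite_toSet l).countable fun q _ => ?_
  have h1 : Measurable fun p : Ω × (Fin D → ℝ) => X q.1.2 p.1 q.1.1 :=
    (measurable_pi_apply _).comp ((hX _).comp measurable_fst)
  have h2 : Measurable fun p : Ω × (Fin D → ℝ) => p.2 q.1.1 :=
    (measurable_pi_apply _).comp measurable_snd
  cases q.2
  · simpa using measurableSet_le h2 h1
  · simpa using measurableSet_lt h1 h2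

/-- A random subset `A` of the feature space which can be tested at random points. -/
def RandomSet (A : Ω → Set (Fin D → ℝ)) : Prop :=
  ∀ y : Ω → Fin D → ℝ, Measurable y → MeasurableSet {ω | y ω ∈ A ω}

lemma randomSet_side (hX : ∀ t, Measurable (X t)) {A : Ω → Set (Fin D → ℝ)} (hA : RandomSet A)
    (q : Candidate D) (b : Bool) : RandomSet fun ω => side (input X Y I Z ω) (A ω) q b := by
  intro y hy
  have h1 : Measurable fun ω => X q.2 ω q.1 := (measurable_pi_apply _).comp (hX _)
  have h2 : Measurable fun ω => y ω q.1 := (measurable_pi_apply _).comp hy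
  cases b
  · exact (hA y hy).inter (measurableSet_le h2 h1)
  · exact (hA y hy).inter (measurableSet_lt h1 h2)

lemma randomSet_cell (hX : ∀ t, Measurable (X t)) (s : TreeState D) (v : Node) :
    RandomSet fun ω => cell (input X Y I Z ω) s v := by
  induction v with
  | nil => intro y _; simp [cell]
  | cons b v ih =>
    cases hq : s.split v with
    | none => intro y _; simp [cell, hq]
    | some q => simpa only [cell_cons _ b hq] using randomSet_side hX ih q b

lemma randomSet_univ : RandomSet fun _ : Ω => (Set.univ : Set (Fin D → ℝ)) :=
  fun _ _ => .univ

lemma measurableSet_type (hI : ∀ t, Measurable (I t)) (i : ℕ) (k : PointType) :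
    MeasurableSet {ω | I i ω = k} :=
  hI i (show MeasurableSet {k} from trivial)

lemma countablyValued_count (hX : ∀ t, Measurable (X t)) (hI : ∀ t, Measurable (I t))
    {A : Ω → Set (Fin D → ℝ)} (hA : RandomSet A) (k : PointType) (a b : ℕ) :
    CountablyValued fun ω => count (input X Y I Z ω) k a b (A ω) := by
  unfold count
  refine CountablyValued.comp (.finset (Finset.Ico a b) (by simp +contextual)
    fun i hi => ?_) Finset.card
  simp only [Finset.mem_filter, hi, true_and]
  exact (measurableSet_type hI i k).inter (hA _ (hX i))

lemma countablyValued_hist (hX : ∀ t, Measurable (X t)) (hY : ∀ t, Measurable (Y t))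
    (hI : ∀ t, Measurable (I t)) {A : Ω → Set (Fin D → ℝ)} (hA : RandomSet A) (k : PointType)
    (a b : ℕ) : CountablyValued fun ω => hist (input X Y I Z ω) k a b (A ω) := by
  unfold hist
  refine .pi fun y => CountablyValued.comp (.finset (Finset.Ico a b)
    (by simp +contextual) fun i hi => ?_) Finset.card
  simp only [Finset.mem_filter, hi, true_and]
  exact (measurableSet_type hI i k).inter
    ((hA _ (hX i)).inter (hY i (measurableSet_singleton y)))

variable [NeZero c]

lemma countablyValued_prediction (hX : ∀ t, Measurable (X t)) (hY : ∀ t, Measurable (Y t))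
    (hI : ∀ t, Measurable (I t)) (s : TreeState D) (v : Node) (t : ℕ) :
    CountablyValued fun ω => prediction (input X Y I Z ω) s v t :=
  (countablyValued_hist hX hY hI (randomSet_cell hX s v) _ _ _).comp majority

lemma countablyValued_sHat (hX : ∀ t, Measurable (X t)) (hY : ∀ t, Measurable (Y t))
    (hI : ∀ t, Measurable (I t)) (s : TreeState D) (v : Node) (t : ℕ) :
    CountablyValued fun ω => sHat (input X Y I Z ω) s v t := by
  have hc := randomSet_cell (Y := Y) (I := I) (Z := Z) hX s v
  have h1 := countablyValued_count (Y := Y) (Z := Z) hX hI hc .estimation (birth s v) t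
  have h2 := countablyValued_count (Y := Y) (Z := Z) hX hI (randomSet_univ (Ω := Ω)) .estimation
    (birth s v) t
  have h3 : CountablyValued fun ω => open Classical in
      ((Finset.Ico (birth s v) t).filter fun i => (input X Y I Z ω).I i = .estimation ∧
        (input X Y I Z ω).X i ∈ cell (input X Y I Z ω) s v ∧
        (input X Y I Z ω).Y i ≠ prediction (input X Y I Z ω) s v t) := by
    refine .finset (Finset.Ico (birth s v) t) (by simp +contextual) fun i hi => ?_
    simp only [Finset.mem_filter, hi, true_and]
    refine (measurableSet_type hI i _).inter ((hc _ (hX i)).inter ?_)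
    exact ((CountablyValued.of_countable (hY i)).prodMk
      (countablyValued_prediction hX hY hI s v t)).measurableSet fun p => p.1 ≠ p.2
  exact ((h1.prodMk h2).prodMk h3).comp fun p =>
    (p.1.1 : ℝ) / (p.1.2 : ℝ) * ((p.2.card : ℝ) / (p.1.1 : ℝ))

lemma countablyValued_refill (hX : ∀ t, Measurable (X t)) (hY : ∀ t, Measurable (Y t))
    (hI : ∀ t, Measurable (I t)) (s : TreeState D) (t : ℕ) :
    CountablyValued fun ω => refill prm (input X Y I Z ω) t s := by
  refine .iterate (fun s => ?_) prm.F s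
  unfold activateOne
  by_cases h : s.fringe.card < prm.F
  · simp only [h, if_true]
    have hp : CountablyValued fun ω =>
        pickMax (s.leaves \ s.fringe) (fun v => sHat (input X Y I Z ω) s v t) :=
      .pickMax _ fun v _ => countablyValued_sHat hX hY hI s v t
    refine hp.bind (g := fun o _ => match o with
      | some v => { s with fringe := insert v s.fringe }
      | none => s) (fun o => .const _) fun ω => ?_
    rfl
  · simp only [h, if_false]
    exact .const s

lemma countablyValued_trySplit (hX : ∀ t, Measurable (X t)) (hY : ∀ t, Measurable (Y t))
    (hI : ∀ t, Measurable (I t)) (hZ : ∀ v, Measurable (Z v)) (s : TreeState D) (v : Node)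
    (t : ℕ) : CountablyValued fun ω => trySplit prm (input X Y I Z ω) s v t := by
  have hc := randomSet_cell (Y := Y) (I := I) (Z := Z) hX s v
  have hs := fun q b => randomSet_side (Y := Y) (I := I) (Z := Z) hX hc q b
  have helig : CountablyValued fun ω => eligible prm (input X Y I Z ω) s v (t + 1) := by
    refine (CountablyValued.of_countable (hZ v)).bind (g := fun S ω => open Classical in
      (S ×ˢ s.points v).filter fun q => ∀ b, prm.α v.length ≤
        (count (input X Y I Z ω) .estimation q.2 (t + 1)
          (side (input X Y I Z ω) (cell (input X Y I Z ω) s v) q b) : ℝ)) (fun S => ?_)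
      fun ω => rfl
    refine .finset (S ×ˢ s.points v) (by simp +contextual) fun q hq => ?_
    simp only [Finset.mem_filter, hq, true_and, Set.ofPred_forall]
    refine MeasurableSet.iInter fun b => ?_
    exact (countablyValued_count (Y := Y) (Z := Z) hX hI (hs q b) _ _ _).measurableSet
      fun k => prm.α v.length ≤ (k : ℝ)
  have hgain : ∀ q, CountablyValued fun ω => candidateGain prm (input X Y I Z ω) s v (t + 1) q :=
    fun q => ((countablyValued_hist (Z := Z) hX hY hI (hs q false) _ _ _).prodMk
      (countablyValued_hist (Z := Z) hX hY hI (hs q true) _ _ _)).comp fun p => prm.gain p.1 p.2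
  have hpick : CountablyValued fun ω => pickMax (eligible prm (input X Y I Z ω) s v (t + 1))
      (candidateGain prm (input X Y I Z ω) s v (t + 1)) :=
    helig.bind (g := fun S ω => pickMax S (candidateGain prm (input X Y I Z ω) s v (t + 1)))
      (fun S => .pickMax S fun q _ => hgain q) fun ω => rfl
  refine hpick.bind (g := fun o ω => match o with
    | some q =>
      open Classical in
      if prm.τ ≤ candidateGain prm (input X Y I Z ω) s v (t + 1) q ∨
        prm.β v.length ≤ (count (input X Y I Z ω) .estimation (birth s v) (t + 1)
          (cell (input X Y I Z ω) s v) : ℝ) then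
        refill prm (input X Y I Z ω) (t + 1) (splitLeaf s v q)
      else s
    | none => s) (fun o => ?_) fun ω => rfl
  cases o with
  | none => exact .const s
  | some q =>
    have hcond : CountablyValued fun ω =>
        (prm.τ ≤ candidateGain prm (input X Y I Z ω) s v (t + 1) q ∨
        prm.β v.length ≤ (count (input X Y I Z ω) .estimation (birth s v) (t + 1)
          (cell (input X Y I Z ω) s v) : ℝ)) :=
      ((hgain q).prodMk (countablyValued_count (Y := Y) (Z := Z) hX hI hc .estimation
        (birth s v) (t + 1))).comp fun p => prm.τ ≤ p.1 ∨ prm.β v.length ≤ (p.2 : ℝ)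
    refine hcond.bind (g := fun (p : Prop) ω => open Classical in if p then
      refill prm (input X Y I Z ω) (t + 1) (splitLeaf s v q) else s) (fun p => ?_) fun ω => by
        dsimp only
        congr
    by_cases hp : p
    · simpa [hp] using countablyValued_refill hX hY hI _ _
    · simpa [hp] using CountablyValued.const s

lemma countablyValued_tree (hX : ∀ t, Measurable (X t)) (hY : ∀ t, Measurable (Y t))
    (hI : ∀ t, Measurable (I t)) (hZ : ∀ v, Measurable (Z v)) (t : ℕ) :
    CountablyValued fun ω => tree prm (input X Y I Z ω) t := by
  induction t with
  | zero => exact .const _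
  | succ t ih =>
    refine ih.bind (g := fun s ω => step prm (input X Y I Z ω) t s) (fun s => ?_) fun ω => rfl
    classical
    have hactive : CountablyValued fun ω =>
        ((input X Y I Z ω).I t, s.fringe.filter fun v =>
          (input X Y I Z ω).X t ∈ cell (input X Y I Z ω) s v) :=
      CountablyValued.prodMk ⟨Set.Finite.countable (Set.toFinite _),
        fun k => measurableSet_type hI t k⟩
        (.finset s.fringe (by simp +contextual) fun v hv => by
          simp only [Finset.mem_filter, hv, true_and]
          exact randomSet_cell hX s v _ (hX t))
    have hpred : CountablyValued fun ω => ((input X Y I Z ω).I t, fun v => v ∈ s.fringe ∧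
        (input X Y I Z ω).X t ∈ cell (input X Y I Z ω) s v) := by
      refine (hactive.comp fun p => (p.1, fun v => v ∈ p.2)).bind (g := fun p _ => p)
        (fun p => .const p) fun ω => ?_
      simp
    refine hpred.bind (g := fun p ω => stepWith p.1 p.2
      (fun v => trySplit prm (input X Y I Z ω) (addPoint prm s v t) v t) s)
      (fun p => ?_) fun ω => step_eq_stepWith _ _ _
    unfold stepWith
    by_cases h : p.1 = .structural ∧ ∃ v, p.2 v
    · simp only [h, and_self, dif_pos]
      exact countablyValued_trySplit hX hY hI hZ _ _ _
    · simp only [h, dif_neg, not_false_eq_true]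
      exact CountablyValued.const s

end TreeMeasurable

/-! ### Resampling coordinates of an i.i.d. sequence -/

section Glue

variable {E : Type*}

open Classical in
/-- The sequence which coincides with `p` on `J` and with `f` outside `J`. -/
noncomputable def glue (J : Set ℕ) (p f : ℕ → E) : ℕ → E := fun s => if s ∈ J then p s else f s

lemma glue_of_mem {J : Set ℕ} {s : ℕ} (h : s ∈ J) (p f : ℕ → E) : glue J p f s = p s :=
  if_pos h

lemma glue_of_notMem {J : Set ℕ} {s : ℕ} (h : s ∉ J) (p f : ℕ → E) : glue J p f s = f s :=
  if_neg h

variable [MeasurableSpace E] {ρ : Measure E} [IsProbabilityMeasure ρ]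

/-- Replacing the coordinates outside `J` of an i.i.d. sequence by those of an independent copy
does not change the law. -/
lemma measurePreserving_glue (J : Set ℕ) :
    MeasurePreserving (fun z : (ℕ → E) × (ℕ → E) => glue J z.1 z.2)
      ((Measure.infinitePi fun _ => ρ).prod (Measure.infinitePi fun _ => ρ))
      (Measure.infinitePi fun _ => ρ) := by
  classical
  have hm : Measurable (fun z : (ℕ → E) × (ℕ → E) => glue J z.1 z.2) := by
    refine measurable_pi_lambda _ fun s => ?_
    by_cases h : s ∈ J
    · simp only [glue_of_mem h]
      exact (measurable_pi_apply s).comp measurable_fst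
    · simp only [glue_of_notMem h]
      exact (measurable_pi_apply s).comp measurable_snd
  refine ⟨hm, Measure.eq_infinitePi _ fun S T hT => ?_⟩
  rw [Measure.map_apply hm (MeasurableSet.pi S.countable_toSet fun i _ => hT i)]
  have : (fun z : (ℕ → E) × (ℕ → E) => glue J z.1 z.2) ⁻¹' ((S : Set ℕ).pi T) =
      (((S.filter (· ∈ J) : Finset ℕ) : Set ℕ).pi T) ×ˢ
        (((S.filter (· ∉ J) : Finset ℕ) : Set ℕ).pi T) := by
    ext z
    simp only [Set.mem_preimage, Set.mem_pi, Finset.mem_coe, Set.mem_prod, Finset.mem_filter]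
    constructor
    · intro h
      exact ⟨fun i hi => by simpa only [glue_of_mem hi.2] using h i hi.1,
        fun i hi => by simpa only [glue_of_notMem hi.2] using h i hi.1⟩
    · rintro ⟨h1, h2⟩ i hi
      by_cases hJ : i ∈ J
      · simpa only [glue_of_mem hJ] using h1 i ⟨hi, hJ⟩
      · simpa only [glue_of_notMem hJ] using h2 i ⟨hi, hJ⟩
  rw [this, Measure.prod_prod, Measure.infinitePi_pi _ (fun i _ => hT i),
    Measure.infinitePi_pi _ (fun i _ => hT i), Finset.prod_filter_mul_prod_filter_not]

lemma lintegral_glue (J : Set ℕ) {g : (ℕ → E) → ℝ≥0∞} (hg : Measurable g) :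
    ∫⁻ x, g x ∂(Measure.infinitePi fun _ => ρ) =
      ∫⁻ p, ∫⁻ f, g (glue J p f) ∂(Measure.infinitePi fun _ => ρ)
        ∂(Measure.infinitePi fun _ => ρ) := by
  have h := measurePreserving_glue (ρ := ρ) J
  rw [← h.lintegral_comp hg]
  exact lintegral_prod _ (hg.comp h.measurable).aemeasurable

lemma ae_of_ae_glue (J : Set ℕ) {P : (ℕ → E) → Prop} (hP : MeasurableSet {x | P x})
    (h : ∀ p, ∀ᵐ f ∂(Measure.infinitePi fun _ => ρ), P (glue J p f)) :
    ∀ᵐ x ∂(Measure.infinitePi fun _ => ρ), P x := by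
  have hg := measurePreserving_glue (ρ := ρ) J
  rw [← hg.map_eq, ae_map_iff hg.measurable.aemeasurable hP]
  exact (Measure.ae_prod_iff_ae_ae (hg.measurable hP)).2 (.of_forall h)

lemma map_eval_infinitePi (s : ℕ) :
    (Measure.infinitePi fun _ : ℕ => ρ).map (fun x => x s) = ρ :=
  Measure.infinitePi_map_eval (fun _ => ρ) s

lemma lintegral_eval_infinitePi (s : ℕ) {g : E → ℝ≥0∞} (hg : Measurable g) :
    ∫⁻ x, g (x s) ∂(Measure.infinitePi fun _ : ℕ => ρ) = ∫⁻ y, g y ∂ρ := by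
  conv_rhs => rw [← map_eval_infinitePi (ρ := ρ) s]
  rw [lintegral_map hg (measurable_pi_apply s)]

lemma ae_eval_infinitePi (s : ℕ) {P : E → Prop} (h : ∀ᵐ y ∂ρ, P y) :
    ∀ᵐ x ∂(Measure.infinitePi fun _ : ℕ => ρ), P (x s) := by
  rw [← map_eval_infinitePi (ρ := ρ) s] at h
  exact ae_of_ae_map (measurable_pi_apply s).aemeasurable h

end Glue

/-! ### Frequencies along a subsequence -/

section Frequency

variable {E : Type*} [MeasurableSpace E] {ρ : Measure E} [IsProbabilityMeasure ρ]

open Classical in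
lemma sum_range_count_nth {K : Set ℕ} (hK : K.Infinite) (g : ℕ → ℝ) (t : ℕ) :
    ∑ i ∈ Finset.range (Nat.count (· ∈ K) t), g (Nat.nth (· ∈ K) i) =
      ∑ u ∈ Finset.range t with u ∈ K, g u := by
  refine Finset.sum_bij (fun i _ => Nat.nth (· ∈ K) i) ?_ ?_ ?_ fun _ _ => rfl
  · intro i hi
    simp only [Finset.mem_filter, Finset.mem_range] at hi ⊢
    exact ⟨Nat.nth_lt_of_lt_count hi, Nat.nth_mem_of_infinite hK i⟩
  · intro i _ j _ h
    exact Nat.nth_injective hK h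
  · intro u hu
    simp only [Finset.mem_filter, Finset.mem_range] at hu
    exact ⟨Nat.count (· ∈ K) u, Finset.mem_range.2 (Nat.count_strict_mono hu.2 hu.1),
      Nat.nth_count hu.2⟩

open Classical in
/-- Along an infinite set `K` of times, an i.i.d. sequence visits a set of positive measure with
positive asymptotic frequency. -/
lemma ae_exists_frequency {K : Set ℕ} (hK : K.Infinite) {B : Set E} (hB : MeasurableSet B)
    (hpos : ρ B ≠ 0) : ∀ᵐ f ∂(Measure.infinitePi fun _ : ℕ => ρ), ∃ n : ℕ, ∀ᶠ t in atTop,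
      ((Finset.range t).filter (· ∈ K)).card ≤
        n * ((Finset.range t).filter fun u => u ∈ K ∧ f u ∈ B).card := by
  set ν := Measure.infinitePi fun _ : ℕ => ρ with hν
  set ind : E → ℝ := B.indicator 1 with hind
  have hindm : Measurable ind := measurable_one.indicator hB
  set W : ℕ → (ℕ → E) → ℝ := fun i f => ind (f (Nat.nth (· ∈ K) i)) with hW
  have hindep : iIndepFun (fun (u : ℕ) (f : ℕ → E) => ind (f u)) ν :=
    iIndepFun_infinitePi (P := fun _ : ℕ => ρ) (X := fun _ => ind) fun _ => hindm
  -- the strong law of large numbers applies to the indicators `W i` of a visit at the `i`-th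
  -- element of `K`
  have hident : ∀ i j, IdentDistrib (W i) (W j) ν ν := fun i j => by
    have h : IdentDistrib (fun f : ℕ → E => f (Nat.nth (· ∈ K) i))
        (fun f : ℕ → E => f (Nat.nth (· ∈ K) j)) ν ν :=
      ⟨(measurable_pi_apply _).aemeasurable, (measurable_pi_apply _).aemeasurable, by
        rw [map_eval_infinitePi, map_eval_infinitePi]⟩
    exact h.comp hindm
  have hmean : ∫ f, W 0 f ∂ν = ρ.real B := by
    have h1 : ∫ f, W 0 f ∂ν = ∫ y, ind y ∂ρ := by
      conv_rhs => rw [← map_eval_infinitePi (ρ := ρ) (Nat.nth (· ∈ K) 0)]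
      rw [integral_map (measurable_pi_apply _).aemeasurable hindm.aestronglyMeasurable]
    rw [h1, hind, integral_indicator_one hB]
  have hint : Integrable (W 0) ν := by
    refine Integrable.of_bound (hindm.comp (measurable_pi_apply _)).aestronglyMeasurable 1
      (.of_forall fun f => ?_)
    simp only [hW, hind, Set.indicator_apply]
    split_ifs <;> simp
  have hlaw := strong_law_ae_real W hint
    (fun i j hij => (hindep.indepFun ((Nat.nth_injective hK).ne hij))) (fun i => hident i 0)
  rw [hmean] at hlaw
  have hb : 0 < ρ.real B := ENNReal.toReal_pos hpos (measure_ne_top _ _)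
  filter_upwards [hlaw] with f hf
  obtain ⟨n, hn⟩ := exists_nat_gt (2 / ρ.real B)
  refine ⟨n, ?_⟩
  have hcount : Tendsto (Nat.count (· ∈ K)) atTop atTop := by
    refine tendsto_atTop_atTop.2 fun b => ⟨Nat.nth (· ∈ K) b, fun t ht => ?_⟩
    exact (Nat.count_nth_of_infinite (p := (· ∈ K)) hK b).symm.le.trans (Nat.count_monotone _ ht)
  have hev := (hf.comp hcount).eventually (lt_mem_nhds (half_lt_self hb))
  filter_upwards [hev, hcount.eventually (eventually_gt_atTop 0)] with t ht hpos
  have hN : ((Finset.range t).filter (· ∈ K)).card = Nat.count (· ∈ K) t := by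
    rw [Nat.count_eq_card_filter_range (p := (· ∈ K))]
  have hS : ∑ i ∈ Finset.range (Nat.count (· ∈ K) t), W i f =
      (((Finset.range t).filter fun u => u ∈ K ∧ f u ∈ B).card : ℝ) := by
    rw [sum_range_count_nth hK (fun u => ind (f u)) t, hind]
    simp only [Set.indicator_apply, Pi.one_apply, Finset.sum_boole, Finset.filter_filter]
  simp only [Function.comp_apply] at ht
  rw [hS, lt_div_iff₀ (by exact_mod_cast hpos)] at ht
  rw [hN]
  have hn' : 2 < n * ρ.real B := by rwa [div_lt_iff₀ hb] at hn
  have hcpos : (0 : ℝ) < Nat.count (· ∈ K) t := by exact_mod_cast hpos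
  have hn0 : (0 : ℝ) ≤ n := Nat.cast_nonneg n
  have : (Nat.count (· ∈ K) t : ℝ) ≤
      n * (((Finset.range t).filter fun u => u ∈ K ∧ f u ∈ B).card : ℝ) := by
    have := mul_le_mul_of_nonneg_left ht.le hn0
    nlinarith
  exact_mod_cast this

end Frequency

/-! ### Splitting a distribution at a random point -/

section SplitMeasure

lemma measure_le_of_forall_compact {κ : Measure ℝ} [IsFiniteMeasure κ] {S : Set ℝ}
    (hS : MeasurableSet S) {a : ℝ≥0∞} (h : ∀ K ⊆ S, IsCompact K → κ K ≤ a) : κ S ≤ a := by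
  rw [hS.measure_eq_iSup_isCompact_of_ne_top (measure_ne_top _ _)]
  exact iSup₂_le fun K hK => iSup_le fun hc => h K hK hc

lemma measurable_measure_Iic (κ : Measure ℝ) : Measurable fun y => κ (Set.Iic y) :=
  Monotone.measurable fun _ _ h => measure_mono (Set.Iic_subset_Iic.2 h)

lemma measurable_measure_Ici (κ : Measure ℝ) : Measurable fun y => κ (Set.Ici y) :=
  Antitone.measurable fun _ _ h => measure_mono (Set.Ici_subset_Ici.2 h)

lemma measurable_measure_Ioi (κ : Measure ℝ) : Measurable fun y => κ (Set.Ioi y) :=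
  Antitone.measurable fun _ _ h => measure_mono (Set.Ioi_subset_Ioi h)

/-- The distribution function of a random variable, evaluated at this variable, is at most `a`
with probability at most `a`. -/
lemma measure_setOf_measure_Iic_le (κ : Measure ℝ) [IsFiniteMeasure κ] (a : ℝ≥0∞) :
    κ {y | κ (Set.Iic y) ≤ a} ≤ a := by
  refine measure_le_of_forall_compact
    (measurableSet_le (measurable_measure_Iic κ) measurable_const) fun K hK hc => ?_
  rcases K.eq_empty_or_nonempty with rfl | hne
  · simp
  -- `K` lies below its greatest element, which belongs to the set
  · obtain ⟨y, hy⟩ := hc.exists_isGreatest hne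
    exact (measure_mono fun z hz => hy.2 hz).trans (hK hy.1)

lemma measure_setOf_measure_Ici_le (κ : Measure ℝ) [IsFiniteMeasure κ] (a : ℝ≥0∞) :
    κ {y | κ (Set.Ici y) ≤ a} ≤ a := by
  refine measure_le_of_forall_compact
    (measurableSet_le (measurable_measure_Ici κ) measurable_const) fun K hK hc => ?_
  rcases K.eq_empty_or_nonempty with rfl | hne
  · simp
  · obtain ⟨y, hy⟩ := hc.exists_isLeast hne
    exact (measure_mono fun z hz => hy.2 hz).trans (hK hy.1)

/-- If the function `f` comes within `η M` of `M` only on a set of measure `η M`, then the mean of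
`(f / M) ^ r` is at most `η + (1 - η) ^ r`. -/
lemma lintegral_pow_le {κ : Measure ℝ} {M : ℝ≥0∞} (hM : κ Set.univ ≤ M) {f : ℝ → ℝ≥0∞} {η : ℝ≥0∞}
    {S : Set ℝ} (hS : MeasurableSet S) (hSM : κ S ≤ η * M) (hf : ∀ y, f y ≤ M)
    (hfS : ∀ y ∉ S, f y ≤ (1 - η) * M) (r : ℕ) :
    ∫⁻ y, f y ^ r ∂κ ≤ (η + (1 - η) ^ r) * M ^ (r + 1) := by
  have hpt : ∀ y, f y ^ r ≤ S.indicator (fun _ => M ^ r) y + ((1 - η) * M) ^ r := by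
    intro y
    by_cases hy : y ∈ S
    · rw [Set.indicator_of_mem hy]
      exact (pow_le_pow_left' (hf y) r).trans le_self_add
    · exact (pow_le_pow_left' (hfS y hy) r).trans le_add_self
  calc ∫⁻ y, f y ^ r ∂κ ≤ ∫⁻ y, (S.indicator (fun _ => M ^ r) y + ((1 - η) * M) ^ r) ∂κ :=
        lintegral_mono hpt
    _ = M ^ r * κ S + ((1 - η) * M) ^ r * κ Set.univ := by
        rw [lintegral_add_right _ measurable_const, lintegral_indicator_const hS,
          lintegral_const]
    _ ≤ M ^ r * (η * M) + ((1 - η) * M) ^ r * M := by gcongr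
    _ = (η + (1 - η) ^ r) * M ^ (r + 1) := by ring

lemma le_one_sub_mul {a b M η : ℝ≥0∞} (hM : M ≠ ⊤) (hη : η ≤ 1) (h : a + b ≤ M)
    (hb : η * M ≤ b) : a ≤ (1 - η) * M := by
  have hηM : η * M ≠ ⊤ := ENNReal.mul_ne_top (ne_top_of_le_ne_top ENNReal.one_ne_top hη) hM
  rw [ENNReal.sub_mul (fun _ _ => hM), one_mul]
  refine ENNReal.le_sub_of_add_le_right hηM ?_
  exact (add_le_add_right hb a).trans h

/-- High moments of the relative mass of the part of a distribution cut off at a random point are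
small, uniformly over all distributions without atoms. -/
lemma exists_pow_moment_le {δ : ℝ≥0∞} (hδ : δ ≠ 0) (hδ1 : δ ≤ 1) : ∃ r : ℕ, 1 ≤ r ∧
    ∀ (κ : Measure ℝ) [IsFiniteMeasure κ] [NullSingletonClass κ],
      ∫⁻ y, κ (Set.Iic y) ^ r ∂κ ≤ δ * κ Set.univ ^ (r + 1) ∧
      ∫⁻ y, κ (Set.Ioi y) ^ r ∂κ ≤ δ * κ Set.univ ^ (r + 1) := by
  set η := δ / 2 with hη
  have hη0 : η ≠ 0 := (ENNReal.half_pos hδ).ne'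
  have hη1 : η ≤ 1 := ENNReal.half_le_self.trans hδ1
  have hlt : 1 - η < 1 := ENNReal.sub_lt_self ENNReal.one_ne_top one_ne_zero hη0
  have hlim := ENNReal.tendsto_pow_atTop_nhds_zero_of_lt_one hlt
  obtain ⟨r, hr1, hr⟩ := ((eventually_ge_atTop 1).and
    (hlim.eventually (ge_mem_nhds (pos_iff_ne_zero.2 hη0)))).exists
  refine ⟨r, hr1, fun κ _ _ => ?_⟩
  have hM : κ Set.univ ≠ ⊤ := measure_ne_top _ _
  have hsum : η + (1 - η) ^ r ≤ δ := by
    calc η + (1 - η) ^ r ≤ η + η := by gcongr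
      _ = δ := ENNReal.add_halves δ
  have htotal : ∀ y, κ (Set.Iic y) + κ (Set.Ioi y) = κ Set.univ := fun y => by
    rw [← measure_union (Set.Iic_disjoint_Ioi le_rfl) measurableSet_Ioi, Set.Iic_union_Ioi]
  have hIci : ∀ y, κ (Set.Ici y) = κ (Set.Ioi y) := fun y => measure_congr Ioi_ae_eq_Ici.symm
  constructor
  -- the cut leaves less than a fraction `η` above only if it is made in a set of mass `η κ(ℝ)`
  · refine (lintegral_pow_le le_rfl (measurableSet_le (measurable_measure_Ici κ) measurable_const)
      (measure_setOf_measure_Ici_le κ _) (fun y => measure_mono (Set.subset_univ _))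
      (fun y hy => ?_) r).trans (by gcongr)
    refine le_one_sub_mul hM hη1 (htotal y).le ?_
    rw [← hIci]
    exact (not_le.1 hy).le
  · refine (lintegral_pow_le le_rfl (measurableSet_le (measurable_measure_Iic κ) measurable_const)
      (measure_setOf_measure_Iic_le κ _) (fun y => measure_mono (Set.subset_univ _))
      (fun y hy => ?_) r).trans (by gcongr)
    refine le_one_sub_mul hM hη1 (le_of_eq ?_) (not_le.1 hy).le
    rw [add_comm, htotal y]

variable {D : ℕ} {μ : Measure (Fin D → ℝ)}

/-- The side `b` (`false`: below, `true`: above) of the hyperplane `{z | z j = a}`. -/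
def halfSpace (j : Fin D) (b : Bool) (a : ℝ) : Set (Fin D → ℝ) :=
  (fun z => z j) ⁻¹' (if b then Set.Ioi a else Set.Iic a)

lemma box_cons (x : ℕ → Fin D → ℝ) (q : Candidate D) (b : Bool) (l : List (Candidate D × Bool)) :
    box x ((q, b) :: l) = halfSpace q.1 b (x q.2 q.1) ∩ box x l := by
  ext z
  cases b <;> simp [box, halfSpace]

lemma nullSingletonClass_map_eval (hμ : μ ≪ volume) (A : Set (Fin D → ℝ)) (j : Fin D) :
    NullSingletonClass ((μ.restrict A).map fun z => z j) := by
  refine ⟨fun a => ?_⟩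
  rw [Measure.map_apply (measurable_pi_apply j) (measurableSet_singleton a)]
  refine le_antisymm ((Measure.restrict_le_self _).trans_eq ?_) zero_le
  have h : (volume : Measure (Fin D → ℝ)) {z | z j = a} = 0 :=
    Measure.pi_hyperplane (fun _ : Fin D => (volume : Measure ℝ)) j a
  exact hμ h

lemma map_restrict_eval_apply (A : Set (Fin D → ℝ)) (j : Fin D) (b : Bool) (a : ℝ) :
    ((μ.restrict A).map fun z => z j) (if b then Set.Ioi a else Set.Iic a) =
      μ (halfSpace j b a ∩ A) := by
  have hm : MeasurableSet (if b then Set.Ioi a else Set.Iic a) := by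
    cases b
    · exact measurableSet_Iic
    · exact measurableSet_Ioi
  rw [Measure.map_apply (measurable_pi_apply j) hm,
    Measure.restrict_apply (measurable_pi_apply j hm)]
  rfl

lemma map_restrict_eval_univ (A : Set (Fin D → ℝ)) (j : Fin D) :
    ((μ.restrict A).map fun z => z j) Set.univ = μ A := by
  rw [Measure.map_apply (measurable_pi_apply j) .univ]
  simp

lemma measurable_measure_halfSpace_inter (A : Set (Fin D → ℝ)) (j : Fin D) (b : Bool) :
    Measurable fun a => μ (halfSpace j b a ∩ A) := by
  simp only [← map_restrict_eval_apply]
  cases b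
  · exact measurable_measure_Iic _
  · exact measurable_measure_Ioi _

lemma lintegral_halfSpace_inter_pow (A : Set (Fin D → ℝ)) (j : Fin D) (b : Bool) (r : ℕ) :
    ∫⁻ y in A, μ (halfSpace j b (y j) ∩ A) ^ r ∂μ =
      ∫⁻ a, ((μ.restrict A).map fun z => z j) (if b then Set.Ioi a else Set.Iic a) ^ r
        ∂((μ.restrict A).map fun z => z j) := by
  simp only [map_restrict_eval_apply]
  rw [lintegral_map ((measurable_measure_halfSpace_inter A j b).pow_const r)
    (measurable_pi_apply j)]

/-- If the exponent `r` is large enough, then cutting any set `A` at a random point of `A`,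
orthogonally to a coordinate, leaves on either side a mass whose `r`-th power has mean at most
`δ μ(A) ^ r`. -/
lemma exists_pow_halfSpace_le {δ : ℝ≥0∞} (hδ : δ ≠ 0) (hδ1 : δ ≤ 1) [IsFiniteMeasure μ]
    (hμ : μ ≪ volume) : ∃ r : ℕ, 1 ≤ r ∧ ∀ (A : Set (Fin D → ℝ)) (j : Fin D) (b : Bool),
      ∫⁻ y in A, μ (halfSpace j b (y j) ∩ A) ^ r ∂μ ≤ δ * μ A ^ (r + 1) := by
  obtain ⟨r, hr, h⟩ := exists_pow_moment_le hδ hδ1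
  refine ⟨r, hr, fun A j b => ?_⟩
  have := nullSingletonClass_map_eval hμ A j
  rw [lintegral_halfSpace_inter_pow, ← map_restrict_eval_univ (μ := μ) A j]
  cases b
  · simpa using (h ((μ.restrict A).map fun z => z j)).1
  · simpa using (h ((μ.restrict A).map fun z => z j)).2

/-- A random point of `A` almost surely splits `A` into two parts of positive measure. -/
lemma ae_measure_halfSpace_inter_ne_zero [IsFiniteMeasure μ] (hμ : μ ≪ volume)
    {A : Set (Fin D → ℝ)} (hA : MeasurableSet A) (j : Fin D) (b : Bool) :
    ∀ᵐ y ∂μ, y ∈ A → μ (halfSpace j b (y j) ∩ A) ≠ 0 := by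
  rw [← ae_restrict_iff' hA]
  have hna := nullSingletonClass_map_eval hμ A j
  set κ := (μ.restrict A).map fun z => z j with hκ
  have key : ∀ᵐ a ∂κ, κ (if b then Set.Ioi a else Set.Iic a) ≠ 0 := by
    rw [ae_iff]
    simp only [ne_eq, not_not]
    cases b
    · simpa using measure_setOf_measure_Iic_le κ 0
    · have hIci : ∀ y, κ (Set.Ici y) = κ (Set.Ioi y) := fun y => measure_congr Ioi_ae_eq_Ici.symm
      simpa [hIci] using measure_setOf_measure_Ici_le κ 0
  have := ae_of_ae_map (measurable_pi_apply j).aemeasurable key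
  filter_upwards [this] with y hy
  rwa [hκ, map_restrict_eval_apply] at hy

end SplitMeasure

/-! ### Typical sequences of data points -/

section Typical

variable {D c : ℕ} {ρ : Measure ((Fin D → ℝ) × Fin c)} [IsProbabilityMeasure ρ]

lemma measurable_feature (t : ℕ) :
    Measurable fun x : ℕ → (Fin D → ℝ) × Fin c => (x t).1 :=
  measurable_fst.comp (measurable_pi_apply t)

lemma lintegral_feature {μ : Measure (Fin D → ℝ)} (hμ : ρ.map Prod.fst = μ) (t : ℕ)
    {A : Set (Fin D → ℝ)} (hA : MeasurableSet A) {g : (Fin D → ℝ) → ℝ≥0∞} (hg : Measurable g) :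
    ∫⁻ f, A.indicator g (f t).1 ∂(Measure.infinitePi fun _ : ℕ => ρ) = ∫⁻ y in A, g y ∂μ := by
  rw [← lintegral_indicator hA, ← hμ, lintegral_map (hg.indicator hA) measurable_fst]
  exact lintegral_eval_infinitePi t ((hg.indicator hA).comp measurable_fst)

lemma measurableSet_box_apply (x : ℕ → Fin D → ℝ) (l : List (Candidate D × Bool)) :
    MeasurableSet (box x l) := by
  have h := measurableSet_box (Ω := Unit) (X := fun t _ => x t) (fun t => measurable_const) l
  exact measurable_prodMk_left (x := ()) h

lemma measurableSet_box_feature (l : List (Candidate D × Bool)) :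
    MeasurableSet {p : (ℕ → (Fin D → ℝ) × Fin c) × (Fin D → ℝ) |
      p.2 ∈ box (fun t => (p.1 t).1) l} :=
  measurableSet_box (X := fun t (x : ℕ → (Fin D → ℝ) × Fin c) => (x t).1) measurable_feature l

lemma measurable_measure_box (μ : Measure (Fin D → ℝ)) [SFinite μ]
    (l : List (Candidate D × Bool)) :
    Measurable fun x : ℕ → (Fin D → ℝ) × Fin c => μ (box (fun t => (x t).1) l) :=
  measurable_measure_prodMk_left (measurableSet_box_feature l)

/-- The data points with features in `A` and label `k`. -/
def labelled (A : Set (Fin D → ℝ)) (k : Fin c) : Set ((Fin D → ℝ) × Fin c) := A ×ˢ {k}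

lemma measurableSet_labelled {A : Set (Fin D → ℝ)} (hA : MeasurableSet A) (k : Fin c) :
    MeasurableSet (labelled A k) :=
  hA.prod (measurableSet_singleton k)

lemma measurable_measure_labelled_box (l : List (Candidate D × Bool)) (k : Fin c) :
    Measurable fun x : ℕ → (Fin D → ℝ) × Fin c =>
      ρ (labelled (box (fun t => (x t).1) l) k) := by
  refine measurable_measure_prodMk_left (s := {p : (ℕ → (Fin D → ℝ) × Fin c) ×
    ((Fin D → ℝ) × Fin c) | p.2 ∈ labelled (box (fun t => (p.1 t).1) l) k}) ?_
  have h1 : MeasurableSet {p : (ℕ → (Fin D → ℝ) × Fin c) × ((Fin D → ℝ) × Fin c) |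
      p.2.1 ∈ box (fun t => (p.1 t).1) l} :=
    (measurable_fst.prodMk (measurable_fst.comp measurable_snd)) (measurableSet_box_feature l)
  have h2 : MeasurableSet {p : (ℕ → (Fin D → ℝ) × Fin c) × ((Fin D → ℝ) × Fin c) |
      p.2.2 ∈ ({k} : Set (Fin c))} :=
    (measurable_snd.comp measurable_snd) (measurableSet_singleton k)
  exact h1.inter h2

lemma measurableSet_mem_labelled_box (l : List (Candidate D × Bool)) (k : Fin c) (u : ℕ) :
    MeasurableSet {x : ℕ → (Fin D → ℝ) × Fin c |
      x u ∈ labelled (box (fun t => (x t).1) l) k} := by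
  have h1 : MeasurableSet {x : ℕ → (Fin D → ℝ) × Fin c | (x u).1 ∈ box (fun t => (x t).1) l} :=
    (measurable_id.prodMk (measurable_feature u)) (measurableSet_box_feature l)
  have h2 : MeasurableSet {x : ℕ → (Fin D → ℝ) × Fin c | (x u).2 ∈ ({k} : Set (Fin c))} :=
    (measurable_snd.comp (measurable_pi_apply u)) (measurableSet_singleton k)
  exact h1.inter h2

lemma box_glue {l : List (Candidate D × Bool)} {J : Set ℕ} (hJ : ∀ s ∈ times l, s ∈ J)
    (p f : ℕ → (Fin D → ℝ) × Fin c) :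
    box (fun t => (glue J p f t).1) l = box (fun t => (p t).1) l :=
  box_congr fun s hs => by rw [glue_of_mem (hJ s hs)]

/-- Almost surely, every data point which falls in a box cut out by other data points splits it
into two parts of positive measure. -/
lemma ae_measure_box_cons_ne_zero (hρ : ρ.map Prod.fst ≪ volume) :
    ∀ᵐ x ∂(Measure.infinitePi fun _ : ℕ => ρ), ∀ (l : List (Candidate D × Bool)) (s : ℕ)
      (j : Fin D) (b : Bool), s ∉ times l → (x s).1 ∈ box (fun t => (x t).1) l →
        ρ.map Prod.fst (box (fun t => (x t).1) (((j, s), b) :: l)) ≠ 0 := by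
  have : IsProbabilityMeasure (ρ.map Prod.fst) :=
    Measure.isProbabilityMeasure_map measurable_fst.aemeasurable
  rw [ae_all_iff]; intro l
  rw [ae_all_iff]; intro s
  rw [ae_all_iff]; intro j
  rw [ae_all_iff]; intro b
  by_cases hs : s ∈ times l
  · exact .of_forall fun x h => absurd hs h
  -- the box depends only on the points at `times l`, which may be fixed
  refine ae_of_ae_glue (times l : Set ℕ) ?_ fun p => ?_
  · have h1 : MeasurableSet {x : ℕ → (Fin D → ℝ) × Fin c |
        (x s).1 ∈ box (fun t => (x t).1) l} :=
      (measurable_id.prodMk (measurable_feature s)) (measurableSet_box_feature l)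
    have h2 := (measurable_measure_box (c := c) (ρ.map Prod.fst) (((j, s), b) :: l))
      (measurableSet_singleton 0)
    exact measurableSet_imp (.const _) (measurableSet_imp h1 h2.compl)
  · have h := ae_measure_halfSpace_inter_ne_zero hρ
      (measurableSet_box_apply (fun t => (p t).1) l) j b
    have h' := ae_eval_infinitePi (ρ := ρ) s (ae_of_ae_map measurable_fst.aemeasurable h)
    filter_upwards [h'] with f hf _ hmem
    rw [box_cons, box_glue (fun _ h => h)]
    rw [box_glue (fun _ h => h), glue_of_notMem (by simpa using hs)] at hmem
    rw [glue_of_notMem (by simpa using hs)]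
    exact hf hmem

open Classical in
/-- The number of times before `t` in the set `K` at which `x` belongs to `B`. -/
noncomputable def visits {E : Type*} (K : Set ℕ) (x : ℕ → E) (B : Set E) (t : ℕ) : ℕ :=
  ((Finset.range t).filter fun u => u ∈ K ∧ x u ∈ B).card

/-- The sequence behaves as prescribed by `ρ` with respect to the box `l` and the label `k`: apart
from the points which cut out the box, it avoids the points of the box with this label if they
are negligible, and visits them with positive frequency along any of the sets `K a` if not. -/
def Typical {ι : Type*} (ρ : Measure ((Fin D → ℝ) × Fin c)) (K : ι → Set ℕ)
    (x : ℕ → (Fin D → ℝ) × Fin c) (l : List (Candidate D × Bool)) (k : Fin c) : Prop :=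
  (ρ (labelled (box (fun t => (x t).1) l) k) = 0 →
    ∀ u ∉ times l, x u ∉ labelled (box (fun t => (x t).1) l) k) ∧
  (ρ (labelled (box (fun t => (x t).1) l) k) ≠ 0 →
    ∀ a, ∃ n : ℕ, ∃ T, ∀ t ≥ T, visits (K a \ times l) x Set.univ t ≤
      n * visits (K a \ times l) x (labelled (box (fun t => (x t).1) l) k) t)

lemma countablyValued_visits {Ω E : Type*} [MeasurableSpace Ω] {K : Set ℕ} {x : Ω → ℕ → E}
    {B : Ω → Set E} (h : ∀ u ∈ K, MeasurableSet {ω | x ω u ∈ B ω}) (t : ℕ) :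
    CountablyValued fun ω => visits K (x ω) (B ω) t := by
  unfold visits
  refine CountablyValued.comp (.finset (Finset.range t) (by simp +contextual) fun u hu => ?_)
    Finset.card
  simp only [Finset.mem_filter, hu, true_and]
  by_cases hK : u ∈ K
  · simpa only [hK, true_and] using h u hK
  · simp [hK]

/-- Almost every sequence of data points is typical for all boxes cut out by data points. -/
lemma ae_typical {ι : Type*} [Countable ι] {K : ι → Set ℕ} (hK : ∀ a, (K a).Infinite) :
    ∀ᵐ x ∂(Measure.infinitePi fun _ : ℕ => ρ), ∀ l k, Typical ρ K x l k := by
  rw [ae_all_iff]; intro l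
  rw [ae_all_iff]; intro k
  -- the box depends only on the points at `times l`, which may be fixed
  refine ae_of_ae_glue (times l : Set ℕ) ?_ fun p => ?_
  · have h0 := measurable_measure_labelled_box (ρ := ρ) l k (measurableSet_singleton 0)
    have hmem := measurableSet_mem_labelled_box (c := c) l k
    have h1 : MeasurableSet {x : ℕ → (Fin D → ℝ) × Fin c |
        ∀ u ∉ times l, x u ∉ labelled (box (fun t => (x t).1) l) k} := by
      simp only [Set.ofPred_forall]
      exact .iInter fun u => .iInter fun _ => (hmem u).compl
    have h2 : MeasurableSet {x : ℕ → (Fin D → ℝ) × Fin c | ∀ a, ∃ n : ℕ, ∃ T, ∀ t ≥ T,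
        visits (K a \ times l) x Set.univ t ≤
          n * visits (K a \ times l) x (labelled (box (fun t => (x t).1) l) k) t} := by
      simp only [Set.ofPred_forall, Set.ofPred_exists]
      refine .iInter fun a => .iUnion fun n => .iUnion fun T => .iInter fun t => .iInter fun _ => ?_
      exact ((countablyValued_visits (K := K a \ times l) (x := fun x => x)
        (B := fun _ => Set.univ) (fun u _ => by simp) t).prodMk
        (countablyValued_visits (x := fun x => x) (fun u _ => hmem u) t)).measurableSet
        fun q => q.1 ≤ n * q.2
    exact (measurableSet_imp h0 h1).inter (measurableSet_imp h0.compl h2)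
  · have hB : MeasurableSet (labelled (box (fun t => (p t).1) l) k) :=
      measurableSet_labelled (measurableSet_box_apply _ l) k
    have hbox : ∀ f : ℕ → (Fin D → ℝ) × Fin c,
        box (fun t => (glue (times l : Set ℕ) p f t).1) l = box (fun t => (p t).1) l :=
      fun f => box_glue (fun _ h => h) p f
    have hvis : ∀ (K' : Set ℕ) (f : ℕ → (Fin D → ℝ) × Fin c) B t,
        visits (K' \ times l) (glue (times l : Set ℕ) p f) B t =
          visits (K' \ times l) f B t := by
      intro K' f B t
      unfold visits
      congr 1
      ext u
      simp only [Finset.mem_filter]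
      refine and_congr_right fun _ => and_congr_right fun hu => ?_
      rw [glue_of_notMem hu.2]
    simp only [Typical, hbox, hvis]
    by_cases h0 : ρ (labelled (box (fun t => (p t).1) l) k) = 0
    · have : ∀ u, ∀ᵐ f ∂(Measure.infinitePi fun _ : ℕ => ρ),
          f u ∉ labelled (box (fun t => (p t).1) l) k := fun u =>
        ae_eval_infinitePi u (measure_eq_zero_iff_ae_notMem.1 h0)
      filter_upwards [ae_all_iff.2 this] with f hf
      refine ⟨fun _ u hu => ?_, fun h => absurd h0 h⟩
      rw [glue_of_notMem (by simpa using hu)]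
      exact hf u
    · have : ∀ a, ∀ᵐ f ∂(Measure.infinitePi fun _ : ℕ => ρ), ∃ n : ℕ, ∃ T, ∀ t ≥ T,
          visits (K a \ times l) f Set.univ t ≤
            n * visits (K a \ times l) f (labelled (box (fun t => (p t).1) l) k) t := by
        intro a
        have hinf : (K a \ (times l : Set ℕ)).Infinite := (hK a).sdiff (times l).finite_toSet
        filter_upwards [ae_exists_frequency hinf hB h0] with f hf
        obtain ⟨n, hn⟩ := hf
        obtain ⟨T, hT⟩ := eventually_atTop.1 hn
        refine ⟨n, T, fun t ht => le_trans (le_of_eq ?_) ((hT t ht).trans (le_of_eq ?_))⟩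
        · unfold visits
          congr 1
          ext u
          simp
        · rfl
      filter_upwards [ae_all_iff.2 this] with f hf
      exact ⟨fun h => absurd h h0, fun _ => hf⟩

end Typical

/-! ### A maximal inequality for visiting frequencies -/

section Frequent

variable {E : Type*} [MeasurableSpace E] {ρ : Measure E} [IsProbabilityMeasure ρ]

open Classical in
/-- A union bound over the sets of `k` times in `S` at which `B` may be visited. -/
lemma measure_le_card_filter_mem (S : Finset ℕ) {B : Set E} (hB : MeasurableSet B) (k : ℕ) :
    (Measure.infinitePi fun _ : ℕ => ρ) {f | k ≤ (S.filter fun u => f u ∈ B).card} ≤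
      2 ^ S.card * ρ B ^ k := by
  have hsub : {f : ℕ → E | k ≤ (S.filter fun u => f u ∈ B).card} ⊆
      ⋃ T ∈ S.powersetCard k, (T : Set ℕ).pi fun _ => B := by
    intro f hf
    obtain ⟨T, hT, hcard⟩ := Finset.exists_subset_card_eq (Set.mem_ofPred_eq ▸ hf)
    refine Set.mem_biUnion (x := T) ?_ fun u hu => (Finset.mem_filter.1 (hT hu)).2
    exact Finset.mem_powersetCard.2 ⟨hT.trans (Finset.filter_subset _ _), hcard⟩
  calc _ ≤ (Measure.infinitePi fun _ : ℕ => ρ) _ := measure_mono hsub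
    _ ≤ ∑ T ∈ S.powersetCard k,
        (Measure.infinitePi fun _ : ℕ => ρ) ((T : Set ℕ).pi fun _ => B) :=
      measure_biUnion_finset_le _ _
    _ = ∑ T ∈ S.powersetCard k, ρ B ^ k := by
      refine Finset.sum_congr rfl fun T hT => ?_
      rw [Measure.infinitePi_pi _ (fun _ _ => hB), Finset.prod_const,
        (Finset.mem_powersetCard.1 hT).2]
    _ = (S.card.choose k : ℝ≥0∞) * ρ B ^ k := by
      rw [Finset.sum_const, Finset.card_powersetCard, nsmul_eq_mul]
    _ ≤ 2 ^ S.card * ρ B ^ k := by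
      gcongr
      exact_mod_cast Nat.choose_le_two_pow _ _

/-- The union bound for `n` times and `k ≥ max r (n / L)` visits is summable over `n` if `q` is
small. -/
lemma two_pow_mul_pow_le {q : ℝ≥0∞} {L n k r : ℕ} (hq : 4 ^ L * q ≤ 1) (hr : r ≤ k)
    (hn : n ≤ L * k) : 2 ^ n * q ^ k ≤ 4 ^ (L * r) * q ^ r * 2⁻¹ ^ n := by
  have h2 : (2 : ℝ≥0∞) ^ n = 4 ^ n * 2⁻¹ ^ n := by
    rw [← mul_pow, show (4 : ℝ≥0∞) = 2 * 2 by norm_num, mul_assoc,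
      ENNReal.mul_inv_cancel two_ne_zero ENNReal.ofNat_ne_top, mul_one]
  have h4 : (4 : ℝ≥0∞) ^ n ≤ 4 ^ (L * r) * (4 ^ L) ^ (k - r) := by
    rw [← pow_mul, ← pow_add, ← mul_add, Nat.add_sub_cancel' hr]
    exact pow_le_pow_right₀ (by norm_num) hn
  obtain ⟨j, rfl⟩ := Nat.exists_eq_add_of_le hr
  rw [Nat.add_sub_cancel_left] at h4
  calc 2 ^ n * q ^ (r + j) = 4 ^ n * (2⁻¹ ^ n * (q ^ r * q ^ j)) := by rw [h2, pow_add, mul_assoc]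
    _ ≤ 4 ^ (L * r) * (4 ^ L) ^ j * (2⁻¹ ^ n * (q ^ r * q ^ j)) := by gcongr
    _ = 4 ^ (L * r) * q ^ r * 2⁻¹ ^ n * (4 ^ L * q) ^ j := by rw [mul_pow]; ring
    _ ≤ 4 ^ (L * r) * q ^ r * 2⁻¹ ^ n * 1 := by
      gcongr
      exact pow_le_one₀ (zero_le) hq
    _ = _ := mul_one _

/-- At some time, at least `r` of the preceding points at times in `K` belong to `B`, and these
are at least a fraction `1 / L` of the preceding points at times in `K`. -/
def Frequent {E : Type*} (K : Set ℕ) (r L : ℕ) (B : Set E) (f : ℕ → E) : Prop :=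
  ∃ t, r ≤ visits K f B t ∧ visits K f Set.univ t ≤ L * visits K f B t

/-- It is unlikely that a set of small measure is ever visited at least `r` times with frequency
at least `1 / L`. -/
lemma measure_frequent_le (K : Set ℕ) {B : Set E} (hB : MeasurableSet B) (r : ℕ) {L : ℕ}
    (hL : 1 ≤ L) : (Measure.infinitePi fun _ : ℕ => ρ) {f | Frequent K r L B f} ≤
      2 * 4 ^ (L * r) * ρ B ^ r := by
  classical
  set ν := Measure.infinitePi fun _ : ℕ => ρ with hν
  rcases le_or_gt (4 ^ L * ρ B) 1 with hq | hq
  · -- `n` is the number of times in `K` so far and `k n` the least admissible number of visits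
    set k : ℕ → ℕ := fun n => max r ((n + L - 1) / L) with hk
    have hkn : ∀ n, n ≤ L * k n := fun n => by
      have h1 : (n + L - 1) / L ≤ k n := le_max_right _ _
      have h2 := Nat.lt_mul_div_succ (n + L - 1) (show 0 < L by omega)
      have h3 := Nat.mul_le_mul_left L h1
      rw [mul_add] at h2
      omega
    set N : ℕ → ℕ := fun t => ((Finset.range t).filter (· ∈ K)).card with hN
    have hNv : ∀ (f : ℕ → E) t, visits K f Set.univ t = N t := fun f t => by
      simp only [visits, hN, Set.mem_univ, and_true]
    -- the set of times in `K` so far is determined by its size, so that one union bound for each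
    -- size suffices
    have hset : ∀ t t', N t = N t' →
        (Finset.range t).filter (· ∈ K) = (Finset.range t').filter (· ∈ K) := by
      intro t t' h
      rcases le_total t t' with h' | h'
      · exact Finset.eq_of_subset_of_card_le
          (Finset.filter_subset_filter _ (Finset.range_mono h')) h.ge
      · exact (Finset.eq_of_subset_of_card_le
          (Finset.filter_subset_filter _ (Finset.range_mono h')) h.le).symm
    set G : ℕ → Set (ℕ → E) := fun n => {f | ∃ t, N t = n ∧ k n ≤ visits K f B t} with hG
    have hsub : {f | Frequent K r L B f} ⊆ ⋃ n, G n := by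
      rintro f ⟨t, hr, ht⟩
      refine Set.mem_iUnion.2 ⟨N t, t, rfl, max_le hr ?_⟩
      rw [hNv] at ht
      refine Nat.le_of_lt_succ ((Nat.div_lt_iff_lt_mul (by omega)).2 ?_)
      rw [Nat.succ_mul, mul_comm]
      omega
    have hGn : ∀ n, ν (G n) ≤ 4 ^ (L * r) * ρ B ^ r * 2⁻¹ ^ n := by
      intro n
      by_cases hex : ∃ t₀, N t₀ = n
      · obtain ⟨t₀, ht₀⟩ := hex
        set S := (Finset.range t₀).filter (· ∈ K) with hS
        have hGS : G n ⊆ {f | k n ≤ (S.filter fun u => f u ∈ B).card} := by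
          rintro f ⟨t, ht, hle⟩
          refine Set.mem_ofPred_eq ▸ hle.trans (le_of_eq ?_)
          rw [hS, ← hset t t₀ (ht.trans ht₀.symm), Finset.filter_filter]
          rfl
        have hcard : S.card = n := ht₀
        refine (measure_mono hGS).trans ((measure_le_card_filter_mem S hB (k n)).trans ?_)
        rw [hcard]
        exact two_pow_mul_pow_le hq (le_max_left _ _) (hkn n)
      · have : G n = ∅ := by
          refine Set.eq_empty_iff_forall_notMem.2 ?_
          rintro f ⟨t, ht, -⟩
          exact hex ⟨t, ht⟩
        simp [this]
    calc ν {f | Frequent K r L B f} ≤ ∑' n, ν (G n) :=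
          (measure_mono hsub).trans (measure_iUnion_le _)
      _ ≤ ∑' n, 4 ^ (L * r) * ρ B ^ r * 2⁻¹ ^ n := ENNReal.tsum_le_tsum hGn
      _ = 2 * 4 ^ (L * r) * ρ B ^ r := by
        rw [ENNReal.tsum_mul_left, ENNReal.tsum_geometric, ENNReal.one_sub_inv_two, inv_inv]
        ring
  -- if `B` is large, the bound exceeds `1`
  · calc ν {f | Frequent K r L B f} ≤ 1 := prob_le_one
      _ ≤ (4 ^ L * ρ B) ^ r := one_le_pow₀ hq.le
      _ = 4 ^ (L * r) * ρ B ^ r := by rw [mul_pow, pow_mul]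
      _ ≤ 2 * 4 ^ (L * r) * ρ B ^ r := by
        rw [mul_assoc]
        exact le_mul_of_one_le_left (zero_le) (by norm_num)

end Frequent

/-! ### The mass of the candidate cells at a given depth -/

section Mass

variable {D c : ℕ} {prm : Params c} {i : ℕ → PointType} {z : Node → Finset (Fin D)}

/-- The input made of a sequence of labelled data points, of a deterministic assignment to the two
streams and of deterministic candidate dimensions. -/
def seqInput (i : ℕ → PointType) (z : Node → Finset (Fin D)) (x : ℕ → (Fin D → ℝ) × Fin c) :
    Input D c :=
  input (fun t x => (x t).1) (fun t x => (x t).2) (fun t _ => i t) (fun v _ => z v) x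

lemma seqInput_X (x : ℕ → (Fin D → ℝ) × Fin c) : (seqInput i z x).X = fun t => (x t).1 := rfl

variable [NeZero c]

lemma countablyValued_seqTree (t : ℕ) :
    CountablyValued fun x : ℕ → (Fin D → ℝ) × Fin c => tree prm (seqInput i z x) t :=
  countablyValued_tree measurable_feature
    (fun t => measurable_snd.comp (measurable_pi_apply t)) (fun _ => measurable_const)
    (fun _ => measurable_const) t

lemma seqTree_glue (hF : 1 ≤ prm.F) {J : Set ℕ} {t : ℕ} (hJ : ∀ s < t, s ∈ J)
    (p f : ℕ → (Fin D → ℝ) × Fin c) :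
    tree prm (seqInput i z (glue J p f)) t = tree prm (seqInput i z p) t := by
  refine Agree.tree_eq hF ⟨fun s hs => ?_, fun s hs => ?_, fun s _ => rfl, rfl⟩
  · change (glue J p f s).1 = (p s).1
    rw [glue_of_mem (hJ s hs)]
  · change (glue J p f s).2 = (p s).2
    rw [glue_of_mem (hJ s hs)]

/-- At time `t`, the node `v` is active with the cell described by `l` and needs further candidate
splits, and the arriving point is a structure point. -/
def Open (prm : Params c) (i : ℕ → PointType) (z : Node → Finset (Fin D)) (v : Node) (t : ℕ)
    (l : List (Candidate D × Bool)) (x : ℕ → (Fin D → ℝ) × Fin c) : Prop :=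
  i t = .structural ∧ v ∈ (tree prm (seqInput i z x) t).fringe ∧
    ((tree prm (seqInput i z x) t).points v).card < prm.m ∧
    path (tree prm (seqInput i z x) t) v = l

/-- At time `t`, candidate splits of the node `v` with the cell described by `l` are created. -/
def CreatedIn (prm : Params c) (i : ℕ → PointType) (z : Node → Finset (Fin D)) (v : Node) (t : ℕ)
    (l : List (Candidate D × Bool)) (x : ℕ → (Fin D → ℝ) × Fin c) : Prop :=
  Open prm i z v t l x ∧ (x t).1 ∈ box (fun s => (x s).1) l

lemma measurableSet_open (v : Node) (t : ℕ) (l : List (Candidate D × Bool)) :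
    MeasurableSet {x : ℕ → (Fin D → ℝ) × Fin c | Open prm i z v t l x} :=
  (countablyValued_seqTree (prm := prm) (i := i) (z := z) t).measurableSet fun s =>
    i t = .structural ∧ v ∈ s.fringe ∧ (s.points v).card < prm.m ∧ path s v = l

lemma measurableSet_createdIn (v : Node) (t : ℕ) (l : List (Candidate D × Bool)) :
    MeasurableSet {x : ℕ → (Fin D → ℝ) × Fin c | CreatedIn prm i z v t l x} :=
  (measurableSet_open v t l).inter
    ((measurable_id.prodMk (measurable_feature t)) (measurableSet_box_feature l))

lemma open_glue (hF : 1 ≤ prm.F) {J : Set ℕ} {t : ℕ} (hJ : ∀ s < t, s ∈ J) (v : Node)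
    (l : List (Candidate D × Bool)) (p f : ℕ → (Fin D → ℝ) × Fin c) :
    Open prm i z v t l (glue J p f) ↔ Open prm i z v t l p := by
  unfold Open
  rw [seqTree_glue hF hJ]

lemma Open.reached (hF : 1 ≤ prm.F) {v : Node} {t : ℕ} {l : List (Candidate D × Bool)}
    {x : ℕ → (Fin D → ℝ) × Fin c} (h : Open prm i z v t l x) :
    Reached (tree prm (seqInput i z x) t) v :=
  have hinv := tree_invariant (prm := prm) (inp := seqInput i z x) hF t
  hinv.leaf_reached v (hinv.fringe_subset h.2.1)

lemma Open.times_lt (hF : 1 ≤ prm.F) {v : Node} {t : ℕ} {l : List (Candidate D × Bool)}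
    {x : ℕ → (Fin D → ℝ) × Fin c} (h : Open prm i z v t l x) : ∀ s ∈ times l, s < t := by
  intro s hs
  rw [← h.2.2.2] at hs
  exact (times_path_lt hF (h.reached hF) s hs).1

lemma Open.cell_eq (hF : 1 ≤ prm.F) {v : Node} {t : ℕ} {l : List (Candidate D × Bool)}
    {x : ℕ → (Fin D → ℝ) × Fin c} (h : Open prm i z v t l x) :
    cell (seqInput i z x) (tree prm (seqInput i z x) t) v = box (fun s => (x s).1) l := by
  rw [cell_eq_box _ (h.reached hF), h.2.2.2, seqInput_X]

lemma created_iff (hF : 1 ≤ prm.F) {v : Node} {t : ℕ} {x : ℕ → (Fin D → ℝ) × Fin c} :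
    Created prm (seqInput i z x) v t ↔
      CreatedIn prm i z v t (path (tree prm (seqInput i z x) t) v) x := by
  have key : ∀ h : Open prm i z v t (path (tree prm (seqInput i z x) t) v) x,
    cell (seqInput i z x) (tree prm (seqInput i z x) t) v =
      box (fun s => (x s).1) (path (tree prm (seqInput i z x) t) v) := fun h => h.cell_eq hF
  constructor
  · rintro ⟨h1, h2, h3, h4⟩
    have ho : Open prm i z v t (path (tree prm (seqInput i z x) t) v) x := ⟨h1, h2, h3, rfl⟩
    refine ⟨ho, ?_⟩
    rw [key ho] at h4
    exact h4
  · rintro ⟨ho, hx⟩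
    refine ⟨ho.1, ho.2.1, ho.2.2.1, ?_⟩
    rw [key ho]
    exact hx

open Classical in
/-- The `r`-th power of the mass of the cell of `v`; `0` if `v` never becomes a leaf. -/
noncomputable def leafMass (prm : Params c) (μ : Measure (Fin D → ℝ)) (i : ℕ → PointType)
    (z : Node → Finset (Fin D)) (r : ℕ) (v : Node) (x : ℕ → (Fin D → ℝ) × Fin c) : ℝ≥0∞ :=
  ⨆ t, if v ∈ (tree prm (seqInput i z x) t).leaves then
    μ (cell (seqInput i z x) (tree prm (seqInput i z x) t) v) ^ r else 0

open Classical in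
/-- The sum of the `r`-th powers of the masses of all candidate children created at time `t` in the
node `v` with the cell described by `l`. -/
noncomputable def childMass (prm : Params c) (μ : Measure (Fin D → ℝ)) (i : ℕ → PointType)
    (z : Node → Finset (Fin D)) (r : ℕ) (v : Node) (t : ℕ) (l : List (Candidate D × Bool))
    (x : ℕ → (Fin D → ℝ) × Fin c) : ℝ≥0∞ :=
  if CreatedIn prm i z v t l x then
    ∑ j, ∑ b, μ (box (fun s => (x s).1) (((j, t), b) :: l)) ^ r else 0

open Classical in
/-- The `r`-th power of the mass of the cell described by `l`, if candidate splits of the node `v`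
with this cell are created at time `t`. -/
noncomputable def parentMass (prm : Params c) (μ : Measure (Fin D → ℝ)) (i : ℕ → PointType)
    (z : Node → Finset (Fin D)) (r : ℕ) (v : Node) (t : ℕ) (l : List (Candidate D × Bool))
    (x : ℕ → (Fin D → ℝ) × Fin c) : ℝ≥0∞ :=
  if CreatedIn prm i z v t l x then μ (box (fun s => (x s).1) l) ^ r else 0

variable {μ : Measure (Fin D → ℝ)} [IsProbabilityMeasure μ]

lemma measurable_childMass (r : ℕ) (v : Node) (t : ℕ) (l : List (Candidate D × Bool)) :
    Measurable (childMass (c := c) prm μ i z r v t l) := by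
  classical
  unfold childMass
  refine Measurable.ite (measurableSet_createdIn v t l) ?_ measurable_const
  exact Finset.measurable_fun_sum _ fun j _ => Finset.measurable_fun_sum _ fun b _ =>
    (measurable_measure_box μ _).pow_const r

lemma measurable_parentMass (r : ℕ) (v : Node) (t : ℕ) (l : List (Candidate D × Bool)) :
    Measurable (parentMass (c := c) prm μ i z r v t l) := by
  classical
  unfold parentMass
  exact Measurable.ite (measurableSet_createdIn v t l)
    ((measurable_measure_box μ _).pow_const r) measurable_const

variable {ρ : Measure ((Fin D → ℝ) × Fin c)} [IsProbabilityMeasure ρ]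

/-- The `r`-th powers of the masses of the candidate children created at time `t` are small in the
mean, compared to that of their parent. -/
lemma lintegral_childMass_le (hF : 1 ≤ prm.F) (hμ : ρ.map Prod.fst = μ) {r : ℕ} {δ : ℝ≥0∞}
    (hδ : δ ≠ ⊤) (hr : ∀ (A : Set (Fin D → ℝ)) (j : Fin D) (b : Bool),
      ∫⁻ y in A, μ (halfSpace j b (y j) ∩ A) ^ r ∂μ ≤ δ * μ A ^ (r + 1))
    (v : Node) (t : ℕ) (l : List (Candidate D × Bool)) :
    ∫⁻ x, childMass prm μ i z r v t l x ∂(Measure.infinitePi fun _ : ℕ => ρ) ≤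
      D * 2 * δ * ∫⁻ x, parentMass prm μ i z r v t l x ∂(Measure.infinitePi fun _ : ℕ => ρ) := by
  classical
  -- the points before `t` are fixed; then the box is deterministic and is cut at the point `f t`,
  -- which has the law `μ` and creates candidates only if it falls in the box
  rw [lintegral_glue (Set.Iio t) (measurable_childMass r v t l),
    lintegral_glue (Set.Iio t) (measurable_parentMass r v t l),
    ← lintegral_const_mul' _ _ (ENNReal.mul_ne_top (by finiteness) hδ)]
  refine lintegral_mono fun p => ?_
  have hopen : ∀ f, Open prm i z v t l (glue (Set.Iio t) p f) ↔ Open prm i z v t l p :=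
    open_glue hF (fun s hs => hs) v l p
  by_cases hp : Open prm i z v t l p
  · have hbox : ∀ f : ℕ → (Fin D → ℝ) × Fin c,
        box (fun s => (glue (Set.Iio t) p f s).1) l = box (fun s => (p s).1) l :=
      fun f => box_glue (fun s hs => hp.times_lt hF s hs) p f
    have hft : ∀ f : ℕ → (Fin D → ℝ) × Fin c, glue (Set.Iio t) p f t = f t := fun f =>
      glue_of_notMem (by simp) p f
    set A := box (fun s => (p s).1) l with hA
    have hAm : MeasurableSet A := measurableSet_box_apply _ l
    have hone : ∀ j b, Measurable fun y : Fin D → ℝ => μ (halfSpace j b (y j) ∩ A) ^ r :=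
      fun j b =>
        ((measurable_measure_halfSpace_inter A j b).comp (measurable_pi_apply j)).pow_const r
    have hsum : ∀ j, Measurable fun y : Fin D → ℝ => ∑ b, μ (halfSpace j b (y j) ∩ A) ^ r :=
      fun j => Finset.measurable_fun_sum _ fun b _ => hone j b
    have h1 : ∫⁻ f, childMass prm μ i z r v t l (glue (Set.Iio t) p f)
        ∂(Measure.infinitePi fun _ : ℕ => ρ) =
        ∫⁻ y in A, ∑ j, ∑ b, μ (halfSpace j b (y j) ∩ A) ^ r ∂μ := by
      rw [← lintegral_feature hμ t hAm (Finset.measurable_fun_sum _ fun j _ => hsum j)]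
      refine lintegral_congr fun f => ?_
      simp only [childMass, CreatedIn, hopen, hp, hbox, hft, box_cons, true_and,
        Set.indicator_apply]
    have h2 : ∫⁻ f, parentMass prm μ i z r v t l (glue (Set.Iio t) p f)
        ∂(Measure.infinitePi fun _ : ℕ => ρ) = μ A ^ (r + 1) := by
      rw [pow_succ, ← setLIntegral_const, ← lintegral_feature hμ t hAm measurable_const]
      refine lintegral_congr fun f => ?_
      simp only [parentMass, CreatedIn, hopen, hp, hbox, hft, true_and, Set.indicator_apply]
    rw [h1, h2, lintegral_finsetSum _ fun j _ => hsum j]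
    calc ∑ j, ∫⁻ y in A, ∑ b, μ (halfSpace j b (y j) ∩ A) ^ r ∂μ
        ≤ ∑ j : Fin D, 2 * (δ * μ A ^ (r + 1)) := by
          refine Finset.sum_le_sum fun j _ => ?_
          rw [lintegral_finsetSum _ fun b _ => hone j b, Fintype.sum_bool, two_mul]
          exact add_le_add (hr A j true) (hr A j false)
      _ = D * 2 * δ * μ A ^ (r + 1) := by
          rw [Finset.sum_const, Finset.card_univ, Fintype.card_fin, nsmul_eq_mul]
          ring
  · simp [childMass, CreatedIn, hopen, hp]

end Mass

section Depth

variable {D c : ℕ} [NeZero c] {prm : Params c} {i : ℕ → PointType} {z : Node → Finset (Fin D)}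
  {μ : Measure (Fin D → ℝ)}

lemma parentMass_le_leafMass (hF : 1 ≤ prm.F) (r : ℕ) (v : Node) (t : ℕ)
    (l : List (Candidate D × Bool)) (x : ℕ → (Fin D → ℝ) × Fin c) :
    parentMass prm μ i z r v t l x ≤ leafMass prm μ i z r v x := by
  classical
  unfold parentMass
  split_ifs with h
  · have hinv := tree_invariant (prm := prm) (inp := seqInput i z x) hF t
    refine le_trans (le_of_eq ?_) (le_iSup _ t)
    rw [if_pos (hinv.fringe_subset h.1.2.1), h.1.cell_eq hF]
  · exact zero_le

/-- The candidate splits of a node are created at no more than `m` times, each time with one box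
only. -/
lemma tsum_parentMass_le (hF : 1 ≤ prm.F) (r : ℕ) (v : Node) (x : ℕ → (Fin D → ℝ) × Fin c) :
    ∑' t, ∑' l, parentMass prm μ i z r v t l x ≤ prm.m * leafMass prm μ i z r v x := by
  classical
  have hsingle : ∀ t, ∑' l, parentMass prm μ i z r v t l x ≤
      if Created prm (seqInput i z x) v t then leafMass prm μ i z r v x else 0 := by
    intro t
    rw [tsum_eq_single (path (tree prm (seqInput i z x) t) v)]
    · split_ifs with h
      · exact parentMass_le_leafMass hF r v t _ x
      · rw [created_iff hF] at h
        simp [parentMass, h]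
    · intro l hl
      exact if_neg fun h => hl h.1.2.2.2.symm
  refine (ENNReal.tsum_le_tsum hsingle).trans ?_
  rw [ENNReal.tsum_eq_iSup_sum]
  refine iSup_le fun S => ?_
  rw [← Finset.sum_filter, Finset.sum_const, nsmul_eq_mul]
  gcongr
  exact_mod_cast card_le_of_created hF fun τ hτ => (Finset.mem_filter.1 hτ).2

lemma leafMass_child_le (hF : 1 ≤ prm.F) (r : ℕ) {v : Node} {x : ℕ → (Fin D → ℝ) × Fin c}
    {t : ℕ} {q : Candidate D} (hq : (tree prm (seqInput i z x) t).split v = some q) (b : Bool) :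
    leafMass prm μ i z r (b :: v) x ≤ μ (box (fun s => (x s).1)
      ((q, b) :: path (tree prm (seqInput i z x) q.2) v)) ^ r := by
  classical
  refine iSup_le fun t' => ?_
  split_ifs with hleaf
  · have hinv := tree_invariant (prm := prm) (inp := seqInput i z x) hF t'
    obtain ⟨q', hq'⟩ := Option.isSome_iff_exists.1 (hinv.leaf_reached _ hleaf).1
    -- the split of a node never changes
    obtain rfl : q' = q := by
      rcases le_total t t' with h | h
      · have := tree_extends hF h v q hq
        rw [hq'] at this
        exact Option.some_inj.1 this
      · have := tree_extends hF h v q' hq'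
        rw [hq] at this
        exact (Option.some_inj.1 this).symm
    have hc := (created_of_split hF hq').1
    rw [cell_child hF b hq', cell_eq_box _ (hc.reached hF), side_box]
    exact le_rfl
  · exact zero_le

/-- The children of a node are among its candidate children. -/
lemma leafMass_children_le (hF : 1 ≤ prm.F) (r : ℕ) (v : Node) (x : ℕ → (Fin D → ℝ) × Fin c) :
    leafMass prm μ i z r (false :: v) x + leafMass prm μ i z r (true :: v) x ≤
      ∑' t, ∑' l, childMass prm μ i z r v t l x := by
  classical
  by_cases h : ∃ t q, (tree prm (seqInput i z x) t).split v = some q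
  · obtain ⟨t, q, hq⟩ := h
    have hc := (created_iff hF).1 (created_of_split hF hq).1
    set l := path (tree prm (seqInput i z x) q.2) v with hl
    calc _ ≤ μ (box (fun s => (x s).1) ((q, false) :: l)) ^ r +
          μ (box (fun s => (x s).1) ((q, true) :: l)) ^ r :=
          add_le_add (leafMass_child_le hF r hq false) (leafMass_child_le hF r hq true)
      _ = ∑ b, μ (box (fun s => (x s).1) (((q.1, q.2), b) :: l)) ^ r := by
          rw [Fintype.sum_bool, add_comm]
      _ ≤ ∑ j, ∑ b, μ (box (fun s => (x s).1) (((j, q.2), b) :: l)) ^ r :=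
          Finset.single_le_sum
            (f := fun j => ∑ b, μ (box (fun s => (x s).1) (((j, q.2), b) :: l)) ^ r)
            (fun _ _ => zero_le) (Finset.mem_univ q.1)
      _ = childMass prm μ i z r v q.2 l x := (if_pos hc).symm
      _ ≤ ∑' l, childMass prm μ i z r v q.2 l x := ENNReal.le_tsum l
      _ ≤ _ := ENNReal.le_tsum (f := fun t => ∑' l, childMass prm μ i z r v t l x) q.2
  · have h0 : ∀ b, leafMass prm μ i z r (b :: v) x = 0 := by
      intro b
      refine le_antisymm (iSup_le fun t => ?_) zero_le
      rw [if_neg]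
      intro hleaf
      have hinv := tree_invariant (prm := prm) (inp := seqInput i z x) hF t
      obtain ⟨q, hq⟩ := Option.isSome_iff_exists.1 (hinv.leaf_reached _ hleaf).1
      exact h ⟨t, q, hq⟩
    rw [h0, h0, add_zero]
    exact zero_le

variable [IsProbabilityMeasure μ] {ρ : Measure ((Fin D → ℝ) × Fin c)} [IsProbabilityMeasure ρ]

/-- The mean of the sum of the `r`-th powers of the masses of the candidate children of a node is at
most half that of the node. -/
lemma lintegral_tsum_childMass_le (hF : 1 ≤ prm.F) (hμ : ρ.map Prod.fst = μ) {r : ℕ} {δ : ℝ≥0∞}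
    (hδ : δ ≠ ⊤) (hδ' : D * 2 * δ * prm.m ≤ 2⁻¹)
    (hr : ∀ (A : Set (Fin D → ℝ)) (j : Fin D) (b : Bool),
      ∫⁻ y in A, μ (halfSpace j b (y j) ∩ A) ^ r ∂μ ≤ δ * μ A ^ (r + 1)) (v : Node) :
    ∑' t, ∑' l, ∫⁻ x, childMass prm μ i z r v t l x ∂(Measure.infinitePi fun _ : ℕ => ρ) ≤
      2⁻¹ * ∫⁻ x, leafMass prm μ i z r v x ∂(Measure.infinitePi fun _ : ℕ => ρ) := by
  calc _ ≤ ∑' t, ∑' l, D * 2 * δ *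
        ∫⁻ x, parentMass prm μ i z r v t l x ∂(Measure.infinitePi fun _ : ℕ => ρ) :=
        ENNReal.tsum_le_tsum fun t => ENNReal.tsum_le_tsum fun l =>
          lintegral_childMass_le hF hμ hδ hr v t l
    _ = D * 2 * δ * ∫⁻ x, ∑' t, ∑' l, parentMass prm μ i z r v t l x
          ∂(Measure.infinitePi fun _ : ℕ => ρ) := by
        rw [lintegral_tsum fun t => (Measurable.tsum fun l =>
          measurable_parentMass r v t l).aemeasurable]
        simp_rw [lintegral_tsum fun l => (measurable_parentMass r v _ l).aemeasurable,
          ENNReal.tsum_mul_left]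
    _ ≤ D * 2 * δ * ∫⁻ x, prm.m * leafMass prm μ i z r v x
          ∂(Measure.infinitePi fun _ : ℕ => ρ) := by
        gcongr with x
        exact tsum_parentMass_le hF r v x
    _ = (D * 2 * δ * prm.m) * ∫⁻ x, leafMass prm μ i z r v x
          ∂(Measure.infinitePi fun _ : ℕ => ρ) := by
        rw [lintegral_const_mul' _ _ (ENNReal.natCast_ne_top _), ← mul_assoc]
    _ ≤ _ := by gcongr

/-- The nodes of depth `d`. -/
def level : ℕ → Finset Node
  | 0 => {[]}
  | d + 1 => (level d).image (List.cons false) ∪ (level d).image (List.cons true)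

lemma mem_level (v : Node) : v ∈ level v.length := by
  induction v with
  | nil => simp [level]
  | cons b v ih => cases b <;> simp [level, ih]

lemma sum_level_succ (f : Node → ℝ≥0∞) (d : ℕ) :
    ∑ v ∈ level (d + 1), f v = ∑ v ∈ level d, (f (false :: v) + f (true :: v)) := by
  have hdisj : Disjoint ((level d).image (List.cons false)) ((level d).image (List.cons true)) := by
    rw [Finset.disjoint_left]
    intro v h1 h2
    obtain ⟨a, -, rfl⟩ := Finset.mem_image.1 h1
    obtain ⟨b, -, h⟩ := Finset.mem_image.1 h2
    simp at h
  rw [level, Finset.sum_union hdisj, Finset.sum_image (fun _ _ _ _ h => List.tail_eq_of_cons_eq h),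
    Finset.sum_image (fun _ _ _ _ h => List.tail_eq_of_cons_eq h), Finset.sum_add_distrib]

/-- The mean of the sum of the `r`-th powers of the masses of the nodes of depth `d` decreases
geometrically. -/
lemma sum_level_leafMass_le (hF : 1 ≤ prm.F) (hμ : ρ.map Prod.fst = μ) {r : ℕ} {δ : ℝ≥0∞}
    (hδ : δ ≠ ⊤) (hδ' : D * 2 * δ * prm.m ≤ 2⁻¹)
    (hr : ∀ (A : Set (Fin D → ℝ)) (j : Fin D) (b : Bool),
      ∫⁻ y in A, μ (halfSpace j b (y j) ∩ A) ^ r ∂μ ≤ δ * μ A ^ (r + 1)) (d : ℕ) :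
    ∑ v ∈ level d, ∫⁻ x, leafMass prm μ i z r v x ∂(Measure.infinitePi fun _ : ℕ => ρ) ≤
      2⁻¹ ^ d := by
  classical
  induction d with
  | zero =>
    simp only [level, Finset.sum_singleton, pow_zero]
    refine (lintegral_mono (g := fun _ => 1) fun x => iSup_le fun t => ?_).trans (by simp)
    split_ifs
    · exact pow_le_one₀ zero_le prob_le_one
    · exact zero_le
  | succ d ih =>
    rw [sum_level_succ, pow_succ']
    refine le_trans ?_ (mul_le_mul_right ih 2⁻¹)
    rw [Finset.mul_sum]
    refine Finset.sum_le_sum fun v _ => ?_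
    calc _ ≤ ∫⁻ x, (leafMass prm μ i z r (false :: v) x + leafMass prm μ i z r (true :: v) x)
          ∂(Measure.infinitePi fun _ : ℕ => ρ) := le_lintegral_add _ _
      _ ≤ ∫⁻ x, ∑' t, ∑' l, childMass prm μ i z r v t l x
          ∂(Measure.infinitePi fun _ : ℕ => ρ) :=
          lintegral_mono fun x => leafMass_children_le hF r v x
      _ = ∑' t, ∑' l, ∫⁻ x, childMass prm μ i z r v t l x
          ∂(Measure.infinitePi fun _ : ℕ => ρ) := by
          rw [lintegral_tsum fun t => (Measurable.tsum fun l =>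
            measurable_childMass r v t l).aemeasurable]
          simp_rw [lintegral_tsum fun l => (measurable_childMass r v _ l).aemeasurable]
      _ ≤ _ := lintegral_tsum_childMass_le hF hμ hδ hδ' hr v

end Depth

/-! ### Candidate cells visited too often -/

section Bad

variable {D c : ℕ} [NeZero c] {prm : Params c} {i : ℕ → PointType} {z : Node → Finset (Fin D)}

/-- The times after `t` at which estimation points arrive. -/
def estimationTimes (i : ℕ → PointType) (t : ℕ) : Set ℕ := {u | t < u ∧ i u = .estimation}

/-- A candidate child created in the node `v` at time `t` receives later at least `r` estimation
points, which are at least a fraction `1 / L` of all of them. -/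
def FrequentChild (prm : Params c) (i : ℕ → PointType) (z : Node → Finset (Fin D)) (r L : ℕ)
    (v : Node) (t : ℕ) (l : List (Candidate D × Bool)) (j : Fin D) (b : Bool)
    (x : ℕ → (Fin D → ℝ) × Fin c) : Prop :=
  CreatedIn prm i z v t l x ∧
    Frequent (estimationTimes i t) r L (Prod.fst ⁻¹' box (fun s => (x s).1) (((j, t), b) :: l)) x

open Classical in
/-- The `r`-th power of the mass of the candidate child on the side `b` of the split along the
coordinate `j`, if candidate splits of the node `v` with the cell described by `l` are created at
time `t`. -/
noncomputable def oneChildMass (prm : Params c) (μ : Measure (Fin D → ℝ)) (i : ℕ → PointType)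
    (z : Node → Finset (Fin D)) (r : ℕ) (v : Node) (t : ℕ) (l : List (Candidate D × Bool))
    (j : Fin D) (b : Bool) (x : ℕ → (Fin D → ℝ) × Fin c) : ℝ≥0∞ :=
  if CreatedIn prm i z v t l x then μ (box (fun s => (x s).1) (((j, t), b) :: l)) ^ r else 0

lemma measurableSet_frequentChild (r L : ℕ) (v : Node) (t : ℕ) (l : List (Candidate D × Bool))
    (j : Fin D) (b : Bool) :
    MeasurableSet {x : ℕ → (Fin D → ℝ) × Fin c | FrequentChild prm i z r L v t l j b x} := by
  have hmem : ∀ u, MeasurableSet {x : ℕ → (Fin D → ℝ) × Fin c |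
      x u ∈ Prod.fst ⁻¹' box (fun s => (x s).1) (((j, t), b) :: l)} := fun u =>
    (measurable_id.prodMk (measurable_feature u)) (measurableSet_box_feature _)
  have : {x : ℕ → (Fin D → ℝ) × Fin c | Frequent (estimationTimes i t) r L
      (Prod.fst ⁻¹' box (fun s => (x s).1) (((j, t), b) :: l)) x} = ⋃ n,
      {x | r ≤ visits (estimationTimes i t) x
        (Prod.fst ⁻¹' box (fun s => (x s).1) (((j, t), b) :: l)) n ∧
        visits (estimationTimes i t) x Set.univ n ≤ L * visits (estimationTimes i t) x
        (Prod.fst ⁻¹' box (fun s => (x s).1) (((j, t), b) :: l)) n} := by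
    ext x
    simp [Frequent]
  have hfreq : MeasurableSet (⋃ n, {x : ℕ → (Fin D → ℝ) × Fin c |
      r ≤ visits (estimationTimes i t) x
        (Prod.fst ⁻¹' box (fun s => (x s).1) (((j, t), b) :: l)) n ∧
        visits (estimationTimes i t) x Set.univ n ≤ L * visits (estimationTimes i t) x
        (Prod.fst ⁻¹' box (fun s => (x s).1) (((j, t), b) :: l)) n}) := by
    refine .iUnion fun n => ?_
    exact ((countablyValued_visits (x := fun x => x) (fun u _ => hmem u) n).prodMk
      (countablyValued_visits (K := estimationTimes i t) (x := fun x => x) (B := fun _ => Set.univ)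
      (fun u _ => by simp) n)).measurableSet fun p => r ≤ p.1 ∧ p.2 ≤ L * p.1
  rw [← this] at hfreq
  exact (measurableSet_createdIn v t l).inter hfreq

variable {μ : Measure (Fin D → ℝ)}

lemma childMass_eq_sum (r : ℕ) (v : Node) (t : ℕ) (l : List (Candidate D × Bool))
    (x : ℕ → (Fin D → ℝ) × Fin c) :
    childMass prm μ i z r v t l x = ∑ j, ∑ b, oneChildMass prm μ i z r v t l j b x := by
  classical
  unfold childMass oneChildMass
  split_ifs <;> simp

variable [IsProbabilityMeasure μ]
  {ρ : Measure ((Fin D → ℝ) × Fin c)} [IsProbabilityMeasure ρ]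

lemma measurable_oneChildMass (r : ℕ) (v : Node) (t : ℕ) (l : List (Candidate D × Bool))
    (j : Fin D) (b : Bool) : Measurable (oneChildMass (c := c) prm μ i z r v t l j b) := by
  classical
  unfold oneChildMass
  exact Measurable.ite (measurableSet_createdIn v t l)
    ((measurable_measure_box μ _).pow_const r) measurable_const

lemma visits_glue {E : Type*} {J K : Set ℕ} (h : ∀ u ∈ K, u ∉ J) (p f : ℕ → E) (B : Set E)
    (t : ℕ) : visits K (glue J p f) B t = visits K f B t := by
  unfold visits
  congr 1
  ext u
  simp only [Finset.mem_filter]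
  refine and_congr_right fun _ => and_congr_right fun hu => ?_
  rw [glue_of_notMem (h u hu)]

/-- A candidate child is visited frequently with a probability controlled by the mean of the `r`-th
power of its mass. -/
lemma measure_frequentChild_le (hF : 1 ≤ prm.F) (hμ : ρ.map Prod.fst = μ) (r : ℕ) {L : ℕ}
    (hL : 1 ≤ L) (v : Node) (t : ℕ) (l : List (Candidate D × Bool)) (j : Fin D) (b : Bool) :
    (Measure.infinitePi fun _ : ℕ => ρ) {x | FrequentChild prm i z r L v t l j b x} ≤
      2 * 4 ^ (L * r) * ∫⁻ x, oneChildMass prm μ i z r v t l j b x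
        ∂(Measure.infinitePi fun _ : ℕ => ρ) := by
  classical
  have hm := measurableSet_frequentChild (c := c) (prm := prm) (i := i) (z := z) r L v t l j b
  have hC : (2 * 4 ^ (L * r) : ℝ≥0∞) ≠ ⊤ := by finiteness
  -- the points up to time `t`, which determine the candidate child, are fixed, while the later
  -- points remain i.i.d.
  rw [← lintegral_indicator_one hm, lintegral_glue (Set.Iic t) (measurable_one.indicator hm),
    lintegral_glue (Set.Iic t) (measurable_oneChildMass r v t l j b), ← lintegral_const_mul' _ _ hC]
  refine lintegral_mono fun p => ?_
  have hopen : ∀ f, Open prm i z v t l (glue (Set.Iic t) p f) ↔ Open prm i z v t l p :=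
    open_glue hF (fun s hs => hs.le) v l p
  by_cases hp : Open prm i z v t l p
  · have ht := hp.times_lt hF
    have hbox : ∀ f : ℕ → (Fin D → ℝ) × Fin c,
        box (fun s => (glue (Set.Iic t) p f s).1) l = box (fun s => (p s).1) l :=
      fun f => box_glue (fun s hs => (ht s hs).le) p f
    have hbox' : ∀ f : ℕ → (Fin D → ℝ) × Fin c,
        box (fun s => (glue (Set.Iic t) p f s).1) (((j, t), b) :: l) =
          box (fun s => (p s).1) (((j, t), b) :: l) :=
      fun f => box_glue (fun s hs => by
        rw [times_cons] at hs
        rcases Finset.mem_insert.1 hs with rfl | hs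
        · exact Set.mem_Iic.2 le_rfl
        · exact Set.mem_Iic.2 (ht s hs).le) p f
    have hpt : ∀ f : ℕ → (Fin D → ℝ) × Fin c, glue (Set.Iic t) p f t = p t := fun f =>
      glue_of_mem (by simp) p f
    have hfreq : ∀ (f : ℕ → (Fin D → ℝ) × Fin c) B,
        Frequent (estimationTimes i t) r L B (glue (Set.Iic t) p f) ↔
          Frequent (estimationTimes i t) r L B f := fun f B => by
      have hdisj : ∀ u ∈ estimationTimes i t, u ∉ Set.Iic t := fun u hu => by
        simpa using hu.1
      unfold Frequent
      simp only [visits_glue hdisj]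
    simp only [oneChildMass, FrequentChild, Set.indicator_apply, CreatedIn, hopen, hp, hbox, hbox',
      hpt, hfreq, true_and, Set.mem_ofPred_eq, lintegral_const, measure_univ, mul_one]
    by_cases hx : (p t).1 ∈ box (fun s => (p s).1) l
    · simp only [hx, true_and, if_true]
      set B := box (fun s => (p s).1) (((j, t), b) :: l) with hB
      have hBm : MeasurableSet B := measurableSet_box_apply _ _
      have h := measure_frequent_le (ρ := ρ) (estimationTimes i t) (measurable_fst hBm) r hL
      rw [← Measure.map_apply measurable_fst hBm, hμ] at h
      refine le_trans (lintegral_indicator_one_le _) h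
    · simp [hx]
  · simp [oneChildMass, FrequentChild, CreatedIn, hopen, hp]

/-- Almost surely, deep in the tree no candidate child is visited frequently: by the bound on the
mass of the nodes of a given depth, the probabilities of the contrary at depth `d` are summable. -/
lemma ae_exists_depth_not_frequentChild (hF : 1 ≤ prm.F) (hμ : ρ.map Prod.fst = μ) {r : ℕ}
    {δ : ℝ≥0∞} (hδ : δ ≠ ⊤) (hδ' : D * 2 * δ * prm.m ≤ 2⁻¹)
    (hr : ∀ (A : Set (Fin D → ℝ)) (j : Fin D) (b : Bool),
      ∫⁻ y in A, μ (halfSpace j b (y j) ∩ A) ^ r ∂μ ≤ δ * μ A ^ (r + 1)) {L : ℕ} (hL : 1 ≤ L) :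
    ∀ᵐ x ∂(Measure.infinitePi fun _ : ℕ => ρ), ∃ d₀, ∀ v : Node, d₀ ≤ v.length → ∀ t l j b,
      ¬ FrequentChild prm i z r L v t l j b x := by
  set ν := Measure.infinitePi fun _ : ℕ => ρ with hν
  set C : ℝ≥0∞ := 2 * 4 ^ (L * r) with hC
  have hCtop : C ≠ ⊤ := by rw [hC]; finiteness
  set U : ℕ → Set (ℕ → (Fin D → ℝ) × Fin c) := fun d =>
    ⋃ v ∈ level d, ⋃ t, ⋃ l, ⋃ j, ⋃ b, {x | FrequentChild prm i z r L v t l j b x} with hU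
  have hnode : ∀ v, ν (⋃ t, ⋃ l, ⋃ j, ⋃ b, {x | FrequentChild prm i z r L v t l j b x}) ≤
      C * ∫⁻ x, leafMass prm μ i z r v x ∂ν := by
    intro v
    calc _ ≤ ∑' t, ∑' l, ∑ j, ∑ b, ν {x | FrequentChild prm i z r L v t l j b x} := by
          refine (measure_iUnion_le _).trans (ENNReal.tsum_le_tsum fun t =>
            (measure_iUnion_le _).trans (ENNReal.tsum_le_tsum fun l => ?_))
          refine (measure_iUnion_le _).trans_eq ?_ |>.trans (Finset.sum_le_sum fun j _ =>
            (measure_iUnion_le _).trans_eq (tsum_fintype _))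
          rw [tsum_fintype]
      _ ≤ ∑' t, ∑' l, ∑ j, ∑ b, C * ∫⁻ x, oneChildMass prm μ i z r v t l j b x ∂ν :=
          ENNReal.tsum_le_tsum fun t => ENNReal.tsum_le_tsum fun l =>
            Finset.sum_le_sum fun j _ => Finset.sum_le_sum fun b _ =>
              measure_frequentChild_le hF hμ r hL v t l j b
      _ = C * ∑' t, ∑' l, ∫⁻ x, childMass prm μ i z r v t l x ∂ν := by
          simp_rw [childMass_eq_sum, ← Finset.mul_sum, ENNReal.tsum_mul_left]
          congr 1
          refine tsum_congr fun t => tsum_congr fun l => ?_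
          rw [lintegral_finsetSum _ fun j _ => Finset.measurable_fun_sum _ fun b _ =>
            measurable_oneChildMass r v t l j b]
          refine Finset.sum_congr rfl fun j _ => ?_
          rw [lintegral_finsetSum _ fun b _ => measurable_oneChildMass r v t l j b]
      _ ≤ C * (2⁻¹ * ∫⁻ x, leafMass prm μ i z r v x ∂ν) := by
          gcongr
          exact lintegral_tsum_childMass_le hF hμ hδ hδ' hr v
      _ ≤ C * ∫⁻ x, leafMass prm μ i z r v x ∂ν := by
          gcongr
          exact mul_le_of_le_one_left zero_le (by simp)
  have hUd : ∀ d, ν (U d) ≤ C * 2⁻¹ ^ d := by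
    intro d
    calc ν (U d) ≤ ∑ v ∈ level d, C * ∫⁻ x, leafMass prm μ i z r v x ∂ν :=
          (measure_biUnion_finset_le _ _).trans (Finset.sum_le_sum fun v _ => hnode v)
      _ ≤ C * 2⁻¹ ^ d := by
          rw [← Finset.mul_sum]
          gcongr
          exact sum_level_leafMass_le hF hμ hδ hδ' hr d
  have hsum : ∑' d, ν (U d) ≠ ⊤ := by
    refine ne_top_of_le_ne_top ?_ (ENNReal.tsum_le_tsum hUd)
    rw [ENNReal.tsum_mul_left, ENNReal.tsum_geometric, ENNReal.one_sub_inv_two, inv_inv]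
    exact ENNReal.mul_ne_top hCtop ENNReal.ofNat_ne_top
  filter_upwards [ae_eventually_notMem hsum] with x hx
  obtain ⟨d₀, hd₀⟩ := eventually_atTop.1 hx
  refine ⟨d₀, fun v hv t l j b hfreq => hd₀ v.length hv ?_⟩
  simp only [hU, Set.mem_iUnion]
  exact ⟨v, mem_level v, t, l, j, b, hfreq⟩

end Bad

/-! ### Every leaf with positive score becomes active -/

section Conclusion

variable {D c : ℕ} {prm : Params c} {i : ℕ → PointType} {z : Node → Finset (Fin D)}
  {x : ℕ → (Fin D → ℝ) × Fin c} {ρ : Measure ((Fin D → ℝ) × Fin c)}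

lemma infinite_of_visits {E : Type*} {K : Set ℕ} {y : ℕ → E} {B : Set E} {n T : ℕ}
    (hK : K.Infinite) (h : ∀ t ≥ T, visits K y Set.univ t ≤ n * visits K y B t) :
    {u | u ∈ K ∧ y u ∈ B}.Infinite := by
  classical
  intro hfin
  obtain ⟨S, hSK, hS⟩ := hK.exists_subset_card_eq (n * hfin.toFinset.card + 1)
  set t := max T (S.sup id + 1) with ht
  have h1 : S.card ≤ visits K y Set.univ t := by
    refine Finset.card_le_card fun u hu => ?_
    have : u < t := (Nat.lt_succ_of_le (Finset.le_sup (f := id) hu)).trans_le (le_max_right _ _)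
    simpa [this] using hSK hu
  have h2 : visits K y B t ≤ hfin.toFinset.card := by
    refine Finset.card_le_card fun u hu => ?_
    simpa using (Finset.mem_filter.1 hu).2
  have := h1.trans ((h t (le_max_left _ _)).trans (Nat.mul_le_mul_left n h2))
  omega

lemma exists_label_measure_ne_zero {S : Set (Fin c)} {A : Set (Fin D → ℝ)}
    (h : ρ {y | y.1 ∈ A ∧ y.2 ∈ S} ≠ 0) : ∃ k ∈ S, ρ (labelled A k) ≠ 0 := by
  by_contra! hcon
  refine h (measure_mono_null (t := ⋃ k ∈ S, labelled A k) (fun y hy => ?_) ?_)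
  · exact Set.mem_biUnion hy.2 ⟨hy.1, rfl⟩
  · exact (measure_biUnion_null_iff (Set.to_countable S)).2 hcon

open Classical in
lemma exists_le_card_filter {p : ℕ → Prop} (h : {u | p u}.Infinite) (a n : ℕ) :
    ∃ T, ∀ t ≥ T, n ≤ ((Finset.Ico a t).filter p).card := by
  obtain ⟨S, hS, hcard⟩ := (h.sdiff (Finset.range a).finite_toSet).exists_subset_card_eq n
  refine ⟨S.sup id + 1, fun t ht => ?_⟩
  rw [← hcard]
  refine Finset.card_le_card fun u hu => ?_
  have h1 := hS hu
  have h2 : u < t := (Nat.lt_succ_of_le (Finset.le_sup (f := id) hu)).trans_le ht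
  simp only [Set.mem_sdiff, Set.mem_ofPred_eq, Finset.coe_range, Set.mem_Iio, not_lt] at h1
  simpa [h2, h1.2] using h1.1

lemma exists_le_count {inp : Input D c} {k : PointType} {A : Set (Fin D → ℝ)}
    (h : {u | inp.I u = k ∧ inp.X u ∈ A}.Infinite) (a : ℕ) (C : ℝ) :
    ∃ T, ∀ t ≥ T, C ≤ (count inp k a t A : ℝ) := by
  obtain ⟨n, hn⟩ := exists_nat_ge C
  obtain ⟨T, hT⟩ := exists_le_card_filter h a n
  refine ⟨T, fun t ht => hn.trans (Nat.cast_le.2 ((hT t ht).trans (le_of_eq ?_)))⟩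
  unfold count
  congr 1
  ext u
  simp only [Finset.mem_filter]

variable [NeZero c]

/-- The sequence of data points is typical: it satisfies the almost sure properties on which the
activation of all leafs with positive score rests. -/
structure GoodSequence (prm : Params c) (ρ : Measure ((Fin D → ℝ) × Fin c)) (i : ℕ → PointType)
    (z : Node → Finset (Fin D)) (r : ℕ) (x : ℕ → (Fin D → ℝ) × Fin c) : Prop where
  /-- a data point which falls in a box splits it into two parts of positive measure -/
  split_pos : ∀ (l : List (Candidate D × Bool)) (s : ℕ) (j : Fin D) (b : Bool), s ∉ times l →
    (x s).1 ∈ box (fun t => (x t).1) l →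
      ρ.map Prod.fst (box (fun t => (x t).1) (((j, s), b) :: l)) ≠ 0
  /-- a class visits a box with positive frequency in either stream, unless it is negligible there;
  then it avoids the box -/
  typical : ∀ l k, Typical ρ (fun k => {u | i u = k}) x l k
  /-- no candidate child deep in the tree is visited frequently -/
  not_frequent : ∀ L, 1 ≤ L → ∃ d₀, ∀ v : Node, d₀ ≤ v.length → ∀ t l j b,
    ¬ FrequentChild prm i z r L v t l j b x

lemma GoodSequence.infinite {r : ℕ} (hx : GoodSequence prm ρ i z r x)
    (hi : ∀ k, {u | i u = k}.Infinite) {l : List (Candidate D × Bool)}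
    (hl : ρ.map Prod.fst (box (fun t => (x t).1) l) ≠ 0) (k : PointType) :
    {u | i u = k ∧ (x u).1 ∈ box (fun t => (x t).1) l}.Infinite := by
  rw [Measure.map_apply measurable_fst (measurableSet_box_apply _ l)] at hl
  obtain ⟨y, -, hy⟩ := exists_label_measure_ne_zero (ρ := ρ) (S := Set.univ)
    (A := box (fun t => (x t).1) l) (by
      rwa [show {y : (Fin D → ℝ) × Fin c | y.1 ∈ box (fun t => (x t).1) l ∧ y.2 ∈ Set.univ} =
        Prod.fst ⁻¹' box (fun t => (x t).1) l by ext; simp])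
  obtain ⟨n, T, hT⟩ := (hx.typical l y).2 hy k
  refine (infinite_of_visits ((hi k).sdiff (times l).finite_toSet) hT).mono fun u hu => ?_
  exact ⟨hu.1.1, hu.2.1⟩

lemma GoodSequence.side_pos (hF : 1 ≤ prm.F) {r : ℕ} (hx : GoodSequence prm ρ i z r x) {v : Node}
    {τ : ℕ} (h : Created prm (seqInput i z x) v τ) (j : Fin D) (b : Bool) :
    ρ.map Prod.fst (box (fun t => (x t).1)
      (((j, τ), b) :: path (tree prm (seqInput i z x) τ) v)) ≠ 0 := by
  refine hx.split_pos _ τ j b (fun hmem => ?_) ((created_iff hF).1 h).2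
  exact lt_irrefl _ (times_path_lt hF (h.reached hF) τ hmem).1

lemma GoodSequence.cell_pos [IsProbabilityMeasure ρ] (hF : 1 ≤ prm.F) {r : ℕ}
    (hx : GoodSequence prm ρ i z r x) {v : Node} {t : ℕ}
    (hv : Reached (tree prm (seqInput i z x) t) v) :
    ρ.map Prod.fst (box (fun t => (x t).1) (path (tree prm (seqInput i z x) t) v)) ≠ 0 := by
  cases v with
  | nil =>
    rw [Measure.map_apply measurable_fst (measurableSet_box_apply _ _)]
    simp [path]
  | cons b v =>
    obtain ⟨q, hq⟩ := Option.isSome_iff_exists.1 hv.1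
    obtain ⟨hc, hlt⟩ := created_of_split hF hq
    rw [path_cons b hq, (tree_extends hF hlt.le).path_eq (hc.reached hF)]
    exact hx.side_pos hF hc q.1 b

/-- An active leaf remains active until it is split. -/
lemma mem_fringe_of_not_split {inp : Input D c} (hF : 1 ≤ prm.F) {w : Node} {s t : ℕ}
    (hst : s ≤ t) (hw : w ∈ (tree prm inp s).fringe) (hns : (tree prm inp t).split w = none) :
    w ∈ (tree prm inp t).fringe := by
  induction t, hst using Nat.le_induction with
  | base => exact hw
  | succ t hst ih =>
    have hnone : (tree prm inp t).split w = none := by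
      by_contra hcon
      obtain ⟨q, hq⟩ := Option.ne_none_iff_exists'.1 hcon
      have := tree_extends_succ hF t w q hq
      simp [hns] at this
    have ih := ih hnone
    rcases tree_succ_cases (prm := prm) (inp := inp) hF t with
      h | ⟨v, hv, -, -, -, ⟨-, h, -⟩ | ⟨q, -, h, hmem, -⟩⟩
    · rwa [h]
    · rwa [h]
    · refine hmem w ih ?_
      rintro rfl
      rw [h, splitLeaf_split_self] at hns
      simp at hns

lemma trySplit_split {inp : Input D c} {s : TreeState D} {v : Node} {t : ℕ}
    (hs : s.fringe ⊆ s.leaves) {q : Candidate D} (hq : q ∈ eligible prm inp s v (t + 1))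
    (hβ : prm.β v.length ≤ (count inp .estimation (birth s v) (t + 1) (cell inp s v) : ℝ)) :
    ∃ q', (trySplit prm inp s v t).split v = some q' := by
  obtain ⟨q', hq'⟩ := pickMax_isSome (f := candidateGain prm inp s v (t + 1)) ⟨q, hq⟩
  refine ⟨q', ?_⟩
  unfold trySplit
  rw [hq']
  dsimp only
  rw [if_pos (Or.inr hβ), (refill_spec _ (splitLeaf_fringe_subset hs)).2.1, splitLeaf_split_self]

/-- An active leaf is eventually split: it receives a structure point, the two sides of the
candidate splits generated by this point have positive measure, hence receive enough estimation
points, and so does the leaf itself for the split to be compulsory. -/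
lemma GoodSequence.exists_split [IsProbabilityMeasure ρ] (hm : 1 ≤ prm.m) (hF : 1 ≤ prm.F)
    (hz : ∀ v, (z v).Nonempty) (hi : ∀ k, {u | i u = k}.Infinite) {r : ℕ}
    (hx : GoodSequence prm ρ i z r x) {w : Node} {T : ℕ}
    (hw : w ∈ (tree prm (seqInput i z x) T).fringe) :
    ∃ t q, (tree prm (seqInput i z x) t).split w = some q := by
  by_contra! hcon
  set inp := seqInput i z x with hinp
  have hnone : ∀ t, (tree prm inp t).split w = none := fun t => by
    by_contra h
    obtain ⟨q, hq⟩ := Option.ne_none_iff_exists'.1 h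
    exact hcon t q hq
  have hfr : ∀ t ≥ T, w ∈ (tree prm inp t).fringe := fun t ht =>
    mem_fringe_of_not_split hF ht hw (hnone t)
  have hinv := fun t => tree_invariant (prm := prm) (inp := inp) hF t
  have hreach : Reached (tree prm inp T) w := (hinv T).leaf_reached w ((hinv T).fringe_subset hw)
  set l := path (tree prm inp T) w with hl
  have hcell : ∀ t ≥ T, cell inp (tree prm inp t) w = box (fun s => (x s).1) l := fun t ht => by
    rw [(tree_extends hF ht).cell_eq inp hreach, cell_eq_box inp hreach]
    rfl
  have hinf := hx.infinite hi (hx.cell_pos hF hreach)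
  -- a structure point generates candidate splits, which stay in the list of candidates
  obtain ⟨t₁, ht₁, hT₁⟩ := (hinf .structural).exists_gt T
  have hp : ((tree prm inp (t₁ + 1)).points w).Nonempty := by
    rw [points_succ hF ht₁.1 (hfr t₁ hT₁.le) (by rw [hcell t₁ hT₁.le]; exact ht₁.2)]
    split_ifs with h
    · exact Finset.insert_nonempty _ _
    · exact Finset.card_pos.1 (by omega)
  obtain ⟨τ, hτ⟩ := hp
  have hτc := created_of_mem_points hF hτ
  obtain ⟨j, hj⟩ := hz w
  have hreachτ := hτc.reached hF
  have hτlt := (hinv (t₁ + 1)).point_lt w τ hτ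
  have hside : ∀ b, ∀ t ≥ t₁ + 1, side inp (cell inp (tree prm inp t) w) (j, τ) b =
      box (fun s => (x s).1) (((j, τ), b) :: path (tree prm inp τ) w) := fun b t ht => by
    rw [(tree_extends hF (hτlt.le.trans ht)).cell_eq inp hreachτ, cell_eq_box inp hreachτ, side_box]
    rfl
  have hα : ∀ b, ∃ T', ∀ t ≥ T', prm.α w.length ≤ (count inp .estimation τ t
      (box (fun s => (x s).1) (((j, τ), b) :: path (tree prm inp τ) w)) : ℝ) := fun b =>
    exists_le_count (hx.infinite hi (hx.side_pos hF hτc j b) .estimation) _ _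
  obtain ⟨T₂, hT₂⟩ := hα false
  obtain ⟨T₃, hT₃⟩ := hα true
  obtain ⟨T₄, hT₄⟩ := exists_le_count (inp := inp) (hinf .estimation) (birth (tree prm inp T) w)
    (prm.β w.length)
  obtain ⟨t, ht, hlt⟩ := (hinf .structural).exists_gt (T + t₁ + T₂ + T₃ + T₄ + 1)
  have htree := tree_succ_eq_trySplit hF (inp := inp) ht.1 (hfr t (by omega))
    (by rw [hcell t (by omega)]; exact ht.2)
  have helig : (j, τ) ∈ eligible prm inp (addPoint prm (tree prm inp t) w t) w (t + 1) := by
    refine mem_eligible.2 ⟨hj, points_subset_addPoint _ _ _ _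
      (points_subset hF (by omega) w hτ), fun b => ?_⟩
    rw [cell_addPoint, hside b t (by omega)]
    cases b
    · exact hT₂ _ (by omega)
    · exact hT₃ _ (by omega)
  obtain ⟨q', hq'⟩ := trySplit_split (prm := prm) (inp := inp)
    (s := addPoint prm (tree prm inp t) w t) (hinv t).fringe_subset helig (by
      rw [cell_addPoint, hcell t (by omega),
        birth_congr_split (s := addPoint prm (tree prm inp t) w t) (s' := tree prm inp t) rfl,
        (tree_extends hF (show T ≤ t by omega)).birth_eq hreach]
      exact hT₄ _ (by omega))
  rw [← htree, hnone] at hq'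
  simp at hq'

end Conclusion

section Activation

variable {D c : ℕ} {prm : Params c} {i : ℕ → PointType} {z : Node → Finset (Fin D)}
  {x : ℕ → (Fin D → ℝ) × Fin c} {ρ : Measure ((Fin D → ℝ) × Fin c)}

lemma count_eq_visits {s : ℕ} (hs : i s = .structural) (t : ℕ) (A : Set (Fin D → ℝ)) :
    count (seqInput i z x) .estimation s t A =
      visits (estimationTimes i s) x (Prod.fst ⁻¹' A) t := by
  unfold count visits
  congr 1
  ext u
  simp only [Finset.mem_filter, Finset.mem_Ico, Finset.mem_range]
  simp only [estimationTimes, Set.mem_ofPred_eq, Set.mem_preimage]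
  constructor
  · rintro ⟨⟨h1, h2⟩, h3, h4⟩
    refine ⟨h2, ⟨lt_of_le_of_ne h1 ?_, h3⟩, h4⟩
    rintro rfl
    rw [show (seqInput i z x).I s = i s from rfl, hs] at h3
    exact absurd h3 (by decide)
  · rintro ⟨h2, ⟨h1, h3⟩, h4⟩
    exact ⟨⟨h1.le, h2⟩, h3, h4⟩

variable [NeZero c]

open Classical in
/-- The number of misclassified estimation points in a leaf. -/
noncomputable def misclassified (inp : Input D c) (s : TreeState D) (v : Node) (t : ℕ) : ℕ :=
  ((Finset.Ico (birth s v) t).filter fun i => inp.I i = .estimation ∧ inp.X i ∈ cell inp s v ∧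
      inp.Y i ≠ prediction inp s v t).card

lemma eHat_eq (inp : Input D c) (s : TreeState D) (v : Node) (t : ℕ) :
    eHat inp s v t = (misclassified inp s v t : ℝ) /
      (count inp .estimation (birth s v) t (cell inp s v) : ℝ) := rfl

lemma misclassified_le (inp : Input D c) (s : TreeState D) (v : Node) (t : ℕ) :
    misclassified inp s v t ≤ count inp .estimation (birth s v) t (cell inp s v) := by
  unfold misclassified count
  refine Finset.card_le_card fun u hu => ?_
  simp only [Finset.mem_filter] at hu ⊢
  exact ⟨hu.1, hu.2.1, hu.2.2.1⟩

lemma hist_le_misclassified (inp : Input D c) (s : TreeState D) (v : Node) (t : ℕ) {k : Fin c}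
    (hk : k ≠ prediction inp s v t) :
    hist inp .estimation (birth s v) t (cell inp s v) k ≤ misclassified inp s v t := by
  unfold misclassified hist
  refine Finset.card_le_card fun u hu => ?_
  simp only [Finset.mem_filter] at hu ⊢
  exact ⟨hu.1, hu.2.1, hu.2.2.1, hu.2.2.2 ▸ hk⟩

lemma sHat_eq (inp : Input D c) (s : TreeState D) (v : Node) (t : ℕ) :
    sHat inp s v t = (misclassified inp s v t : ℝ) /
      (count inp .estimation (birth s v) t Set.univ : ℝ) := by
  have h := misclassified_le inp s v t
  rw [sHat, eHat_eq, pHat]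
  rcases Nat.eq_zero_or_pos (count inp .estimation (birth s v) t (cell inp s v)) with h0 | h0
  · have : misclassified inp s v t = 0 := by omega
    simp [h0, this]
  · have : (count inp .estimation (birth s v) t (cell inp s v) : ℝ) ≠ 0 := by positivity
    field_simp

/-- A leaf whose estimated score is at least `1 / L` contains at least a fraction `1 / L` of the
estimation points of its lifetime. -/
lemma count_univ_le_of_one_le_mul_sHat {inp : Input D c} {s : TreeState D} {v : Node} {t L : ℕ}
    (h : 1 ≤ L * sHat inp s v t) : count inp .estimation (birth s v) t Set.univ ≤
      L * count inp .estimation (birth s v) t (cell inp s v) := by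
  rw [sHat_eq] at h
  rcases Nat.eq_zero_or_pos (count inp .estimation (birth s v) t Set.univ) with h0 | h0
  · simp [h0]
  · rw [← mul_div_assoc, le_div_iff₀ (by exact_mod_cast h0), one_mul] at h
    have h' : count inp .estimation (birth s v) t Set.univ ≤ L * misclassified inp s v t := by
      exact_mod_cast h
    exact h'.trans (Nat.mul_le_mul_left L (misclassified_le inp s v t))

/-- If the cell of a leaf contains points of two classes which are not negligible, then its
estimated score is eventually bounded from below. -/
lemma GoodSequence.one_le_mul_sHat_of_two_labels (hF : 1 ≤ prm.F) {r : ℕ}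
    (hx : GoodSequence prm ρ i z r x) (hi : {u | i u = .estimation}.Infinite) {v : Node} {t₀ : ℕ}
    (hv : Reached (tree prm (seqInput i z x) t₀) v) {k₁ k₂ : Fin c} (hk : k₁ ≠ k₂)
    (h₁ : ρ (labelled (cell (seqInput i z x) (tree prm (seqInput i z x) t₀) v) k₁) ≠ 0)
    (h₂ : ρ (labelled (cell (seqInput i z x) (tree prm (seqInput i z x) t₀) v) k₂) ≠ 0) :
    ∃ L T : ℕ, 1 ≤ L ∧ ∀ t ≥ T,
      1 ≤ L * sHat (seqInput i z x) (tree prm (seqInput i z x) t) v t := by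
  set inp := seqInput i z x with hinp
  set l := path (tree prm inp t₀) v with hl
  set a := birth (tree prm inp t₀) v with ha
  have hcell : ∀ t ≥ t₀, cell inp (tree prm inp t) v = box (fun s => (x s).1) l := fun t ht => by
    rw [(tree_extends hF ht).cell_eq inp hv, cell_eq_box inp hv]
    rfl
  have hbirth : ∀ t ≥ t₀, birth (tree prm inp t) v = a := fun t ht =>
    (tree_extends hF ht).birth_eq hv
  rw [hcell t₀ le_rfl] at h₁ h₂
  set K : Set ℕ := {u | i u = .estimation} with hK
  have hnt : ∀ u ∈ K, u ∉ times l := fun u hu hmem => by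
    have : i u = .structural := (times_path_lt hF hv u hmem).2
    rw [hK, Set.mem_ofPred_eq, this] at hu
    exact absurd hu (by decide)
  have hKl : K \ times l = K := by
    ext u
    exact ⟨fun h => h.1, fun h => ⟨h, hnt u h⟩⟩
  have key : ∀ k, ρ (labelled (box (fun s => (x s).1) l) k) ≠ 0 → ∃ n T : ℕ, ∀ t ≥ T,
      a + 1 ≤ hist inp .estimation a t (box (fun s => (x s).1) l) k ∧
      count inp .estimation a t Set.univ ≤
        n * (a + hist inp .estimation a t (box (fun s => (x s).1) l) k) := by
    intro k hk
    obtain ⟨n, T, hT⟩ := (hx.typical l k).2 hk .estimation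
    change ∀ t ≥ T, visits (K \ times l) x _ t ≤ n * visits (K \ times l) x _ t at hT
    rw [hKl] at hT
    obtain ⟨T', hT'⟩ := exists_le_card_filter (infinite_of_visits hi hT) a (a + 1)
    refine ⟨n, max T T', fun t ht => ⟨?_, ?_⟩⟩
    · refine (hT' t (le_of_max_le_right ht)).trans (le_of_eq ?_)
      unfold hist
      congr 1
      ext u
      simp only [Finset.mem_filter]
      exact Iff.rfl
    · have h1 : count inp .estimation a t Set.univ ≤ visits K x Set.univ t := by
        refine Finset.card_le_card fun u hu => ?_
        simp only [Finset.mem_filter, Finset.mem_Ico, Finset.mem_range] at hu ⊢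
        exact ⟨hu.1.2, hu.2.1, trivial⟩
      have h2 : visits K x (labelled (box (fun s => (x s).1) l) k) t ≤
          a + hist inp .estimation a t (box (fun s => (x s).1) l) k := by
        classical
        unfold hist
        refine le_trans (Finset.card_le_card (t := Finset.range a ∪ (Finset.Ico a t).filter
          fun u => inp.I u = .estimation ∧ inp.X u ∈ box (fun s => (x s).1) l ∧ inp.Y u = k)
          fun u hu => ?_) ((Finset.card_union_le _ _).trans (le_of_eq ?_))
        · simp only [Finset.mem_filter, Finset.mem_union, Finset.mem_Ico, Finset.mem_range] at hu ⊢
          rcases lt_or_ge u a with h | h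
          · exact .inl h
          · exact .inr ⟨⟨h, hu.1⟩, hu.2.1, hu.2.2.1, hu.2.2.2⟩
        · rw [Finset.card_range]
      exact h1.trans ((hT t (le_of_max_le_left ht)).trans (Nat.mul_le_mul_left n h2))
  obtain ⟨n₁, T₁, hT₁⟩ := key k₁ h₁
  obtain ⟨n₂, T₂, hT₂⟩ := key k₂ h₂
  -- `Typical` counts all points, while the estimated score ignores the `a` points which arrived
  -- before the leaf was created; since more than `a` points are misclassified later, a factor `2`
  -- makes up for them
  refine ⟨2 * (n₁ + n₂ + 1), t₀ + T₁ + T₂ + a + 1, by omega, fun t ht => ?_⟩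
  -- one of the two classes differs from the predicted class
  obtain ⟨k, n, hkp, hn, h1, h2⟩ : ∃ k n, k ≠ prediction inp (tree prm inp t) v t ∧ n ≤ n₁ + n₂ ∧
      a + 1 ≤ hist inp .estimation a t (box (fun s => (x s).1) l) k ∧
      count inp .estimation a t Set.univ ≤
        n * (a + hist inp .estimation a t (box (fun s => (x s).1) l) k) := by
    by_cases h : k₁ = prediction inp (tree prm inp t) v t
    · exact ⟨k₂, n₂, fun h' => hk (h.trans h'.symm), by omega, hT₂ t (by omega)⟩
    · exact ⟨k₁, n₁, h, by omega, hT₁ t (by omega)⟩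
  have h3 := hist_le_misclassified inp (tree prm inp t) v t hkp
  rw [hcell t (by omega), hbirth t (by omega)] at h3
  have h4 := misclassified_le inp (tree prm inp t) v t
  have h5 : count inp .estimation (birth (tree prm inp t) v) t
      (cell inp (tree prm inp t) v) ≤ count inp .estimation (birth (tree prm inp t) v) t
      Set.univ := by
    refine Finset.card_le_card fun u hu => ?_
    simp only [Finset.mem_filter] at hu ⊢
    exact ⟨hu.1, hu.2.1, trivial⟩
  rw [sHat_eq, ← mul_div_assoc, le_div_iff₀ (by
    have : 0 < count inp .estimation (birth (tree prm inp t) v) t Set.univ := by omega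
    exact_mod_cast this), one_mul, hbirth t (by omega)]
  have h6 : count inp .estimation a t Set.univ ≤
      2 * (n₁ + n₂ + 1) * misclassified inp (tree prm inp t) v t :=
    calc _ ≤ n * (a + hist inp .estimation a t (box (fun s => (x s).1) l) k) := h2
      _ ≤ (n₁ + n₂ + 1) * (2 * misclassified inp (tree prm inp t) v t) :=
        Nat.mul_le_mul (by omega) (by omega)
      _ = _ := by ring
  exact_mod_cast h6

/-- The estimated score of a leaf other than the root whose true score is positive is eventually
bounded from below. The class predicted at time `t₀` has been observed in the cell, so it is not
negligible there; by the positivity of the score, neither is one of the other classes. -/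
lemma GoodSequence.one_le_mul_sHat (hF : 1 ≤ prm.F) (hα : ∀ d, 0 < prm.α d) {r : ℕ}
    (hx : GoodSequence prm ρ i z r x) (hi : {u | i u = .estimation}.Infinite) {b : Bool} {u : Node}
    {t₀ : ℕ} (hv : b :: u ∈ (tree prm (seqInput i z x) t₀).leaves)
    (hpos : ρ {y | y.1 ∈ cell (seqInput i z x) (tree prm (seqInput i z x) t₀) (b :: u) ∧
      y.2 ≠ prediction (seqInput i z x) (tree prm (seqInput i z x) t₀) (b :: u) t₀} ≠ 0) :
    ∃ L T : ℕ, 1 ≤ L ∧ ∀ t ≥ T,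
      1 ≤ L * sHat (seqInput i z x) (tree prm (seqInput i z x) t) (b :: u) t := by
  set inp := seqInput i z x with hinp
  have hinv := tree_invariant (prm := prm) (inp := inp) hF t₀
  set s := tree prm inp t₀ with hs
  have hreach := hinv.leaf_reached _ hv
  obtain ⟨q, hq⟩ := Option.isSome_iff_exists.1 hreach.1
  obtain ⟨k₂, hk₂, h₂⟩ := exists_label_measure_ne_zero
    (S := {k | k ≠ prediction inp s (b :: u) t₀}) hpos
  refine hx.one_le_mul_sHat_of_two_labels hF hi hreach (Ne.symm hk₂) ?_ h₂
  have hbirth : birth s (b :: u) = q.2 := by simp [birth, hq]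
  have hcount := (hα u.length).trans_le (hinv.leaf_count b u q hv hq)
  rw [← hbirth] at hcount
  have hhist : 0 < hist inp .estimation (birth s (b :: u)) t₀ (cell inp s (b :: u))
      (prediction inp s (b :: u) t₀) := by
    by_contra! hcon
    have h0 : count inp .estimation (birth s (b :: u)) t₀ (cell inp s (b :: u)) = 0 := by
      rw [← sum_hist]
      refine Finset.sum_eq_zero fun k _ => ?_
      exact Nat.le_zero.1 ((hist_le_hist_majority _ k).trans hcon)
    simp [h0] at hcount
  obtain ⟨w, hw⟩ := Finset.card_pos.1 hhist
  simp only [Finset.mem_filter] at hw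
  obtain ⟨-, hI, hX, hY⟩ := hw
  intro h0
  rw [cell_eq_box inp hreach] at h0 hX
  refine (hx.typical _ _).1 h0 w (fun hmem => ?_) ⟨hX, hY⟩
  have : inp.I w = .structural := (times_path_lt hF hreach w hmem).2
  rw [this] at hI
  exact absurd hI (by decide)

/-- For a typical sequence of data points, a leaf with positive score becomes active: if it did
not, then from some time on only leafs with estimated score bounded from below would be activated.
By `GoodSequence.not_frequent` these have bounded depth, so that only finitely many splits would
be made, although every active leaf is eventually split. -/
theorem GoodSequence.exists_mem_fringe [IsProbabilityMeasure ρ] (hm : 1 ≤ prm.m) (hF : 1 ≤ prm.F)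
    (hα : ∀ d, 0 < prm.α d) (hαtop : Tendsto prm.α atTop atTop) (hz : ∀ v, (z v).Nonempty)
    (hi : ∀ k, {u | i u = k}.Infinite) {r : ℕ} (hx : GoodSequence prm ρ i z r x) {v : Node}
    {t₀ : ℕ} (hv : v ∈ (tree prm (seqInput i z x) t₀).leaves)
    (hpos : ρ {y | y.1 ∈ cell (seqInput i z x) (tree prm (seqInput i z x) t₀) v ∧
      y.2 ≠ prediction (seqInput i z x) (tree prm (seqInput i z x) t₀) v t₀} ≠ 0) :
    ∃ t, v ∈ (tree prm (seqInput i z x) t).fringe := by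
  by_contra! hnever
  cases v with
  | nil => exact hnever 0 (by simp [tree, initial])
  | cons b₀ u₀ =>
  obtain ⟨L, T₀, hL, hT₀⟩ := hx.one_le_mul_sHat hF hα (hi .estimation) hv hpos
  set inp := seqInput i z x with hinp
  obtain ⟨d₀, hd₀⟩ := hx.not_frequent L hL
  obtain ⟨d₁, hd₁⟩ := (hαtop.eventually_ge_atTop (r : ℝ)).exists_forall_of_atTop
  have hinv := fun t => tree_invariant (prm := prm) (inp := inp) hF t
  set T := max T₀ t₀ with hT
  set d := max d₀ d₁ + 1 with hd
  -- from time `T` on, only leafs of bounded depth are activated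
  have hact : ∀ t ≥ T, ∀ w, w ∉ (tree prm inp t).fringe → w ∈ (tree prm inp (t + 1)).fringe →
      w.length < d := by
    intro t ht w hw hw'
    rcases tree_succ_cases (prm := prm) (inp := inp) hF t with
      h | ⟨_, -, -, -, -, ⟨-, h, -⟩ | ⟨_, -, -, -, h⟩⟩
    · exact absurd (h ▸ hw') hw
    · exact absurd (h ▸ hw') hw
    have hle := h _ w (leaf_of_never_active hF
      ((le_max_right T₀ t₀).trans (ht.trans t.le_succ)) hv hnever) (hnever _) hw hw'
    have h1 := (hT₀ (t + 1) ((le_max_left T₀ t₀).trans (ht.trans t.le_succ))).trans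
      (mul_le_mul_of_nonneg_left hle (Nat.cast_nonneg L))
    have hfreq := count_univ_le_of_one_le_mul_sHat h1
    cases w with
    | nil => simp [hd]
    | cons b u =>
    by_contra! hlen
    simp only [List.length_cons, hd, add_le_add_iff_right] at hlen
    have hleaf := (hinv (t + 1)).fringe_subset hw'
    obtain ⟨q, hq⟩ := Option.isSome_iff_exists.1 ((hinv (t + 1)).leaf_reached _ hleaf).1
    obtain ⟨hcr, -⟩ := created_of_split hF hq
    have hstr : i q.2 = .structural := hcr.1
    have hbirth : birth (tree prm inp (t + 1)) (b :: u) = q.2 := by simp [birth, hq]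
    have hcell : cell inp (tree prm inp (t + 1)) (b :: u) =
        box (fun s => (x s).1) (((q.1, q.2), b) :: path (tree prm inp q.2) u) := by
      rw [cell_child hF b hq, cell_eq_box inp (hcr.reached hF), side_box]
      rfl
    have hcount := (hd₁ u.length ((le_max_right _ _).trans hlen)).trans
      ((hinv (t + 1)).leaf_count b u q hleaf hq)
    rw [Nat.cast_le, hcell, hinp, count_eq_visits hstr] at hcount
    rw [hbirth, hcell, hinp, count_eq_visits hstr, count_eq_visits hstr,
      Set.preimage_univ] at hfreq
    exact hd₀ u ((le_max_left _ _).trans hlen) q.2 _ q.1 b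
      ⟨(created_iff hF).1 hcr, t + 1, hcount, hfreq⟩
  -- every node which is ever split was split or active at time `T` or was activated later
  have hfin : {w | ∃ t, ((tree prm inp t).split w).isSome}.Finite := by
    refine (((hinv T).finite_split.union (tree prm inp T).fringe.finite_toSet).union
      (List.finite_length_lt Bool d)).subset ?_
    have key : ∀ t ≥ T, ∀ w, ((tree prm inp t).split w).isSome ∨ w ∈ (tree prm inp t).fringe →
        w ∈ {w | ((tree prm inp T).split w).isSome} ∪ ↑(tree prm inp T).fringe ∪
          {w : List Bool | w.length < d} := by
      intro t ht
      induction t, ht using Nat.le_induction with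
      | base =>
        rintro w (h | h)
        · exact .inl (.inl h)
        · exact .inl (.inr h)
      | succ t ht ih =>
        rintro w (h | h)
        · by_cases hs : ((tree prm inp t).split w).isSome
          · exact ih w (.inl hs)
          · refine ih w (.inr ?_)
            rcases tree_succ_cases (prm := prm) (inp := inp) hF t with
              h' | ⟨v, hv, -, -, -, ⟨-, -, h'⟩ | ⟨q, -, h', -⟩⟩
            · exact absurd (h' ▸ h) hs
            · exact absurd (h' ▸ h) hs
            · by_cases hwv : w = v
              · exact hwv ▸ hv
              · rw [h', splitLeaf_split_of_ne _ _ hwv] at h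
                exact absurd h hs
        · by_cases hs : w ∈ (tree prm inp t).fringe
          · exact ih w (.inr hs)
          · exact .inr (hact t ht w hs h)
    rintro w ⟨t, ht⟩
    refine key (max t T) (le_max_right _ _) w (.inl ?_)
    obtain ⟨q, hq⟩ := Option.isSome_iff_exists.1 ht
    rw [tree_extends hF (le_max_left t T) w q hq]
    rfl
  choose! τ hτ using fun w (hw : w ∈ {w | ∃ t, ((tree prm inp t).split w).isSome}) => hw
  -- when all splits have been made, there is still an active leaf, which is split later
  obtain ⟨w, hw⟩ := (hinv (hfin.toFinset.sup τ)).fringe_nonempty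
  have hns := (hinv _).leaf_unsplit w ((hinv _).fringe_subset hw)
  obtain ⟨t, q, hq⟩ := hx.exists_split hm hF hz hi hw
  have hmem : w ∈ {w | ∃ t, ((tree prm inp t).split w).isSome} := ⟨t, by rw [hq]; rfl⟩
  obtain ⟨q', hq'⟩ := Option.isSome_iff_exists.1 (hτ w hmem)
  have := tree_extends hF (Finset.le_sup (f := τ) (hfin.mem_toFinset.2 hmem)) w q' hq'
  rw [hns] at this
  simp at this

end Activation

/-! ### Almost every sequence of data points is typical -/

section Typical

variable {D c : ℕ} [NeZero c] {prm : Params c} {i : ℕ → PointType} {z : Node → Finset (Fin D)}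
  {ρ : Measure ((Fin D → ℝ) × Fin c)} [IsProbabilityMeasure ρ]

lemma exists_ae_goodSequence (hF : 1 ≤ prm.F) (hρ : ρ.map Prod.fst ≪ volume)
    (hi : ∀ k, {u | i u = k}.Infinite) :
    ∃ r, ∀ᵐ x ∂(Measure.infinitePi fun _ : ℕ => ρ), GoodSequence prm ρ i z r x := by
  have : IsProbabilityMeasure (ρ.map Prod.fst) :=
    Measure.isProbabilityMeasure_map measurable_fst.aemeasurable
  set δ : ℝ≥0∞ := ((4 * D * prm.m + 1 : ℕ) : ℝ≥0∞)⁻¹ with hδ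
  have hδ0 : δ ≠ 0 := ENNReal.inv_ne_zero.2 (ENNReal.natCast_ne_top _)
  have hδ1 : δ ≤ 1 := ENNReal.inv_le_one.2 (by exact_mod_cast Nat.le_add_left 1 _)
  -- each of the `m` candidate split points has `2 D` candidate children
  have hδm : D * 2 * δ * prm.m ≤ (2⁻¹ : ℝ≥0∞) := by
    rw [ENNReal.le_inv_iff_mul_le]
    calc (D * 2 * δ * prm.m * 2 : ℝ≥0∞) = ((4 * D * prm.m : ℕ) : ℝ≥0∞) * δ := by
          push_cast
          ring
      _ ≤ ((4 * D * prm.m + 1 : ℕ) : ℝ≥0∞) * δ := by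
          gcongr
          omega
      _ ≤ 1 := ENNReal.mul_inv_le_one _
  obtain ⟨r, -, hr⟩ := exists_pow_halfSpace_le hδ0 hδ1 hρ
  refine ⟨r, ?_⟩
  have h3 : ∀ᵐ x ∂(Measure.infinitePi fun _ : ℕ => ρ), ∀ L, 1 ≤ L → ∃ d₀, ∀ v : Node,
      d₀ ≤ v.length → ∀ t l j b, ¬ FrequentChild prm i z r L v t l j b x := by
    refine ae_all_iff.2 fun L => ?_
    by_cases hL : 1 ≤ L
    · filter_upwards [ae_exists_depth_not_frequentChild (i := i) (z := z) hF rfl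
        (ne_top_of_le_ne_top ENNReal.one_ne_top hδ1) hδm hr hL] with x hx _
      exact hx
    · exact .of_forall fun _ h => absurd h hL
  filter_upwards [ae_measure_box_cons_ne_zero hρ, ae_typical hi, h3] with x h1 h2 h3
  exact ⟨h1, h2, h3⟩

end Typical

/-! ### Measurability of the event that the leafs with positive score become active -/

section Measurability

variable {Ω : Type*} [MeasurableSpace Ω] {D c : ℕ} {prm : Params c}
  {ρ : Measure ((Fin D → ℝ) × Fin c)} {X : ℕ → Ω → Fin D → ℝ} {Y : ℕ → Ω → Fin c}
  {I : ℕ → Ω → PointType} {Z : Node → Ω → Finset (Fin D)}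

lemma measurableSet_cell (inp : Input D c) (s : TreeState D) (v : Node) :
    MeasurableSet (cell inp s v) :=
  randomSet_cell (Ω := Fin D → ℝ) (X := fun t _ => inp.X t) (Y := fun t _ => inp.Y t)
    (I := fun t _ => inp.I t) (Z := fun v _ => inp.dims v) (fun _ => measurable_const) s v
    (fun y => y) measurable_id

lemma measurable_measure_cell [SFinite ρ] (hX : ∀ t, Measurable (X t)) (s : TreeState D) (v : Node)
    (k : Fin c) :
    Measurable fun ω => ρ {y | y.1 ∈ cell (input X Y I Z ω) s v ∧ y.2 ≠ k} := by
  refine measurable_measure_prodMk_left (s := {p : Ω × ((Fin D → ℝ) × Fin c) |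
    p.2.1 ∈ cell (input X Y I Z p.1) s v ∧ p.2.2 ≠ k}) (.inter ?_ ?_)
  · exact randomSet_cell (Ω := Ω × ((Fin D → ℝ) × Fin c)) (X := fun t p => X t p.1)
      (Y := fun t p => Y t p.1) (I := fun t p => I t p.1) (Z := fun v p => Z v p.1)
      (fun t => (hX t).comp measurable_fst) s v (fun p => p.2.1)
      (measurable_fst.comp measurable_snd)
  · exact (measurable_snd.comp measurable_snd) (measurableSet_singleton k).compl

lemma history_le (hX : ∀ t, Measurable (X t)) (hY : ∀ t, Measurable (Y t))
    (hI : ∀ t, Measurable (I t)) (hZ : ∀ v, Measurable (Z v)) (t₀ : ℕ) :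
    history X Y I Z t₀ ≤ ‹MeasurableSpace Ω› :=
  sup_le (iSup₂_le fun t _ => sup_le (sup_le (hX t).comap_le (hY t).comap_le) (hI t).comap_le)
    (iSup₂_le fun v _ => (hZ v).comap_le)

variable [NeZero c]

/-- The true score of a leaf is positive if and only if the misclassified points in the leaf are
not negligible. -/
lemma trueScore_pos_iff [IsFiniteMeasure ρ] (inp : Input D c) (s : TreeState D) (v : Node)
    (t : ℕ) : 0 < trueScore ρ inp s v t ↔
      ρ {y | y.1 ∈ cell inp s v ∧ y.2 ≠ prediction inp s v t} ≠ 0 := by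
  set A : Set ((Fin D → ℝ) × Fin c) := {y | y.1 ∈ cell inp s v} with hA
  set B : Set ((Fin D → ℝ) × Fin c) := {y | y.2 ≠ prediction inp s v t} with hB
  have hAm : MeasurableSet A := measurable_fst (measurableSet_cell inp s v)
  change 0 < ρ.real A * (ρ[|A]).real B ↔ ρ (A ∩ B) ≠ 0
  rw [show (ρ[|A]).real B = (ρ.real A)⁻¹ * ρ.real (A ∩ B) by
    rw [Measure.real, cond_apply hAm, ENNReal.toReal_mul, ENNReal.toReal_inv, Measure.real,
      Measure.real]]
  have hle : ρ (A ∩ B) ≤ ρ A := measure_mono Set.inter_subset_left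
  by_cases h : ρ A = 0
  · have : ρ (A ∩ B) = 0 := le_antisymm (h ▸ hle) zero_le
    simp [Measure.real, h, this]
  · have h' : ρ.real A ≠ 0 := (ENNReal.toReal_ne_zero.2 ⟨h, measure_ne_top _ _⟩)
    rw [mul_inv_cancel_left₀ h', measureReal_nonneg.lt_iff_ne', Ne, measureReal_eq_zero_iff]

/-- The tree takes countably many values, and for a given tree the event depends measurably on the
data points which cut out the cells. -/
lemma measurableSet_entersFringe [IsFiniteMeasure ρ] (hX : ∀ t, Measurable (X t))
    (hY : ∀ t, Measurable (Y t)) (hI : ∀ t, Measurable (I t)) (hZ : ∀ v, Measurable (Z v))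
    (t₀ T : ℕ) : MeasurableSet (entersFringe prm ρ X Y I Z t₀ T) := by
  have htree := fun t => countablyValued_tree (prm := prm) hX hY hI hZ t
  simp only [entersFringe, Set.ofPred_forall]
  refine .iInter fun v => ?_
  refine measurableSet_imp ((htree t₀).measurableSet fun s => v ∈ s.leaves)
    (measurableSet_imp ?_ ?_)
  · simp only [trueScore_pos_iff]
    have h : CountablyValued fun ω => (tree prm (input X Y I Z ω) t₀,
        prediction (input X Y I Z ω) (tree prm (input X Y I Z ω) t₀) v t₀) :=
      (htree t₀).bind (g := fun s ω => (s, prediction (input X Y I Z ω) s v t₀))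
        (fun s => (countablyValued_prediction hX hY hI s v t₀).comp fun k => (s, k)) fun _ => rfl
    have h' : CountablyValued fun ω =>
        ρ {y | y.1 ∈ cell (input X Y I Z ω) (tree prm (input X Y I Z ω) t₀) v ∧
          y.2 ≠ prediction (input X Y I Z ω) (tree prm (input X Y I Z ω) t₀) v t₀} ≠ 0 := by
      refine h.bind (g := fun p ω =>
        ρ {y | y.1 ∈ cell (input X Y I Z ω) p.1 v ∧ y.2 ≠ p.2} ≠ 0) (fun p => ?_) fun _ => rfl
      have hm := measurable_measure_cell (ρ := ρ) (Y := Y) (I := I) (Z := Z) hX p.1 v p.2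
      exact .of_measurableSet (hm (measurableSet_singleton 0).compl)
    exact h'.measurableSet fun p => p
  · have : {ω | ∃ t ≤ T, v ∈ (tree prm (input X Y I Z ω) t).fringe} =
        ⋃ t ∈ Set.Iic T, {ω | v ∈ (tree prm (input X Y I Z ω) t).fringe} := by
      ext ω
      simp
    rw [this]
    exact .biUnion (Set.to_countable _) fun t _ => (htree t).measurableSet fun s => v ∈ s.fringe

end Measurability

section Enters

variable {Ω : Type*} {D c : ℕ} [NeZero c] {prm : Params c}
  {ρ : Measure ((Fin D → ℝ) × Fin c)} {X : ℕ → Ω → Fin D → ℝ} {Y : ℕ → Ω → Fin c}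
  {I : ℕ → Ω → PointType} {Z : Node → Ω → Finset (Fin D)}

lemma entersFringe_mono (t₀ : ℕ) : Monotone (entersFringe prm ρ X Y I Z t₀) :=
  fun _ _ h _ hω v hv hs =>
    let ⟨t, ht, hm⟩ := hω v hv hs
    ⟨t, ht.trans h, hm⟩

lemma exists_mem_entersFringe {t₀ : ℕ} {ω : Ω}
    (h : ∀ v ∈ (tree prm (input X Y I Z ω) t₀).leaves,
      0 < trueScore ρ (input X Y I Z ω) (tree prm (input X Y I Z ω) t₀) v t₀ →
        ∃ t, v ∈ (tree prm (input X Y I Z ω) t).fringe) :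
    ∃ T, ω ∈ entersFringe prm ρ X Y I Z t₀ T := by
  choose! τ hτ using h
  refine ⟨(tree prm (input X Y I Z ω) t₀).leaves.sup τ, fun v hv hs => ?_⟩
  exact ⟨τ v, Finset.le_sup hv, hτ v hv hs⟩

end Enters

/-! ### Conditional probabilities of an increasing sequence of events -/

section Conditional

variable {Ω : Type*} {m₀ : MeasurableSpace Ω} {P : Measure Ω} [IsProbabilityMeasure P]
  {E : ℕ → Set Ω}

lemma exists_le_measureReal (hE : Monotone E) (hEm : ∀ T, MeasurableSet (E T))
    (h : ∀ᵐ ω ∂P, ∃ T, ω ∈ E T) {δ : ℝ} (hδ : 0 < δ) :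
    ∃ T, 1 - δ ≤ P.real (E T) := by
  have h1 : P (⋃ T, E T) = 1 :=
    (mem_ae_iff_prob_eq_one (.iUnion hEm)).1 (h.mono fun ω hω => Set.mem_iUnion.2 hω)
  have h2 := tendsto_measure_iUnion_atTop (μ := P) hE
  rw [h1] at h2
  have h3 := (ENNReal.tendsto_toReal ENNReal.one_ne_top).comp h2
  obtain ⟨T, hT⟩ := (h3.eventually_const_lt (show 1 - δ < (1 : ℝ≥0∞).toReal by simpa)).exists
  exact ⟨T, hT.le⟩

/-- If almost every point belongs to one of the increasing events `E T`, then their conditional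
probabilities tend to `1` almost surely. -/
lemma ae_exists_le_condExp {m : MeasurableSpace Ω} (hm : m ≤ m₀) (hE : Monotone E)
    (hEm : ∀ T, MeasurableSet[m₀] (E T)) (h : ∀ᵐ ω ∂P, ∃ T, ω ∈ E T) :
    ∀ᵐ ω ∂P, ∀ δ : ℝ, 0 < δ → ∃ T, 1 - δ ≤ (P⟦E T | m⟧) ω := by
  have key : ∀ n : ℕ, ∀ᵐ ω ∂P, ∃ T, 1 - 1 / ((n : ℝ) + 1) ≤ (P⟦E T | m⟧) ω := by
    intro n
    set ε : ℝ := 1 / ((n : ℝ) + 1) with hε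
    have hε0 : 0 < ε := by positivity
    -- the event `B` that the conditional probabilities stay below `1 - ε` belongs to `m`
    set B : Set Ω := {ω | ∀ T, (P⟦E T | m⟧) ω < 1 - ε} with hB
    have hBm : MeasurableSet[m] B := by
      rw [hB, Set.ofPred_forall]
      refine .iInter fun T => ?_
      have hmeas : Measurable[m] (P⟦E T | m⟧) := stronglyMeasurable_condExp.measurable
      exact hmeas (measurableSet_Iio (a := 1 - ε))
    have h1 : ∀ T, P.real (B ∩ E T) ≤ (1 - ε) * P.real B := by
      intro T
      have hint : Integrable ((E T).indicator fun _ => (1 : ℝ)) P :=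
        (integrable_const _).indicator (hEm T)
      have heq := setIntegral_condExp hm hint hBm
      rw [setIntegral_indicator (hEm T), setIntegral_const, smul_eq_mul, mul_one] at heq
      rw [← heq]
      calc _ ≤ ∫ _ in B, (1 - ε) ∂P := setIntegral_mono_on integrable_condExp.integrableOn
            (integrable_const _).integrableOn (hm _ hBm) fun ω hω => (hω T).le
        _ = _ := by rw [setIntegral_const, smul_eq_mul, mul_comm]
    have h2 : Tendsto (fun T => P.real (B ∩ E T)) atTop (𝓝 (P.real B)) := by
      have hlim := tendsto_measure_iUnion_atTop (μ := P)
        (s := fun T => B ∩ E T) fun _ _ hT => Set.inter_subset_inter_right _ (hE hT)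
      have hu : P (⋃ T, B ∩ E T) = P B := by
        rw [← Set.inter_iUnion]
        exact measure_inter_conull (mem_ae_iff.1 (h.mono fun ω hω => Set.mem_iUnion.2 hω))
      rw [hu] at hlim
      exact (ENNReal.tendsto_toReal (measure_ne_top P B)).comp hlim
    have h3 : P.real B ≤ (1 - ε) * P.real B := le_of_tendsto' h2 h1
    have h4 : P.real B = 0 := by
      have := measureReal_nonneg (μ := P) (s := B)
      nlinarith
    have h5 : P B = 0 := (measureReal_eq_zero_iff).1 h4
    filter_upwards [measure_eq_zero_iff_ae_notMem.1 h5] with ω hω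
    simpa [hB] using hω
  filter_upwards [ae_all_iff.2 key] with ω hω δ hδ
  obtain ⟨n, hn⟩ := exists_nat_one_div_lt hδ
  obtain ⟨T, hT⟩ := hω n
  exact ⟨T, by linarith⟩

end Conditional

/-! ### Randomness of the types and of the candidate dimensions -/

section Main

variable {Ω : Type*} [MeasurableSpace Ω] {P : Measure Ω} [IsProbabilityMeasure P] {D c : ℕ}
  {prm : Params c} {ρ : Measure ((Fin D → ℝ) × Fin c)}

/-- If the data points are assigned to the streams independently at random, then both streams are
almost surely infinite. -/
lemma ae_infinite_type {I : ℕ → Ω → PointType} {p : ℝ} (hp0 : 0 < p) (hp1 : p < 1)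
    (hI : ∀ t, Measurable (I t)) (hIp : ∀ t, P.real {ω | I t ω = .estimation} = p)
    (hind : iIndepFun I P) : ∀ᵐ ω ∂P, ∀ k, {t | I t ω = k}.Infinite := by
  have hm : ∀ t k, MeasurableSet {ω | I t ω = k} := measurableSet_type hI
  have hreal : ∀ k, ∃ q : ℝ, 0 < q ∧ ∀ t, P.real {ω | I t ω = k} = q := by
    intro k
    cases k with
    | estimation => exact ⟨p, hp0, hIp⟩
    | structural =>
      refine ⟨1 - p, by linarith, fun t => ?_⟩
      have : {ω | I t ω = .structural} = {ω | I t ω = .estimation}ᶜ := by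
        ext ω
        cases h : I t ω <;> simp [h]
      rw [this, probReal_compl_eq_one_sub (hm t _), hIp]
  refine ae_all_iff.2 fun k => ?_
  obtain ⟨q, hq, hqt⟩ := hreal k
  have hlim := measure_limsup_eq_one (μ := P) (s := fun t => {ω | I t ω = k}) (fun t => hm t k)
    ((iIndepSet_iff_meas_biInter fun t => hm t k).2 fun S =>
      hind.measure_inter_preimage_eq_mul S (sets := fun _ => {k})
        fun t _ => show MeasurableSet {k} from trivial)
    (by
      have hPq : ∀ t, P {ω | I t ω = k} = ENNReal.ofReal q := fun t => by
        rw [← hqt t, ofReal_measureReal]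
      simp only [hPq]
      exact ENNReal.tsum_const_eq_top_of_ne_zero (by simpa using hq))
  have := (mem_ae_iff_prob_eq_one (.measurableSet_limsup fun t => hm t k)).2 hlim
  filter_upwards [this] with ω hω
  rw [mem_limsup_iff_frequently_mem] at hω
  exact Nat.frequently_atTop_iff_infinite.1 hω

/-- Almost surely, the set of candidate dimensions of a node is not empty. -/
lemma dimsProb_empty (hD : 1 ≤ D) (lam : ℝ≥0) : dimsProb lam D ∅ = 0 := by
  have : {n : ℕ | min (1 + n) D = (∅ : Finset (Fin D)).card} = ∅ := by
    ext n
    simp only [Finset.card_empty, Set.mem_ofPred_eq, Set.mem_empty_iff_false, iff_false]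
    omega
  rw [dimsProb, this, measure_empty, ENNReal.zero_div]

variable [NeZero c]

/-- Almost surely, every leaf with positive score becomes active. The types and the candidate
dimensions are independent of the data points, so that they may be fixed. -/
theorem ae_exists_mem_entersFringe (hD : 1 ≤ D) (hm : 1 ≤ prm.m) (hF : 1 ≤ prm.F)
    (hα : ∀ d, 0 < prm.α d) (hαtop : Tendsto prm.α atTop atTop) {lam : ℝ≥0}
    [IsProbabilityMeasure ρ] (hρ : ρ.map Prod.fst ≪ volume)
    {X : ℕ → Ω → Fin D → ℝ} {Y : ℕ → Ω → Fin c}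
    (hX : ∀ t, Measurable (X t)) (hY : ∀ t, Measurable (Y t))
    (hXYlaw : ∀ t, P.map (fun ω => (X t ω, Y t ω)) = ρ)
    (hXYindep : iIndepFun (fun t ω => (X t ω, Y t ω)) P)
    {Z : Node → Ω → Finset (Fin D)} (hZ : ∀ v, Measurable (Z v))
    (hZlaw : ∀ v S, P {ω | Z v ω = S} = dimsProb lam D S)
    (hXYZ : IndepFun (fun ω t => (X t ω, Y t ω)) (fun ω v => Z v ω) P)
    {I : ℕ → Ω → PointType} (hI : ∀ t, Measurable (I t))
    (hIinf : ∀ᵐ ω ∂P, ∀ k, {t | I t ω = k}.Infinite)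
    (hIXYZ : IndepFun (fun ω t => I t ω)
      (fun ω => (fun t => (X t ω, Y t ω), fun v => Z v ω)) P) (t₀ : ℕ) :
    ∀ᵐ ω ∂P, ∃ T, ω ∈ entersFringe prm ρ X Y I Z t₀ T := by
  set ξ : Ω → ℕ → (Fin D → ℝ) × Fin c := fun ω t => (X t ω, Y t ω) with hξ
  have hξm : Measurable ξ := measurable_pi_lambda _ fun t => (hX t).prodMk (hY t)
  have hζm : Measurable fun ω v => Z v ω := measurable_pi_lambda _ hZ
  have hIm : Measurable fun ω t => I t ω := measurable_pi_lambda _ hI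
  -- the event on the canonical space
  set E := (ℕ → PointType) × ((ℕ → (Fin D → ℝ) × Fin c) × (Node → Finset (Fin D)))
  have hE1 : ∀ t, Measurable fun p : E => p.2.1 t := fun t =>
    (measurable_pi_apply t).comp (measurable_fst.comp measurable_snd)
  set G : Set E := ⋃ T, entersFringe prm ρ (fun t p => (p.2.1 t).1) (fun t p => (p.2.1 t).2)
    (fun t p => p.1 t) (fun v p => p.2.2 v) t₀ T with hG
  have hGm : MeasurableSet G := .iUnion fun T =>
    measurableSet_entersFringe (fun t => measurable_fst.comp (hE1 t))
      (fun t => measurable_snd.comp (hE1 t)) (fun t => (measurable_pi_apply t).comp measurable_fst)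
      (fun v => (measurable_pi_apply v).comp (measurable_snd.comp measurable_snd)) t₀ T
  have hmap : P.map (fun ω => ((fun t => I t ω), ξ ω, fun v => Z v ω)) =
      (P.map fun ω t => I t ω).prod ((Measure.infinitePi fun _ => ρ).prod
        (P.map fun ω v => Z v ω)) := by
    rw [(indepFun_iff_map_prod_eq_prod_map_map hIm.aemeasurable
      (hξm.prodMk hζm).aemeasurable).1 hIXYZ,
      (indepFun_iff_map_prod_eq_prod_map_map hξm.aemeasurable hζm.aemeasurable).1 hXYZ,
      hXYindep.map_fun_eq_infinitePi_map fun t => (hX t).prodMk (hY t)]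
    simp only [hXYlaw]
  have hP1 : IsProbabilityMeasure (P.map fun ω v => Z v ω) :=
    Measure.isProbabilityMeasure_map hζm.aemeasurable
  have hGae : ∀ᵐ p ∂(P.map fun ω => ((fun t => I t ω), ξ ω, fun v => Z v ω)), p ∈ G := by
    rw [hmap, Measure.ae_prod_mem_iff_ae_ae_mem hGm]
    have hIinf' : ∀ᵐ i ∂(P.map fun ω t => I t ω), ∀ k, {t | i t = k}.Infinite := by
      rw [ae_map_iff hIm.aemeasurable]
      · exact hIinf
      · rw [Set.ofPred_forall]
        refine .iInter fun k => ?_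
        have : {i : ℕ → PointType | {t | i t = k}.Infinite} =
            limsup (fun t => {i : ℕ → PointType | i t = k}) atTop := by
          ext i
          rw [mem_limsup_iff_frequently_mem]
          exact Nat.frequently_atTop_iff_infinite.symm
        rw [this]
        exact .measurableSet_limsup fun t => measurable_pi_apply (X := fun _ : ℕ => PointType) t
          (show MeasurableSet {k} from trivial)
    have hz : ∀ᵐ z ∂(P.map fun ω v => Z v ω), ∀ v, (z v).Nonempty := by
      refine ae_all_iff.2 fun v => ?_
      rw [ae_map_iff hζm.aemeasurable]
      · have h0 : P {ω | Z v ω = ∅} = 0 := by rw [hZlaw, dimsProb_empty hD]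
        filter_upwards [measure_eq_zero_iff_ae_notMem.1 h0] with ω hω
        exact Finset.nonempty_iff_ne_empty.2 hω
      · exact measurable_pi_apply (X := fun _ : Node => Finset (Fin D)) v
          (Set.to_countable {S : Finset (Fin D) | S.Nonempty}).measurableSet
    filter_upwards [hIinf'] with i hi
    have hGi : MeasurableSet {q : (ℕ → (Fin D → ℝ) × Fin c) × (Node → Finset (Fin D)) |
        (i, q) ∈ G} := measurable_prodMk_left hGm
    rw [Measure.ae_prod_iff_ae_ae hGi, Measure.ae_ae_comm hGi]
    filter_upwards [hz] with z hz
    obtain ⟨r, hr⟩ := exists_ae_goodSequence (prm := prm) (ρ := ρ) (i := i) (z := z) hF hρ hi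
    filter_upwards [hr] with x hx
    refine Set.mem_iUnion.2 (exists_mem_entersFringe fun v hv hs => ?_)
    exact hx.exists_mem_fringe hm hF hα hαtop hz hi hv ((trueScore_pos_iff _ _ _ _).1 hs)
  filter_upwards [ae_of_ae_map (hIm.prodMk (hξm.prodMk hζm)).aemeasurable hGae] with ω hω
  obtain ⟨T, hT⟩ := Set.mem_iUnion.1 hω
  exact ⟨T, hT⟩

/-- The assertion for any random types which are independent of the rest, a deterministic sequence
of types included. -/
theorem leavesEnterFringe (hD : 1 ≤ D) (hm : 1 ≤ prm.m) (hF : 1 ≤ prm.F)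
    (hα : ∀ d, 0 < prm.α d) (hαtop : Tendsto prm.α atTop atTop) {lam : ℝ≥0}
    (hρ : ρ.map Prod.fst ≪ volume) {X : ℕ → Ω → Fin D → ℝ} {Y : ℕ → Ω → Fin c}
    (hX : ∀ t, Measurable (X t)) (hY : ∀ t, Measurable (Y t))
    (hXYlaw : ∀ t, P.map (fun ω => (X t ω, Y t ω)) = ρ)
    (hXYindep : iIndepFun (fun t ω => (X t ω, Y t ω)) P)
    {Z : Node → Ω → Finset (Fin D)} (hZ : ∀ v, Measurable (Z v))
    (hZlaw : ∀ v S, P {ω | Z v ω = S} = dimsProb lam D S)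
    (hXYZ : IndepFun (fun ω t => (X t ω, Y t ω)) (fun ω v => Z v ω) P)
    {I : ℕ → Ω → PointType} (hI : ∀ t, Measurable (I t))
    (hIinf : ∀ᵐ ω ∂P, ∀ k, {t | I t ω = k}.Infinite)
    (hIXYZ : IndepFun (fun ω t => I t ω)
      (fun ω => (fun t => (X t ω, Y t ω), fun v => Z v ω)) P) :
    LeavesEnterFringe P prm ρ X Y I Z := by
  have : IsProbabilityMeasure ρ :=
    hXYlaw 0 ▸ Measure.isProbabilityMeasure_map ((hX 0).prodMk (hY 0)).aemeasurable
  intro t₀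
  have h := ae_exists_mem_entersFringe hD hm hF hα hαtop hρ hX hY hXYlaw hXYindep hZ hZlaw hXYZ hI
    hIinf hIXYZ t₀
  have hE := fun T => measurableSet_entersFringe (prm := prm) (ρ := ρ) hX hY hI hZ t₀ T
  exact ⟨fun δ hδ => exists_le_measureReal (entersFringe_mono t₀) hE h hδ,
    ae_exists_le_condExp (history_le hX hY hI hZ t₀) (entersFringe_mono t₀) hE h⟩

end Main

end OnlineForest

theorem mainTheorem2 {Ω : Type*} [MeasurableSpace Ω] (P : Measure Ω) [IsProbabilityMeasure P]
    {D c : ℕ} [NeZero c] (hD : 1 ≤ D)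
    (prm : OnlineForest.Params c) (hm : 1 ≤ prm.m) (hF : 1 ≤ prm.F)
    (hαpos : ∀ d, 0 < prm.α d) (hαmono : Monotone prm.α) (hαtop : Tendsto prm.α atTop atTop)
    (hαgrowth : Tendsto (fun d : ℕ => (d : ℝ) / prm.α d) atTop (𝓝 0))
    (hβ : ∀ d, prm.α d ≤ prm.β d)
    (lam : ℝ≥0)
    (ρ : Measure ((Fin D → ℝ) × Fin c)) (hρ : ρ.map Prod.fst ≪ volume)
    (X : ℕ → Ω → Fin D → ℝ) (Y : ℕ → Ω → Fin c)
    (hX : ∀ t, Measurable (X t)) (hY : ∀ t, Measurable (Y t))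
    (hXYlaw : ∀ t, P.map (fun ω => (X t ω, Y t ω)) = ρ)
    (hXYindep : iIndepFun (fun t ω => (X t ω, Y t ω)) P)
    (Z : OnlineForest.Node → Ω → Finset (Fin D)) (hZ : ∀ v, Measurable (Z v))
    (hZlaw : ∀ v S, P {ω | Z v ω = S} = OnlineForest.dimsProb lam D S)
    (hZindep : iIndepFun Z P)
    (hXYZ : IndepFun (fun ω t => (X t ω, Y t ω)) (fun ω v => Z v ω) P) :
    -- for every fixed partitioning sequence
    (∀ i : ℕ → OnlineForest.PointType,
      (∃ᶠ t in atTop, i t = .structural) → (∃ᶠ t in atTop, i t = .estimation) →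
      OnlineForest.LeavesEnterFringe P prm ρ X Y (fun t _ => i t) Z) ∧
    -- for points assigned to the streams at random with fixed probabilities
    (∀ (I : ℕ → Ω → OnlineForest.PointType) (p : ℝ), 0 < p → p < 1 →
      (∀ t, Measurable (I t)) → (∀ t, P.real {ω | I t ω = .estimation} = p) → iIndepFun I P →
      IndepFun (fun ω t => I t ω) (fun ω => (fun t => (X t ω, Y t ω), fun v => Z v ω)) P →
      OnlineForest.LeavesEnterFringe P prm ρ X Y I Z) := by
  refine ⟨fun i hs he => ?_, fun I p hp0 hp1 hI hIp hIind hIXYZ => ?_⟩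
  · refine OnlineForest.leavesEnterFringe hD hm hF hαpos hαtop hρ hX hY hXYlaw hXYindep hZ hZlaw
      hXYZ (fun _ => measurable_const) (.of_forall fun _ k => ?_) (indepFun_const_left i _)
    cases k with
    | structural => exact Nat.frequently_atTop_iff_infinite.1 hs
    | estimation => exact Nat.frequently_atTop_iff_infinite.1 he
  · exact OnlineForest.leavesEnterFringe hD hm hF hαpos hαtop hρ hX hY hXYlaw hXYindep hZ hZlaw
      hXYZ hI (OnlineForest.ae_infinite_type hp0 hp1 hI hIp hIind) hIXYZ
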